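/- **Setting.** Let $f(\theta)=\frac1n\sum_{i=1}^n f_i(\theta)$ on $\mathbb R^d$, $n\ge 1$, where $f_i(\theta)=\mathbb E_{\zeta\sim\mu_i}[f_i(\theta;\zeta)]$ is continuously differentiable (possibly non-convex) and $f$ is bounded below, $f^\star=\inf f$. Assume: 1. For some $L\ge 0$, every $i$ and $\mu_i$-almost every $\zeta$, $f_i(\cdot;\zeta)$ is differentiable with $L$-Lipschitz gradient. 2. $W\in\mathbb R_+^{n\times n}$ is supported on the edges (and self-loops) of an undirected graph on $\{1,\dots,n\}$, $W\mathbf 1=W^\top\mathbf 1=\mathbf 1$; with $U\in\mathbb R^{n\times(n-1)}$ having orthonormal columns and $I-\frac1n\mathbf 1\mathbf 1^\top=UU^\top$, one has $\|U^\top WU\|\le 1-\rho$ for some $\rho\in(0,1]$; and $\|W-I\|\le\bar\omega$ for some $\bar\omega\in(0,2]$ (spectral norms). 3. For some $\sigma\ge0$, all $i$ and all $\theta$: $\mathbb E_{\zeta\sim\mu_i}[\nabla f_i(\theta;\zeta)]=\nabla f_i(\theta)$ and $\mathbb E_{\zeta\sim\mu_i}\|\nabla f_i(\theta;\zeta)-\nabla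 f_i(\theta)\|^2\le\sigma^2$. 4. The compressor returns the random vector $\mathcal Q(x)=\tilde{\mathcal Q}(x;\xi)$, $\xi\sim\pi_x$, with $\mathbb E\|x-\mathcal Q(x)\|^2\le(1-\delta)\|x\|^2$ for all $x\in\mathbb R^d$, for some $\delta\in(0,1]$. **Algorithm (DoCoM-SGT).** Given $\eta>0$, $\gamma\in(0,1]$, $\beta\in(0,1)$, $b_0\ge1$ and $\bar\theta^0\in\mathbb R^d$, set $\theta_i^0=\hat\theta_i^0=\bar\theta^0$, $v_i^0=g_i^0=\frac1{b_0}\sum_{r=1}^{b_0}\nabla f_i(\bar\theta^0;\zeta_i^{0,r})$ and $\hat g_i^0=0$, where the $\zeta_i^{0,r}\sim\mu_i$ are independent. For $t\ge0$, with samples $\zeta_i^{t+1}\sim\mu_i$ independent across agents and of everything drawn before, and with fresh compressor randomness in every compression step, $$\hat\theta_i^{t+1}=\hat\theta_i^t+\mathcal Q(\theta_i^t-\eta g_i^t-\hat\theta_i^t),\qquad \theta_i^{t+1}=\theta_i^t-\eta g_i^t+\gamma\sum_jW_{ij}(\hat\theta_j^{t+1}-\hat\theta_i^{t+1}),$$ $$v_i^{t+1}=\beta\nabla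 f_i(\theta_i^{t+1};\zeta_i^{t+1})+(1-\beta)\big[v_i^t+\nabla f_i(\theta_i^{t+1};\zeta_i^{t+1})-\nabla f_i(\theta_i^t;\zeta_i^{t+1})\big],$$ $$\hat g_i^{t+1}=\hat g_i^t+\mathcal Q(g_i^t+v_i^{t+1}-v_i^t-\hat g_i^t),\qquad g_i^{t+1}=g_i^t+v_i^{t+1}-v_i^t+\gamma\sum_jW_{ij}(\hat g_j^{t+1}-\hat g_i^{t+1}).$$ Write $\bar\theta^t=\frac1n\sum_i\theta_i^t$, $\overline G_0=\frac1n\mathbb E\sum_i\|g_i^0\|^2$, $\bar\beta=\min\{\frac{\rho\gamma}8,\frac{\delta\gamma}8,\beta\}$ and $$\gamma_\infty=\min\Big\{\tfrac1{4\rho},\tfrac{\rho n}{64\bar\omega^2},\tfrac{\delta}{10\bar\omega},\tfrac{\delta\rho\sqrt{1-\gamma}}{259\bar\omega^2}\Big\},\qquad \eta_\infty=\frac\gamma L\min\Big\{\sqrt{\tfrac{1-\beta}{\beta n}}\,\tfrac{\sqrt{\gamma\rho^3}}{45},\tfrac{\rho^2}{240\bar\omega}\Big\},$$ $$\mathbb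 C_\sigma=4+\frac{\eta^2}{\gamma^3}\frac{672L^2n}{\rho^3}+\frac{\eta^2}{\gamma}\frac{6L^2n\rho^4\delta}{25\bar\omega^2}+\frac{\eta^2}{\gamma^2}\frac{4L^2n}{\bar\omega^2},$$ $$\mathbb C_{\bar g}=8(1-\beta)^2L^2(1-\rho\gamma)^2+\frac{L^2n}{\rho\gamma}\Big(96+\frac{141}{400}\frac{\rho^2}{\bar\omega^2}\Big).$$ **Theorem.** (a) Suppose $\gamma\le\gamma_\infty$ and $\eta\le\min\{\eta_\infty,\sqrt{\bar\beta n/(8\mathbb C_{\bar g})}\}$ (for $L=0$ both bounds on $\eta$ are read as $+\infty$). Then all expectations below are finite and for every $T\ge1$ $$\frac1T\sum_{t=0}^{T-1}\mathbb E\Big[\frac12\|\nabla f(\bar\theta^t)\|^2+\frac{L^2}n\sum_{i=1}^n\|\theta_i^t-\bar\theta^t\|^2\Big]\le\frac{f(\bar\theta^0)-f^\star}{\eta T/2}+\mathbb C_\sigma\frac{2\beta^2\sigma^2}{\bar\beta n}+\frac{4\sigma^2}{b_0\bar\beta Tn}+\frac{\eta^2}{\bar\beta T}\frac{384L^2\overline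 G_0}{\rho^2\gamma^2(1-\gamma)}.$$ (b) Let $L>0$. For all constants $0<a_\beta\le A_\beta$, $0<a_\eta\le A_\eta$ and $a_b>0$ there is a constant $C$, depending only on these five numbers, such that for every instance satisfying the assumptions there is $T_0$ such that for all $T\ge T_0$: if the step size conditions of (a) hold, $\gamma=\gamma_\infty$, $\beta\in[a_\beta,A_\beta]\cdot n^{1/3}T^{-2/3}$, $\eta\in[a_\eta,A_\eta]\cdot n^{2/3}L^{-1}T^{-1/3}$ and $b_0\ge a_b\,T^{1/3}n^{-2/3}$, then $$\frac1T\sum_{t=0}^{T-1}\frac1n\sum_{i=1}^n\mathbb E\|\nabla f(\theta_i^t)\|^2\le C\left(\frac{L(f(\bar\theta^0)-f^\star)}{(nT)^{2/3}}+\frac{\sigma^2}{(nT)^{2/3}}+\frac{n\overline G_0}{\delta^2\rho^4T}+\frac{\sigma^2n^{5/3}}{\delta^3\rho^6T^{4/3}}\right),$$ that is, the iterate at an independent uniformly random time in $\{0,\dots,T-1\}$ is $O(T^{-2/3})$-stationary. (c) Such parameters exist: for all $n\ge1$, $L>0$, $\rho,\delta\in(0,1]$ and $\bar\omega\in(0,2]$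 there is $\gamma$ with $\gamma=\gamma_\infty$, and for every $c_\beta>0$ there is $c>0$ such that for every $c_\eta\in(0,c]$ and all sufficiently large $T$ the parameters $\beta=c_\beta n^{1/3}T^{-2/3}$, $\eta=c_\eta n^{2/3}L^{-1}T^{-1/3}$ and $\gamma$ satisfy the step size conditions of (a). -/

import Mathlib

open MeasureTheory ProbabilityTheory

noncomputable section

namespace DoCoM

/-- The parameter space `ℝ^d` with the Euclidean norm. -/
abbrev Vec (d : ℕ) : Type := EuclideanSpace ℝ (Fin d)

/-- The data of a decentralized stochastic optimization problem with `n` agents on `ℝ^d`,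
samples in `Z`, and a stochastic compressor with internal randomness in `Ξ`. -/
structure Setup (n d : ℕ) (Z Ξ : Type*) [MeasurableSpace Z] [MeasurableSpace Ξ] where
  /-- the sample loss `f_i(θ; ζ)` of agent `i` -/
  loss : Fin n → Vec d → Z → ℝ
  /-- the data distribution `μ_i` of agent `i` -/
  dist : Fin n → Measure Z
  /-- the communication graph; self-loops are always available and are not recorded -/
  graph : SimpleGraph (Fin n)
  /-- the weighted adjacency (mixing) matrix -/
  W : Matrix (Fin n) (Fin n) ℝ
  /-- the compressor output `Q(x; ξ)` -/
  comp : Vec d → Ξ → Vec d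
  /-- the law `π_x` of the internal randomness `ξ` of the compressor on input `x` -/
  compLaw : Kernel (Vec d) Ξ

section Objectives

variable {n d : ℕ} {Z Ξ : Type*} [MeasurableSpace Z] [MeasurableSpace Ξ]

/-- The stochastic gradient `∇f_i(θ; ζ)`. -/
def Setup.stochGrad (S : Setup n d Z Ξ) (i : Fin n) (θ : Vec d) (z : Z) : Vec d :=
  gradient (fun x => S.loss i x z) θ

/-- The local objective `f_i(θ) = E_{ζ ∼ μ_i} f_i(θ; ζ)`. -/
def Setup.localObj (S : Setup n d Z Ξ) (i : Fin n) (θ : Vec d) : ℝ :=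
  ∫ z, S.loss i θ z ∂(S.dist i)

/-- The global objective `f(θ) = (1/n) ∑ i, f_i(θ)`. -/
def Setup.obj (S : Setup n d Z Ξ) (θ : Vec d) : ℝ :=
  (1 / (n : ℝ)) * ∑ i, S.localObj i θ

/-- The optimal value of `f`. -/
def Setup.optVal (S : Setup n d Z Ξ) : ℝ := ⨅ θ, S.obj θ

/-! ### Assumptions -/

/-- Standing regularity: the objects are well defined and measurable, the local objectives are
continuously differentiable, and the global objective is bounded below. -/
structure Setup.Regular (S : Setup n d Z Ξ) : Prop where
  dist_prob : ∀ i, IsProbabilityMeasure (S.dist i)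
  loss_integrable : ∀ i θ, Integrable (fun z => S.loss i θ z) (S.dist i)
  loss_differentiable : ∀ i, ∀ᵐ z ∂(S.dist i), Differentiable ℝ (fun θ => S.loss i θ z)
  stochGrad_measurable : ∀ i, Measurable (fun p : Vec d × Z => S.stochGrad i p.1 p.2)
  localObj_contDiff : ∀ i, ContDiff ℝ 1 (S.localObj i)
  obj_bddBelow : BddBelow (Set.range S.obj)
  comp_measurable : Measurable (fun p : Vec d × Ξ => S.comp p.1 p.2)
  compLaw_markov : IsMarkovKernel S.compLaw

/-- Smoothness: for every agent, the gradients of the sample losses are `L`-Lipschitz, for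
(almost) all samples. -/
def Setup.Smooth (S : Setup n d Z Ξ) (L : ℝ) : Prop :=
  0 ≤ L ∧ ∀ i, ∀ᵐ z ∂(S.dist i), ∀ θ θ' : Vec d,
    ‖S.stochGrad i θ z - S.stochGrad i θ' z‖ ≤ L * ‖θ - θ'‖

open scoped Matrix.Norms.L2Operator in
/-- The assumptions on the mixing matrix; the norms are spectral norms. -/
structure Setup.Mixing (S : Setup n d Z Ξ) (ρ ω : ℝ) : Prop where
  nonneg : ∀ i j, 0 ≤ S.W i j
  graph_topology : ∀ i j, i ≠ j → ¬ S.graph.Adj i j → S.W i j = 0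
  row_sum : ∀ i, ∑ j, S.W i j = 1
  col_sum : ∀ j, ∑ i, S.W i j = 1
  rho_pos : 0 < ρ
  rho_le_one : ρ ≤ 1
  mixing : ∃ U : Matrix (Fin n) (Fin (n - 1)) ℝ,
    U.transpose * U = 1 ∧
    (1 : Matrix (Fin n) (Fin n) ℝ) - Matrix.of (fun _ _ => 1 / (n : ℝ)) = U * U.transpose ∧
    ‖U.transpose * S.W * U‖ ≤ 1 - ρ
  omega_pos : 0 < ω
  omega_le_two : ω ≤ 2
  bounded_eigenvalue : ‖S.W - 1‖ ≤ ω

/-- The stochastic gradients are unbiased with variance at most `σ²`. -/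
structure Setup.BoundedVariance (S : Setup n d Z Ξ) (σ : ℝ) : Prop where
  sigma_nonneg : 0 ≤ σ
  integrable : ∀ i θ, Integrable (fun z => S.stochGrad i θ z) (S.dist i)
  unbiased : ∀ i θ, ∫ z, S.stochGrad i θ z ∂(S.dist i) = gradient (S.localObj i) θ
  variance_integrable : ∀ i θ,
    Integrable (fun z => ‖S.stochGrad i θ z - gradient (S.localObj i) θ‖ ^ 2) (S.dist i)
  variance_le : ∀ i θ,
    ∫ z, ‖S.stochGrad i θ z - gradient (S.localObj i) θ‖ ^ 2 ∂(S.dist i) ≤ σ ^ 2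

/-- The compressor is a `δ`-contraction in mean square. -/
structure Setup.Contractive (S : Setup n d Z Ξ) (δ : ℝ) : Prop where
  delta_pos : 0 < δ
  delta_le_one : δ ≤ 1
  error_integrable : ∀ x, Integrable (fun s => ‖x - S.comp x s‖ ^ 2) (S.compLaw x)
  error_le : ∀ x, ∫ s, ‖x - S.comp x s‖ ^ 2 ∂(S.compLaw x) ≤ (1 - δ) * ‖x‖ ^ 2

/-- All assumptions together. -/
structure Setup.Assumptions (S : Setup n d Z Ξ) (L ρ ω σ δ : ℝ) : Prop where
  regular : S.Regular
  smooth : S.Smooth L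
  mixing : S.Mixing ρ ω
  boundedVariance : S.BoundedVariance σ
  contractive : S.Contractive δ

end Objectives

/-! ### The algorithm -/

/-- The variables of the algorithm, one vector per agent. -/
structure State (n d : ℕ) where
  θ : Fin n → Vec d
  θhat : Fin n → Vec d
  v : Fin n → Vec d
  g : Fin n → Vec d
  ghat : Fin n → Vec d

/-- All random inputs of a run: the initial batches, and for each iteration `t` the fresh samples
`ζ_i^{t+1}` and the randomness of the two compression steps of each agent. -/
structure Draws (n b₀ : ℕ) (Z Ξ : Type*) where
  /-- `ζ_i^{0,r}` -/
  init : Fin n → Fin b₀ → Z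
  /-- `sample t i` is `ζ_i^{t+1}` -/
  sample : ℕ → Fin n → Z
  /-- randomness of the compression step for the iterates, in iteration `t` -/
  noiseθ : ℕ → Fin n → Ξ
  /-- randomness of the compression step for the gradient trackers, in iteration `t` -/
  noiseg : ℕ → Fin n → Ξ

/-- The parameters of the algorithm: step sizes `η`, `γ`, momentum `β`, initial batch number `b₀`
and initial iterate. -/
structure Params (d : ℕ) where
  η : ℝ
  γ : ℝ
  β : ℝ
  b₀ : ℕ
  θ₀ : Vec d

section Algorithm

variable {n d : ℕ} {Z Ξ : Type*} [MeasurableSpace Z] [MeasurableSpace Ξ]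

/-- Initialization. -/
def initState (S : Setup n d Z Ξ) {b₀ : ℕ} (θ₀ : Vec d) (z : Fin n → Fin b₀ → Z) : State n d :=
  let v₀ : Fin n → Vec d := fun i => (1 / (b₀ : ℝ)) • ∑ r, S.stochGrad i θ₀ (z i r)
  { θ := fun _ => θ₀
    θhat := fun _ => θ₀
    v := v₀
    g := v₀
    ghat := fun _ => 0 }

/-- Input of the first compressor: `θ_i^t - η g_i^t - θhat_i^t`. -/
def inputθ (η : ℝ) (s : State n d) (i : Fin n) : Vec d :=
  s.θ i - η • s.g i - s.θhat i

/-- `θhat_i^{t+1}`. -/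
def nextθhat (S : Setup n d Z Ξ) (η : ℝ) (s : State n d) (ξ : Fin n → Ξ) (i : Fin n) : Vec d :=
  s.θhat i + S.comp (inputθ η s i) (ξ i)

/-- `θ_i^{t+1}`. -/
def nextθ (S : Setup n d Z Ξ) (η γ : ℝ) (s : State n d) (ξ : Fin n → Ξ) (i : Fin n) : Vec d :=
  s.θ i - η • s.g i +
    γ • ∑ j, S.W i j • (nextθhat S η s ξ j - nextθhat S η s ξ i)

/-- `v_i^{t+1}`; both stochastic gradients use the same fresh sample. -/
def nextv (S : Setup n d Z Ξ) (η γ β : ℝ) (s : State n d) (ξ : Fin n → Ξ) (z : Fin n → Z)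
    (i : Fin n) : Vec d :=
  β • S.stochGrad i (nextθ S η γ s ξ i) (z i) +
    (1 - β) • (s.v i + S.stochGrad i (nextθ S η γ s ξ i) (z i) - S.stochGrad i (s.θ i) (z i))

/-- Input of the second compressor: `g_i^t + v_i^{t+1} - v_i^t - ghat_i^t`. -/
def inputg (S : Setup n d Z Ξ) (η γ β : ℝ) (s : State n d) (ξ : Fin n → Ξ) (z : Fin n → Z)
    (i : Fin n) : Vec d :=
  s.g i + nextv S η γ β s ξ z i - s.v i - s.ghat i

/-- `ghat_i^{t+1}`. -/
def nextghat (S : Setup n d Z Ξ) (η γ β : ℝ) (s : State n d) (ξ : Fin n → Ξ) (z : Fin n → Z)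
    (χ : Fin n → Ξ) (i : Fin n) : Vec d :=
  s.ghat i + S.comp (inputg S η γ β s ξ z i) (χ i)

/-- `g_i^{t+1}`. -/
def nextg (S : Setup n d Z Ξ) (η γ β : ℝ) (s : State n d) (ξ : Fin n → Ξ) (z : Fin n → Z)
    (χ : Fin n → Ξ) (i : Fin n) : Vec d :=
  s.g i + nextv S η γ β s ξ z i - s.v i +
    γ • ∑ j, S.W i j • (nextghat S η γ β s ξ z χ j - nextghat S η γ β s ξ z χ i)

/-- One iteration. -/
def step (S : Setup n d Z Ξ) (η γ β : ℝ) (s : State n d) (ξ : Fin n → Ξ) (z : Fin n → Z)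
    (χ : Fin n → Ξ) : State n d where
  θ := nextθ S η γ s ξ
  θhat := nextθhat S η s ξ
  v := nextv S η γ β s ξ z
  g := nextg S η γ β s ξ z χ
  ghat := nextghat S η γ β s ξ z χ

/-- The state after `t` iterations, for given random inputs. -/
def iter (S : Setup n d Z Ξ) (p : Params d) (D : Draws n p.b₀ Z Ξ) : ℕ → State n d
  | 0 => initState S p.θ₀ D.init
  | t + 1 => step S p.η p.γ p.β (iter S p D t) (D.noiseθ t) (D.sample t) (D.noiseg t)

/-- The averaged iterate. -/
def avgθ (s : State n d) : Vec d := (1 / (n : ℝ)) • ∑ i, s.θ i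

/-- Everything drawn before the sample of iteration `t`. -/
def Draws.history {b₀ : ℕ} (D : Draws n b₀ Z Ξ) (t : ℕ) :
    (Fin n → Fin b₀ → Z) × (Fin t → Fin n → Z) × (Fin (t + 1) → Fin n → Ξ) ×
      (Fin t → Fin n → Ξ) :=
  (D.init, fun s => D.sample s, fun s => D.noiseθ s, fun s => D.noiseg s)

/-- The law of the random inputs: all initial samples are independent, agent `i` draws from `μ_i`;
in each iteration the fresh samples are independent across agents and of everything drawn before;
and in each compression step the randomness is drawn from `π_x` given the input `x`. No joint law
of the compressor randomness of different agents is imposed. -/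
structure IsRun (S : Setup n d Z Ξ) (p : Params d) {Ω : Type*} [MeasurableSpace Ω]
    (P : Measure Ω) (D : Ω → Draws n p.b₀ Z Ξ) : Prop where
  init_measurable : ∀ i r, Measurable (fun ω => (D ω).init i r)
  sample_measurable : ∀ t i, Measurable (fun ω => (D ω).sample t i)
  noiseθ_measurable : ∀ t i, Measurable (fun ω => (D ω).noiseθ t i)
  noiseg_measurable : ∀ t i, Measurable (fun ω => (D ω).noiseg t i)
  init_law : ∀ i r, P.map (fun ω => (D ω).init i r) = S.dist i
  init_indep : iIndepFun (fun (ir : Fin n × Fin p.b₀) ω => (D ω).init ir.1 ir.2) P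
  sample_law : ∀ t i, P.map (fun ω => (D ω).sample t i) = S.dist i
  sample_indep : ∀ t, iIndepFun (fun (i : Fin n) ω => (D ω).sample t i) P
  sample_indep_history : ∀ t,
    IndepFun (fun ω => (D ω).sample t) (fun ω => (D ω).history t) P
  noiseθ_law : ∀ t i, HasCondDistrib (fun ω => (D ω).noiseθ t i)
    (fun ω => inputθ p.η (iter S p (D ω) t) i) S.compLaw P
  noiseg_law : ∀ t i, HasCondDistrib (fun ω => (D ω).noiseg t i)
    (fun ω => inputg S p.η p.γ p.β (iter S p (D ω) t) ((D ω).noiseθ t) ((D ω).sample t) i)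
    S.compLaw P

/-- `(1/n) E ∑ i, ‖g_i^0‖²`. -/
def initGrad (S : Setup n d Z Ξ) (p : Params d) {Ω : Type*} [MeasurableSpace Ω]
    (P : Measure Ω) (D : Ω → Draws n p.b₀ Z Ξ) : ℝ :=
  (1 / (n : ℝ)) * ∫ ω, ∑ i, ‖(iter S p (D ω) 0).g i‖ ^ 2 ∂P

/-- `½ ‖∇f(θbar)‖² + (L²/n) ∑ i, ‖θ_i - θbar‖²`. -/
def merit (S : Setup n d Z Ξ) (L : ℝ) (s : State n d) : ℝ :=
  1 / 2 * ‖gradient S.obj (avgθ s)‖ ^ 2 + L ^ 2 / (n : ℝ) * ∑ i, ‖s.θ i - avgθ s‖ ^ 2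

end Algorithm

/-! ### Constants -/

/-- `γ_∞`. -/
def gammaInf (n : ℕ) (ρ ω δ γ : ℝ) : ℝ :=
  min (min (1 / (4 * ρ)) (ρ * n / (64 * ω ^ 2)))
    (min (δ / (10 * ω)) (δ * ρ * √(1 - γ) / (259 * ω ^ 2)))

/-- `η_∞`. -/
def etaInf (n : ℕ) (L ρ ω γ β : ℝ) : ℝ :=
  γ / L * min (√((1 - β) / (β * n)) * (√(γ * ρ ^ 3) / 45)) (ρ ^ 2 / (240 * ω))

/-- `β̄ = min {ργ/8, δγ/8, β}`. -/
def betaBar (ρ δ γ β : ℝ) : ℝ := min (min (ρ * γ / 8) (δ * γ / 8)) β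

/-- The constant `C_σ`. -/
def Csigma (n : ℕ) (L ρ ω δ η γ : ℝ) : ℝ :=
  4 + η ^ 2 / γ ^ 3 * (672 * L ^ 2 * n / ρ ^ 3)
    + η ^ 2 / γ * (6 * L ^ 2 * n * ρ ^ 4 * δ / (25 * ω ^ 2))
    + η ^ 2 / γ ^ 2 * (4 * L ^ 2 * n / ω ^ 2)

/-- The constant `C_ḡ`. -/
def Cgbar (n : ℕ) (L ρ ω γ β : ℝ) : ℝ :=
  8 * (1 - β) ^ 2 * L ^ 2 * (1 - ρ * γ) ^ 2
    + L ^ 2 * n / (ρ * γ) * (96 + 141 / 400 * (ρ ^ 2 / ω ^ 2))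

/-- The conditions on `η`, `γ`, `β`. For `L = 0` both bounds on `η` have a vanishing denominator;
they are `+∞` and do not restrict `η`. -/
structure StepSizes (n : ℕ) (L ρ ω δ η γ β : ℝ) : Prop where
  eta_pos : 0 < η
  gamma_pos : 0 < γ
  gamma_le_one : γ ≤ 1
  beta_pos : 0 < β
  beta_lt_one : β < 1
  gamma_le : γ ≤ gammaInf n ρ ω δ γ
  eta_le : 0 < L →
    η ≤ min (etaInf n L ρ ω γ β) √(betaBar ρ δ γ β * n / (8 * Cgbar n L ρ ω γ β))

/-- The right-hand side of the main bound, with `Δ₀ = f(θbar⁰) - f⋆` and `G₀` the initial expected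
squared gradient norm. -/
def mainBound (n : ℕ) (L ρ ω σ δ η γ β : ℝ) (b₀ T : ℕ) (Δ₀ G₀ : ℝ) : ℝ :=
  Δ₀ / (η * T / 2)
    + Csigma n L ρ ω δ η γ * (2 * β ^ 2 * σ ^ 2 / (betaBar ρ δ γ β * n))
    + 4 * σ ^ 2 / (b₀ * betaBar ρ δ γ β * T * n)
    + η ^ 2 / (betaBar ρ δ γ β * T) * (384 * L ^ 2 * G₀ / (ρ ^ 2 * γ ^ 2 * (1 - γ)))

/-- The rate, up to a constant factor. -/
def rateBound (n : ℕ) (L ρ σ δ : ℝ) (T : ℕ) (Δ₀ G₀ : ℝ) : ℝ :=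
  L * Δ₀ / ((n : ℝ) * T) ^ (2 / 3 : ℝ)
    + σ ^ 2 / ((n : ℝ) * T) ^ (2 / 3 : ℝ)
    + n * G₀ / (δ ^ 2 * ρ ^ 4 * T)
    + σ ^ 2 * (n : ℝ) ^ (5 / 3 : ℝ) / (δ ^ 3 * ρ ^ 6 * (T : ℝ) ^ (4 / 3 : ℝ))

/-- The scale `n^{1/3} / T^{2/3}` of the momentum. -/
def betaScale (n T : ℕ) : ℝ := (n : ℝ) ^ (1 / 3 : ℝ) / (T : ℝ) ^ (2 / 3 : ℝ)

/-- The scale `n^{2/3} / (L T^{1/3})` of the step size. -/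
def etaScale (n : ℕ) (L : ℝ) (T : ℕ) : ℝ :=
  (n : ℝ) ^ (2 / 3 : ℝ) / (L * (T : ℝ) ^ (1 / 3 : ℝ))

/-- The scale `T^{1/3} / n^{2/3}` of the initial batch number. -/
def batchScale (n T : ℕ) : ℝ := (T : ℝ) ^ (1 / 3 : ℝ) / (n : ℝ) ^ (2 / 3 : ℝ)

end DoCoM

end

/-! Bars denote averages over the agents. Because W has unit row and column sums, gossip leaves
averages unchanged. Hence ḡ = v̄ at all times and θ̄ moves by exactly −η v̄ (`avg_g_eq_avg_v`,
`avg_θ_succ`), so θ̄ performs inexact gradient descent on f. Per step, `obj_avg_sub_smul_le` yields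
a decrease of η(½‖∇f(θ̄)‖² + ¼‖v̄‖²), up to η times the consensus error (L²/n)∑‖θ_i − θ̄‖² and the
squared error of v̄. It remains to show that the sums of these two errors over time are paid for by
the ¼‖v̄‖² terms, the sampling noise and the initial values.

Momentum: the same fresh sample is used at the new and the old iterate, so the error of v shrinks by
1−β and receives centered noise of variance O(β²σ² + L²‖step‖²) (`momentum_sub_gradStack`,
`integral_norm_noise_sq_le`). Independence across agents makes the noise in v̄ smaller by a factor
n.

Consensus: iterates and trackers undergo the same compressed gossip step x + u + γ(W−I)(x + u + q),
with increment u and compression error q. The disagreement contracts by 1−ργ/2 and the distance to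
the compressed copies by 1−2δ/5. Each feeds the other, with small gain because γ is small. The
recursions are summed over time directly, without a Lyapunov function (`GossipConsts.sum_le`).

One loop remains: step lengths drive the increments of v, these drive the tracker disagreement, and
this drives the step lengths. Its gain is of order (ηLω/(ρ²γ))², and `StepConsts.closed_loop` solves
it; `StepConsts.sum_le` then collects the constants. The estimate needs ρ ≤ ω, which holds for n ≥ 2
(`Setup.Mixing.rho_le_omega`); a single agent has no disagreement and is treated directly. Together
this gives `sum_merit_le`, and (a) is a weakening of it.

For (b), once T is large β̄ equals β and the network term in the noise coefficient is at most a
constant, while a fixed point of γ_∞ is at least δρ/1500; what is left is counting powers of n^{1/3}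
and T^{1/3} (`bound_le_rate`). For (c), the fixed point comes from the intermediate value theorem.
The bound η_∞ stays away from zero while η tends to zero, whereas the other bound on η has the same
order as η and forces c_η to be small. -/

noncomputable section

namespace DoCoM

/-! ### Stacks of vectors, one per agent -/

section Stacks

variable {n d : ℕ}

/-- The average over the agents. -/
def avg (x : Fin n → Vec d) : Vec d := (1 / (n : ℝ)) • ∑ i, x i

/-- The squared Frobenius norm of a stack. -/
def sq (x : Fin n → Vec d) : ℝ := ∑ i, ‖x i‖ ^ 2

/-- The deviation from the average. -/
def dev (x : Fin n → Vec d) : Fin n → Vec d := fun i => x i - avg x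

/-- The action of `W - I` for a matrix `W` with unit row sums. -/
def lap (W : Matrix (Fin n) (Fin n) ℝ) (x : Fin n → Vec d) : Fin n → Vec d :=
  fun i => ∑ j, W i j • (x j - x i)

lemma sq_nonneg' (x : Fin n → Vec d) : 0 ≤ sq x := Finset.sum_nonneg fun _ _ => by positivity

/-- After the triangle inequality the gap is the square (a‖x‖ − ‖y‖)²/a. The weight a stays free so
that each recursion below can spend exactly the part of its contraction that it can afford. -/
lemma norm_add_sq_le_young {E : Type*} [NormedAddCommGroup E] (x y : E)
    {a : ℝ} (ha : 0 < a) :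
    ‖x + y‖ ^ 2 ≤ (1 + a) * ‖x‖ ^ 2 + (1 + 1 / a) * ‖y‖ ^ 2 := by
  have h1 : ‖x + y‖ ^ 2 ≤ (‖x‖ + ‖y‖) ^ 2 := by gcongr; exact norm_add_le x y
  have h2 : (1 + a) * ‖x‖ ^ 2 + (1 + 1 / a) * ‖y‖ ^ 2 - (‖x‖ + ‖y‖) ^ 2
      = (a * ‖x‖ - ‖y‖) ^ 2 / a := by field_simp; ring
  have h3 : 0 ≤ (a * ‖x‖ - ‖y‖) ^ 2 / a := by positivity
  linarith

lemma sq_add_le_young (x y : Fin n → Vec d) {a : ℝ} (ha : 0 < a) :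
    sq (x + y) ≤ (1 + a) * sq x + (1 + 1 / a) * sq y := by
  unfold sq
  rw [Finset.mul_sum, Finset.mul_sum, ← Finset.sum_add_distrib]
  exact Finset.sum_le_sum fun i _ => norm_add_sq_le_young (x i) (y i) ha

lemma sq_add_le_two (x y : Fin n → Vec d) : sq (x + y) ≤ 2 * sq x + 2 * sq y := by
  have := sq_add_le_young x y one_pos
  linarith

lemma sq_smul (c : ℝ) (x : Fin n → Vec d) : sq (c • x) = c ^ 2 * sq x := by
  simp only [sq, Pi.smul_apply, norm_smul, mul_pow, Finset.mul_sum, Real.norm_eq_abs, sq_abs]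

lemma sq_neg (x : Fin n → Vec d) : sq (-x) = sq x := by
  simp [sq]

lemma avg_add (x y : Fin n → Vec d) : avg (x + y) = avg x + avg y := by
  simp [avg, Finset.sum_add_distrib]

lemma avg_smul (c : ℝ) (x : Fin n → Vec d) : avg (c • x) = c • avg x := by
  simp [avg, ← Finset.smul_sum, smul_comm c]

lemma avg_sub (x y : Fin n → Vec d) : avg (x - y) = avg x - avg y := by
  simp [avg, smul_sub]

lemma avg_const (hn : 1 ≤ n) (c : Vec d) : avg (fun _ : Fin n => c) = c := by
  have : (n : ℝ) ≠ 0 := by positivity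
  simp [avg, ← Nat.cast_smul_eq_nsmul ℝ, smul_smul, this]

lemma dev_add (x y : Fin n → Vec d) : dev (x + y) = dev x + dev y := by
  ext1 i; simp only [dev, avg_add, Pi.add_apply]; abel

lemma dev_smul (c : ℝ) (x : Fin n → Vec d) : dev (c • x) = c • dev x := by
  ext1 i; simp only [dev, avg_smul, Pi.smul_apply, smul_sub]

lemma sum_eq_card_smul_avg (hn : 1 ≤ n) (x : Fin n → Vec d) : ∑ i, x i = (n : ℝ) • avg x := by
  have : (n : ℝ) ≠ 0 := by positivity
  simp [avg, smul_smul, this]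

/-- Pythagoras: deviations sum to zero, so they are orthogonal to constant stacks. -/
lemma sq_eq_avg_add_dev (hn : 1 ≤ n) (x : Fin n → Vec d) :
    sq x = n * ‖avg x‖ ^ 2 + sq (dev x) := by
  have h0 : ∑ i, dev x i = 0 := by
    simp only [dev, Finset.sum_sub_distrib, sum_eq_card_smul_avg hn x]
    simp [← Nat.cast_smul_eq_nsmul ℝ]
  have h1 : ∀ i, ‖x i‖ ^ 2 = ‖avg x‖ ^ 2 + ‖dev x i‖ ^ 2 + 2 * inner ℝ (avg x) (dev x i) := by
    intro i
    have : x i = avg x + dev x i := by simp [dev]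
    conv_lhs => rw [this]
    rw [norm_add_sq_real]; ring
  unfold sq
  rw [Finset.sum_congr rfl fun i _ => h1 i, Finset.sum_add_distrib, Finset.sum_add_distrib,
    ← Finset.mul_sum, ← inner_sum, h0]
  simp

lemma sq_dev_le (hn : 1 ≤ n) (x : Fin n → Vec d) : sq (dev x) ≤ sq x := by
  rw [sq_eq_avg_add_dev hn x]
  have : (0 : ℝ) ≤ n * ‖avg x‖ ^ 2 := by positivity
  linarith

lemma card_mul_norm_avg_sq_le (hn : 1 ≤ n) (x : Fin n → Vec d) : n * ‖avg x‖ ^ 2 ≤ sq x := by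
  rw [sq_eq_avg_add_dev hn x]
  linarith [sq_nonneg' (dev x)]

lemma lap_add (W : Matrix (Fin n) (Fin n) ℝ) (x y : Fin n → Vec d) :
    lap W (x + y) = lap W x + lap W y := by
  ext1 i
  simp only [lap, Pi.add_apply, ← Finset.sum_add_distrib, ← smul_add]
  refine Finset.sum_congr rfl fun j _ => ?_
  congr 1; abel

/-- Only differences enter, so constants drop out. Gossip moves are therefore controlled by the
disagreement and not by the size of the stack. -/
lemma lap_dev (W : Matrix (Fin n) (Fin n) ℝ) (x : Fin n → Vec d) : lap W (dev x) = lap W x := by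
  ext1 i; simp [lap, dev]

/-- The unit column sums enter here; this is the reason why averages evolve as if there were no
communication. -/
lemma avg_lap {W : Matrix (Fin n) (Fin n) ℝ} (hr : ∀ i, ∑ j, W i j = 1)
    (hc : ∀ j, ∑ i, W i j = 1) (x : Fin n → Vec d) : avg (lap W x) = 0 := by
  have : ∑ i, lap W x i = 0 := by
    simp only [lap, smul_sub, Finset.sum_sub_distrib, ← Finset.sum_smul, hr, one_smul]
    rw [Finset.sum_comm]
    simp only [← Finset.sum_smul, hc, one_smul, sub_self]
  simp [avg, this]

/-- Mixing acts on the agent index only, so spectral norm bounds can be applied to one coordinate of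
ℝ^d at a time. -/
lemma sq_eq_sum_coord (x : Fin n → Vec d) : sq x = ∑ k, ∑ i, (x i k) ^ 2 := by
  rw [Finset.sum_comm]
  simp [sq, EuclideanSpace.norm_sq_eq]

lemma lap_coord (W : Matrix (Fin n) (Fin n) ℝ) (x : Fin n → Vec d) (i : Fin n) (k : Fin d) :
    lap W x i k = ∑ j, W i j * (x j k - x i k) := by
  simp [lap]

lemma dev_coord (x : Fin n → Vec d) (i : Fin n) (k : Fin d) :
    dev x i k = x i k - (1 / (n : ℝ)) * ∑ j, x j k := by
  simp [dev, avg]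

end Stacks

/-! ### The mixing matrix -/

section Mixing

open scoped Matrix.Norms.L2Operator

lemma sum_sq_mulVec_le {m n : ℕ} (A : Matrix (Fin m) (Fin n) ℝ) (u : Fin n → ℝ) :
    ∑ i, (A.mulVec u i) ^ 2 ≤ ‖A‖ ^ 2 * ∑ j, (u j) ^ 2 := by
  have h := A.l2_opNorm_mulVec (WithLp.toLp 2 u)
  have h2 : ‖(EuclideanSpace.equiv (Fin m) ℝ).symm (A.mulVec u)‖ ^ 2
      ≤ (‖A‖ * ‖(WithLp.toLp 2 u : EuclideanSpace ℝ (Fin n))‖) ^ 2 := by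
    gcongr
  rw [mul_pow, EuclideanSpace.norm_sq_eq, EuclideanSpace.norm_sq_eq] at h2
  simpa using h2

variable {n : ℕ} {W : Matrix (Fin n) (Fin n) ℝ} {U : Matrix (Fin n) (Fin (n - 1)) ℝ}

lemma sub_one_mulVec (hr : ∀ i, ∑ j, W i j = 1) (u : Fin n → ℝ) (i : Fin n) :
    (W - 1).mulVec u i = ∑ j, W i j * (u j - u i) := by
  rw [Matrix.sub_mulVec]
  simp [Matrix.mulVec, dotProduct, mul_sub, Finset.sum_sub_distrib, ← Finset.sum_mul, hr]

lemma centering_mulVec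
    (hJ : (1 : Matrix (Fin n) (Fin n) ℝ) - Matrix.of (fun _ _ => 1 / (n : ℝ)) = U * U.transpose)
    (u : Fin n → ℝ) (i : Fin n) :
    u i - (1 / (n : ℝ)) * ∑ j, u j = U.mulVec (U.transpose.mulVec u) i := by
  rw [Matrix.mulVec_mulVec, ← hJ, Matrix.sub_mulVec]
  simp [Matrix.mulVec, dotProduct, Finset.mul_sum]

lemma sum_sq_mulVec_of_orthonormal (hU : U.transpose * U = 1) (w : Fin (n - 1) → ℝ) :
    ∑ i, (U.mulVec w i) ^ 2 = ∑ k, (w k) ^ 2 := by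
  have : dotProduct (U.mulVec w) (U.mulVec w) = dotProduct w w := by
    rw [Matrix.dotProduct_mulVec, ← Matrix.mulVec_transpose, Matrix.mulVec_mulVec, hU,
      Matrix.one_mulVec]
  simpa [dotProduct, pow_two] using this

lemma sum_sq_centered
    (hU : U.transpose * U = 1)
    (hJ : (1 : Matrix (Fin n) (Fin n) ℝ) - Matrix.of (fun _ _ => 1 / (n : ℝ)) = U * U.transpose)
    (u : Fin n → ℝ) :
    ∑ i, (u i - (1 / (n : ℝ)) * ∑ j, u j) ^ 2 = ∑ k, (U.transpose.mulVec u k) ^ 2 := by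
  rw [← sum_sq_mulVec_of_orthonormal hU]
  exact Finset.sum_congr rfl fun i _ => by rw [centering_mulVec hJ u i]

/-- In the coordinates Uᵀu of the mean-zero space, the gossip matrix I + γ(W−I) reads (1−γ)I +
γUᵀWU, whose norm is at most (1−γ) + γ(1−ρ). -/
lemma sum_sq_centered_mix_le {ρ γ : ℝ} (hr : ∀ i, ∑ j, W i j = 1)
    (hU : U.transpose * U = 1)
    (hJ : (1 : Matrix (Fin n) (Fin n) ℝ) - Matrix.of (fun _ _ => 1 / (n : ℝ)) = U * U.transpose)
    (hW : ‖U.transpose * W * U‖ ≤ 1 - ρ) (h0 : 0 ≤ γ) (h1 : γ ≤ 1) (u u' : Fin n → ℝ)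
    (hu' : ∀ i, u' i = u i + γ * ∑ j, W i j * (u j - u i)) :
    ∑ i, (u' i - (1 / (n : ℝ)) * ∑ j, u' j) ^ 2
      ≤ (1 - ρ * γ) ^ 2 * ∑ i, (u i - (1 / (n : ℝ)) * ∑ j, u j) ^ 2 := by
  rw [sum_sq_centered hU hJ, sum_sq_centered hU hJ]
  set w := U.transpose.mulVec u with hw
  have e1 : u' = u + γ • (W - 1).mulVec u := by
    ext i; simp [hu', sub_one_mulVec hr]
  -- W − I kills constants, so u may be replaced by its projection UUᵀu.
  have e2 : (W - 1).mulVec u = (W - 1).mulVec (U.mulVec w) := by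
    ext i
    rw [sub_one_mulVec hr, sub_one_mulVec hr]
    refine Finset.sum_congr rfl fun j _ => ?_
    rw [hw, ← centering_mulVec hJ, ← centering_mulVec hJ]; ring
  have e3 : U.transpose.mulVec u' = (1 - γ) • w + γ • (U.transpose * W * U).mulVec w := by
    rw [e1, Matrix.mulVec_add, Matrix.mulVec_smul, e2, ← hw, Matrix.mulVec_mulVec,
      Matrix.mulVec_mulVec, Matrix.mul_sub, Matrix.sub_mul, Matrix.mul_one, hU,
      Matrix.sub_mulVec, Matrix.one_mulVec]
    module
  set B := U.transpose * W * U
  have hB := sum_sq_mulVec_le B w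
  have key : ‖(WithLp.toLp 2 ((1 - γ) • w + γ • B.mulVec w) : EuclideanSpace ℝ (Fin (n - 1)))‖
      ≤ (1 - ρ * γ) * ‖(WithLp.toLp 2 w : EuclideanSpace ℝ (Fin (n - 1)))‖ := by
    have hB' := B.l2_opNorm_mulVec (WithLp.toLp 2 w)
    have hB2 : ‖(WithLp.toLp 2 (B.mulVec w) : EuclideanSpace ℝ (Fin (n - 1)))‖
      ≤ (1 - ρ) * ‖(WithLp.toLp 2 w : EuclideanSpace ℝ (Fin (n - 1)))‖ :=
      le_trans hB' (by gcongr)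
    calc _ ≤ ‖(1 - γ) • (WithLp.toLp 2 w : EuclideanSpace ℝ (Fin (n - 1)))‖
          + ‖γ • (WithLp.toLp 2 (B.mulVec w) : EuclideanSpace ℝ (Fin (n - 1)))‖ := by
          rw [WithLp.toLp_add, WithLp.toLp_smul, WithLp.toLp_smul]; exact norm_add_le _ _
      _ = (1 - γ) * ‖(WithLp.toLp 2 w : EuclideanSpace ℝ (Fin (n - 1)))‖
          + γ * ‖(WithLp.toLp 2 (B.mulVec w) : EuclideanSpace ℝ (Fin (n - 1)))‖ := by
          rw [norm_smul, norm_smul, Real.norm_of_nonneg (by linarith), Real.norm_of_nonneg h0]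
      _ ≤ (1 - γ) * ‖(WithLp.toLp 2 w : EuclideanSpace ℝ (Fin (n - 1)))‖
          + γ * ((1 - ρ) * ‖(WithLp.toLp 2 w : EuclideanSpace ℝ (Fin (n - 1)))‖) := by gcongr
      _ = _ := by ring
  have key2 := pow_le_pow_left₀ (norm_nonneg _) key 2
  rw [mul_pow, EuclideanSpace.norm_sq_eq, EuclideanSpace.norm_sq_eq] at key2
  rw [e3]
  simpa using key2

variable {d : ℕ} {Z Ξ : Type*} [MeasurableSpace Z] [MeasurableSpace Ξ] {S : Setup n d Z Ξ}
  {ρ ω : ℝ}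

lemma Setup.Mixing.sq_lap_le (hS : S.Mixing ρ ω) {m : ℕ} (x : Fin n → Vec m) :
    sq (lap S.W x) ≤ ω ^ 2 * sq (dev x) := by
  rw [← lap_dev, sq_eq_sum_coord, sq_eq_sum_coord, Finset.mul_sum]
  refine Finset.sum_le_sum fun k _ => ?_
  have h := sum_sq_mulVec_le (S.W - 1) (fun j => dev x j k)
  simp only [sub_one_mulVec hS.row_sum] at h
  simp only [lap_coord]
  refine h.trans ?_
  gcongr
  exact hS.bounded_eigenvalue

lemma Setup.Mixing.sq_dev_mix_le (hS : S.Mixing ρ ω) {γ : ℝ} (h0 : 0 ≤ γ) (h1 : γ ≤ 1) {m : ℕ}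
    (x : Fin n → Vec m) :
    sq (dev (x + γ • lap S.W x)) ≤ (1 - ρ * γ) ^ 2 * sq (dev x) := by
  obtain ⟨U, hU, hJ, hW⟩ := hS.mixing
  rw [sq_eq_sum_coord, sq_eq_sum_coord, Finset.mul_sum]
  refine Finset.sum_le_sum fun k _ => ?_
  simp only [dev_coord]
  refine sum_sq_centered_mix_le hS.row_sum hU hJ hW h0 h1 (fun i => x i k) _ fun i => ?_
  simp [lap_coord]

/-- On mean-zero vectors the identity is the mixing step minus the projection of W − I, of norms at
most 1−ρ and ω, so 1 ≤ 1−ρ+ω. A nonzero mean-zero vector exists only from two agents on; for one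
agent the spectral condition on UᵀWU is empty and ω may be below ρ. -/
lemma Setup.Mixing.rho_le_omega (hS : S.Mixing ρ ω) (hn : 2 ≤ n) : ρ ≤ ω := by
  let x : Fin n → Vec 1 := fun i => if i = ⟨0, by omega⟩ then WithLp.toLp 2 (fun _ => 1) else 0
  have hx : 0 < sq (dev x) := by
    refine lt_of_le_of_ne (sq_nonneg' _) fun h => ?_
    have h2 := (Finset.sum_eq_zero_iff_of_nonneg (fun i _ => by positivity)).1 h.symm
    have ha := h2 ⟨0, by omega⟩ (Finset.mem_univ _)
    have hb := h2 ⟨1, by omega⟩ (Finset.mem_univ _)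
    have ha' : x ⟨0, by omega⟩ = avg x := by simpa [dev, sub_eq_zero] using ha
    have hb' : x ⟨1, by omega⟩ = avg x := by simpa [dev, sub_eq_zero] using hb
    have := congrArg (fun v : Vec 1 => v 0) (ha'.trans hb'.symm)
    simp [x] at this
  have h1 := hS.sq_dev_mix_le zero_le_one le_rfl x
  have h2 := hS.sq_lap_le x
  have h3 : sq (dev (lap S.W x)) ≤ sq (lap S.W x) := sq_dev_le (by omega) _
  have e : dev x = dev (x + (1 : ℝ) • lap S.W x) + -dev (lap S.W x) := by
    rw [dev_add, dev_smul, one_smul]; abel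
  by_contra hlt
  push Not at hlt
  have hω := hS.omega_pos
  have hρ := hS.rho_le_one
  -- The optimal Young weight ω/(1−ρ), which reproduces the square (1−ρ+ω)², degenerates at ρ = 1.
  -- There the mixed part vanishes and any small weight suffices.
  rcases eq_or_lt_of_le hρ with hρ1 | hρ1
  · have h4 : sq (dev (x + (1 : ℝ) • lap S.W x)) = 0 := by
      refine le_antisymm (h1.trans ?_) (sq_nonneg' _)
      rw [hρ1]; simp
    obtain ⟨a, ha, hlt'⟩ : ∃ a : ℝ, 0 < a ∧ (1 + a) * ω ^ 2 < 1 := by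
      have : ω ^ 2 < 1 := by nlinarith
      refine ⟨(1 - ω ^ 2) / 2, by linarith, by nlinarith [mul_pos hω hω]⟩
    have h5 := sq_add_le_young (-dev (lap S.W x)) (dev (x + (1 : ℝ) • lap S.W x)) ha
    rw [add_comm, ← e, h4, sq_neg] at h5
    nlinarith
  · have ha : 0 < ω / (1 - ρ) := div_pos hω (by linarith)
    have h5 := sq_add_le_young (dev (x + (1 : ℝ) • lap S.W x)) (-dev (lap S.W x)) ha
    rw [← e, sq_neg] at h5
    have h6 : sq (dev x) ≤ (1 + ω / (1 - ρ)) * ((1 - ρ * 1) ^ 2 * sq (dev x))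
        + (1 + 1 / (ω / (1 - ρ))) * (ω ^ 2 * sq (dev x)) :=
      h5.trans (by gcongr; exact h3.trans h2)
    have h7 : (1 + ω / (1 - ρ)) * ((1 - ρ * 1) ^ 2 * sq (dev x))
        + (1 + 1 / (ω / (1 - ρ))) * (ω ^ 2 * sq (dev x)) = (1 - ρ + ω) ^ 2 * sq (dev x) := by
      have : 1 - ρ ≠ 0 := by linarith
      field_simp
      ring
    rw [h7] at h6
    have h8 : (1 - ρ + ω) ^ 2 < 1 := by
      have : 0 < 1 - ρ + ω := by linarith
      nlinarith
    nlinarith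

end Mixing

/-! ### Summed recursions -/

section Recursions

/-- Telescoping; the induction keeps the final value u T on the left, and it is dropped at the end.
-/
lemma sum_le_of_contracting {u w : ℕ → ℝ} {r : ℝ} (hu : ∀ t, 0 ≤ u t)
    (h : ∀ t, u (t + 1) ≤ (1 - r) * u t + w t) (T : ℕ) :
    r * ∑ t ∈ Finset.range T, u t ≤ u 0 + ∑ t ∈ Finset.range T, w t := by
  have key : r * ∑ t ∈ Finset.range T, u t + u T ≤ u 0 + ∑ t ∈ Finset.range T, w t := by
    induction T with
    | zero => simp
    | succ T ih =>
      rw [Finset.sum_range_succ, Finset.sum_range_succ]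
      have := h T
      linarith
  linarith [hu T]

/-- The constants of a compressed gossip step, with `τ = ργ` and `p = γω`. -/
structure GossipConsts (δ τ p : ℝ) : Prop where
  delta_pos : 0 < δ
  delta_le : δ ≤ 1
  tau_pos : 0 < τ
  tau_le : τ ≤ p
  p_sq_le : 259 * p ^ 2 ≤ δ * τ

namespace GossipConsts

variable {δ τ p : ℝ}

lemma p_pos (h : GossipConsts δ τ p) : 0 < p := h.tau_pos.trans_le h.tau_le

/-- Otherwise 259p² > δp ≥ δτ. This makes gossip a small perturbation compared with the contraction
of the compressor. -/
lemma p_le (h : GossipConsts δ τ p) : 259 * p ≤ δ := by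
  have h1 := h.p_sq_le
  have h2 := h.p_pos
  have h3 := h.tau_le
  have h4 := h.delta_pos
  by_contra hc
  push Not at hc
  nlinarith [mul_le_mul_of_nonneg_left h3 h4.le, mul_lt_mul_of_pos_right hc h2]

/-- X is the disagreement, h the distance to the copies, Q the compression error, v the disagreeing
part of the increments and U the whole increments. X drives h and, through Q, h drives X back;
summing both recursions turns the coupling into a linear inequality with small feedback. -/
lemma sum_le (hc : GossipConsts δ τ p) {X h v U Q : ℕ → ℝ}
    (hX0 : ∀ t, 0 ≤ X t) (hh0 : ∀ t, 0 ≤ h t) (hv0 : ∀ t, 0 ≤ v t) (hU0 : ∀ t, 0 ≤ U t)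
    (hX : ∀ t, X (t + 1) ≤ (1 - τ / 2) * X t + (2 / τ * v t + p ^ 2 / τ * Q t))
    (hh : ∀ t, h (t + 1) ≤ (1 - 2 * δ / 5) * h t + (8 / δ * U t + 20 * p ^ 2 / δ * X t))
    (hQ : ∀ t, Q t ≤ 2 * h t + 2 * U t) (T : ℕ) :
    τ ^ 2 * ∑ t ∈ Finset.range T, X t ≤ 2.1 * τ * X 0 + 0.05 * τ * h 0
        + 4.1 * ∑ t ∈ Finset.range T, v t + 85 * (p / δ) ^ 2 * ∑ t ∈ Finset.range T, U t
      ∧ p ^ 2 * ∑ t ∈ Finset.range T, Q t ≤ 0.05 * τ * h 0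
        + 42 * (p / δ) ^ 2 * ∑ t ∈ Finset.range T, U t
        + 0.0015 * (τ ^ 2 * ∑ t ∈ Finset.range T, X t) := by
  have e1 := sum_le_of_contracting hX0 hX T
  have e2 := sum_le_of_contracting hh0 hh T
  rw [Finset.sum_add_distrib, ← Finset.mul_sum, ← Finset.mul_sum] at e1 e2
  have e3 : ∑ t ∈ Finset.range T, Q t
      ≤ 2 * ∑ t ∈ Finset.range T, h t + 2 * ∑ t ∈ Finset.range T, U t := by
    rw [Finset.mul_sum, Finset.mul_sum, ← Finset.sum_add_distrib]
    exact Finset.sum_le_sum fun t _ => hQ t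
  have sX := Finset.sum_nonneg (s := Finset.range T) fun t _ => hX0 t
  have sV := Finset.sum_nonneg (s := Finset.range T) fun t _ => hv0 t
  have sU := Finset.sum_nonneg (s := Finset.range T) fun t _ => hU0 t
  set SX := ∑ t ∈ Finset.range T, X t
  set SH := ∑ t ∈ Finset.range T, h t
  set SU := ∑ t ∈ Finset.range T, U t
  set SV := ∑ t ∈ Finset.range T, v t
  set SQ := ∑ t ∈ Finset.range T, Q t
  have hδ := hc.delta_pos
  have hτ := hc.tau_pos
  have hp := hc.p_pos
  have hδ1 := hc.delta_le
  have e1' : τ ^ 2 * SX ≤ 2 * τ * X 0 + 4 * SV + 2 * (p ^ 2 * SQ) := by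
    have := mul_le_mul_of_nonneg_left e1 (by positivity : 0 ≤ 2 * τ)
    have e : 2 * τ * (X 0 + (2 / τ * SV + p ^ 2 / τ * SQ))
      = 2 * τ * X 0 + 4 * SV + 2 * (p ^ 2 * SQ) := by field_simp; ring
    rw [e] at this
    linarith
  have e2' : SH ≤ 2.5 * (h 0 / δ) + 20 * (SU / δ ^ 2) + 50 * (p ^ 2 * SX / δ ^ 2) := by
    have := mul_le_mul_of_nonneg_left e2 (by positivity : 0 ≤ 2.5 / δ)
    have e : 2.5 / δ * (h 0 + (8 / δ * SU + 20 * p ^ 2 / δ * SX))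
      = 2.5 * (h 0 / δ) + 20 * (SU / δ ^ 2) + 50 * (p ^ 2 * SX / δ ^ 2) := by field_simp; ring
    have e' : 2.5 / δ * (2 * δ / 5 * SH) = SH := by field_simp; ring
    rwa [e, e'] at this
  have f1 : p ^ 2 * (h 0 / δ) ≤ τ * h 0 / 259 := by
    have : p ^ 2 / δ ≤ τ / 259 := by
      rw [div_le_div_iff₀ hδ (by norm_num)]; linarith [hc.p_sq_le]
    calc p ^ 2 * (h 0 / δ) = p ^ 2 / δ * h 0 := by ring
      _ ≤ τ / 259 * h 0 := mul_le_mul_of_nonneg_right this (hh0 0)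
      _ = _ := by ring
  have f2 : p ^ 2 * SU ≤ (p / δ) ^ 2 * SU := by
    refine mul_le_mul_of_nonneg_right ?_ sU
    rw [div_pow, le_div_iff₀ (by positivity)]
    have : δ ^ 2 ≤ 1 := pow_le_one₀ hδ.le hδ1
    nlinarith [sq_nonneg p]
  -- The feedback of X on itself, with 67081 = 259². It enters p²·SQ with coefficient 2·50, and
  -- 100/67081 < 0.0015.
  have f3 : p ^ 2 * (p ^ 2 * SX / δ ^ 2) ≤ τ ^ 2 * SX / 67081 := by
    have : p ^ 2 / δ ≤ τ / 259 := by
      rw [div_le_div_iff₀ hδ (by norm_num)]; linarith [hc.p_sq_le]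
    have := pow_le_pow_left₀ (by positivity) this 2
    calc p ^ 2 * (p ^ 2 * SX / δ ^ 2) = (p ^ 2 / δ) ^ 2 * SX := by ring
      _ ≤ (τ / 259) ^ 2 * SX := mul_le_mul_of_nonneg_right this sX
      _ = _ := by ring
  have f4 : p ^ 2 * (SU / δ ^ 2) = (p / δ) ^ 2 * SU := by ring
  have g1 : p ^ 2 * SQ ≤ 2 * (p ^ 2 * SH) + 2 * (p ^ 2 * SU) := by
    have := mul_le_mul_of_nonneg_left e3 (sq_nonneg p)
    linarith
  have g2 : p ^ 2 * SH ≤ 2.5 * (p ^ 2 * (h 0 / δ)) + 20 * (p ^ 2 * (SU / δ ^ 2))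
      + 50 * (p ^ 2 * (p ^ 2 * SX / δ ^ 2)) := by
    have := mul_le_mul_of_nonneg_left e2' (sq_nonneg p)
    linarith
  have sX' : 0 ≤ τ ^ 2 * SX := by positivity
  have sU' : 0 ≤ (p / δ) ^ 2 * SU := by positivity
  have h0' : 0 ≤ τ * h 0 := mul_nonneg hτ.le (hh0 0)
  have x0' : 0 ≤ τ * X 0 := mul_nonneg hτ.le (hX0 0)
  have fin2 : p ^ 2 * SQ ≤ 0.05 * (τ * h 0) + 42 * ((p / δ) ^ 2 * SU)
      + 0.0015 * (τ ^ 2 * SX) := by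
    linarith
  exact ⟨by linarith, by linarith⟩

end GossipConsts

/-- The conditions on the constants behind the bound on the summed recursions, with `l = ηL`,
`τ = ργ`, `p = γω` and `κ` in the role of `β̄`. -/
structure StepConsts (n l τ p δ β κ : ℝ) : Prop where
  gossip : GossipConsts δ τ p
  one_le : 1 ≤ n
  l_nonneg : 0 ≤ l
  beta_pos : 0 < β
  beta_le : β ≤ 1
  kappa_pos : 0 < κ
  kappa_le_beta : κ ≤ β
  kappa_le_tau : κ ≤ τ / 8
  tau_le : τ ≤ 1
  l_sq_le : 768 * l ^ 2 ≤ κ * τ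
  p_mul_l_le : 240 * (p * l) ≤ τ ^ 2
  l_sq_mul_le : 2025 * (l ^ 2 * β * n) ≤ τ ^ 3

namespace StepConsts

variable {n l τ p δ β κ : ℝ}

-- All capital letters except the scale L are sums over time or initial data: A and Gs are the
-- disagreements of iterates and trackers, B the averaged directions, QP the scaled compression
-- error, X the steps, Y the momentum increments, E the momentum errors, N the noise. The hypotheses
-- form the cycle X → E → Y → Gs → X, and eliminating all but X leaves an inequality with a gain
-- well below 1.
set_option maxHeartbeats 800000 in
lemma closed_loop {η L A Gs B QP X Y E G₀ E₀ N : ℝ} (hc : StepConsts n l τ p δ β κ)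
    (hl : l = η * L)
    (hG0 : 0 ≤ Gs) (hB0 : 0 ≤ B) (hX0 : 0 ≤ X) (hY0 : 0 ≤ Y)
    (hG₀ : 0 ≤ G₀) (hE₀ : 0 ≤ E₀) (hN : 0 ≤ N)
    (hA : τ ^ 2 * A ≤ 4.1 * (η ^ 2 * Gs) + 85 * (p / δ) ^ 2 * (η ^ 2 * (B + Gs)))
    (hQ : QP ≤ 42 * (p / δ) ^ 2 * (η ^ 2 * (B + Gs)) + 0.0015 * (τ ^ 2 * A))
    (hG : τ ^ 2 * Gs ≤ 2.15 * τ * G₀ + 4.1 * Y + 85 * (p / δ) ^ 2 * Y)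
    (hX : X ≤ 4 * (η ^ 2 * (B + Gs) + p ^ 2 * A + p ^ 2 * (η ^ 2 * Gs) + QP))
    (hY : Y ≤ 3 * L ^ 2 * X + 3 * N + 3 * (β ^ 2 * E))
    (hE : β * E ≤ E₀ + 2 * N + 2 * L ^ 2 * X) :
    L ^ 2 * X ≤ 4.15 * (l ^ 2 * B)
        + 21.5 * ((p / τ) ^ 2 * (l ^ 2 / τ ^ 2) * (2.15 * τ * G₀ + 37.8 * N + 12.6 * β * E₀)) ∧
      L ^ 2 * A ≤ 4.3 * (l ^ 2 / τ ^ 2 / τ ^ 2 * (2.15 * τ * G₀ + 37.8 * N + 12.6 * β * E₀))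
        + 0.01 * B := by
  have hδ := hc.gossip.delta_pos
  have hτ := hc.gossip.tau_pos
  have hp := hc.gossip.p_pos
  have hδ1 := hc.gossip.delta_le
  have hβ := hc.beta_pos
  have hκ := hc.kappa_pos
  have hn := hc.one_le
  have hn0 : 0 < n := by linarith
  have hr : (p / δ) ^ 2 ≤ 1 / 67081 := by
    have : p / δ ≤ 1 / 259 := by
      rw [div_le_div_iff₀ hδ (by norm_num)]; linarith [hc.gossip.p_le]
    calc (p / δ) ^ 2 ≤ (1 / 259) ^ 2 := by gcongr
      _ = _ := by norm_num
  set r := (p / δ) ^ 2 with hrdef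
  have hr0 : 0 ≤ r := by positivity
  set k := (p / τ) ^ 2 with hkdef
  -- Here ρ ≤ ω enters, since k = (ω/ρ)². It allows every occurrence of g in the step length to be
  -- counted as k·g.
  have hk1 : 1 ≤ k := by
    have : 1 ≤ p / τ := by rw [le_div_iff₀ hτ]; linarith [hc.gossip.tau_le]
    exact one_le_pow₀ this
  have hkτ : k * τ ^ 2 = p ^ 2 := by rw [hkdef]; field_simp
  have hkr : k * r ≤ 1 / 67081 := by
    have : p / τ * (p / δ) ≤ 1 / 259 := by
      rw [div_mul_div_comm, div_le_div_iff₀ (by positivity) (by norm_num)]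
      linarith [hc.gossip.p_sq_le]
    calc k * r = (p / τ * (p / δ)) ^ 2 := by rw [hkdef, hrdef]; ring
      _ ≤ (1 / 259) ^ 2 := by gcongr
      _ = _ := by norm_num
  set b := η ^ 2 * B with hb
  set g := η ^ 2 * Gs with hg
  have hb0 : 0 ≤ b := by positivity
  have hg0 : 0 ≤ g := by positivity
  have hbg : η ^ 2 * (B + Gs) = b + g := by rw [hb, hg]; ring
  rw [hbg] at hA hQ hX
  have rb : r * b ≤ 1 / 67081 * b := by gcongr
  have rg : r * g ≤ 1 / 67081 * g := by gcongr
  have rY : r * Y ≤ 1 / 67081 * Y := by gcongr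
  rw [show 85 * r * (b + g) = 85 * (r * b) + 85 * (r * g) by ring] at hA
  rw [show 42 * r * (b + g) = 42 * (r * b) + 42 * (r * g) by ring] at hQ
  have hA1 : τ ^ 2 * A ≤ 4.2 * g + 85 * (r * b) := by linarith
  have hpA : p ^ 2 * A ≤ 4.2 * (k * g) + 0.0013 * b := by
    have h1 := mul_le_mul_of_nonneg_left hA1 (by positivity : 0 ≤ k)
    have h2 : k * (τ ^ 2 * A) = p ^ 2 * A := by rw [← hkτ]; ring
    have h3 : k * r * b ≤ 1 / 67081 * b := by gcongr
    rw [h2] at h1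
    linarith
  have hpg : p ^ 2 * g ≤ 0.01 * g := by
    have hp1 : p ≤ 1 / 259 := by linarith [hc.gossip.p_le]
    have : p ^ 2 ≤ 0.01 := by nlinarith
    gcongr
  have hkg : g ≤ k * g := le_mul_of_one_le_left hg0 hk1
  have hX1 : X ≤ 4.05 * b + 21 * (k * g) := by linarith
  -- D is everything that enters the cycle from outside. Inserting the bound on β²E gives Y ≤ 9L²X +
  -- 9N + 3βE₀, and the factor 4.2 turns these coefficients into 37.8, 37.8 and 12.6.
  set D := 2.15 * τ * G₀ + 37.8 * N + 12.6 * β * E₀ with hD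
  have hD0 : 0 ≤ D := by positivity
  have hbE : β ^ 2 * E ≤ β * E₀ + 2 * N + 2 * L ^ 2 * X := by
    have h1 := mul_le_mul_of_nonneg_left hE hβ.le
    have h2 : 0 ≤ 2 * N + 2 * L ^ 2 * X := by positivity
    have h3 := mul_le_mul_of_nonneg_right hc.beta_le h2
    linarith
  have hG1 : τ ^ 2 * Gs ≤ D + 37.8 * (L ^ 2 * X) := by
    have h1 : τ ^ 2 * Gs ≤ 2.15 * τ * G₀ + 4.2 * Y := by linarith
    rw [hD]; linarith
  set m := l ^ 2 / τ ^ 2 with hm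
  have hm0 : 0 ≤ m := by positivity
  set K := k * m with hK
  have hK0 : 0 ≤ K := by positivity
  have hmτ : m * τ ^ 2 = l ^ 2 := by rw [hm]; field_simp
  have hmle : 768 * m * τ ≤ κ := by
    have : 768 * m * τ ^ 2 ≤ κ * τ := by rw [mul_assoc, hmτ]; exact hc.l_sq_le
    have : (768 * m * τ) * τ ≤ κ * τ := by linarith
    exact le_of_mul_le_mul_right this hτ
  -- 6144 = 768·8, from the bound on l² combined with κ ≤ τ/8.
  have hm1 : m ≤ 1 / 6144 := by
    have := hc.kappa_le_tau
    have : m * τ ≤ 1 / 6144 * τ := by linarith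
    exact le_of_mul_le_mul_right this hτ
  have hK1 : K ≤ 1 / 57600 := by
    have : p * l / τ ^ 2 ≤ 1 / 240 := by
      rw [div_le_div_iff₀ (by positivity) (by norm_num)]; linarith [hc.p_mul_l_le]
    have hl0 := hc.l_nonneg
    calc K = (p * l / τ ^ 2) ^ 2 := by rw [hK, hkdef, hm]; field_simp
      _ ≤ (1 / 240) ^ 2 := by gcongr
      _ = _ := by norm_num
  -- the closed loop for the step lengths
  have hLg : τ ^ 2 * (L ^ 2 * g) = l ^ 2 * (τ ^ 2 * Gs) := by rw [hg, hl]; ring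
  have hLg1 : L ^ 2 * g ≤ m * (D + 37.8 * (L ^ 2 * X)) := by
    have h1 : τ ^ 2 * (L ^ 2 * g) ≤ τ ^ 2 * (m * (D + 37.8 * (L ^ 2 * X))) := by
      rw [hLg, ← hmτ]
      calc m * τ ^ 2 * (τ ^ 2 * Gs) ≤ m * τ ^ 2 * (D + 37.8 * (L ^ 2 * X)) := by gcongr
        _ = _ := by ring
    exact le_of_mul_le_mul_left h1 (by positivity)
  have hLb : L ^ 2 * b = l ^ 2 * B := by rw [hb, hl]; ring
  have hLX0 : 0 ≤ L ^ 2 * X := by positivity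
  have hLX : L ^ 2 * X ≤ 4.15 * (l ^ 2 * B) + 21.5 * (K * D) := by
    have h1 := mul_le_mul_of_nonneg_left hX1 (sq_nonneg L)
    have h2 := mul_le_mul_of_nonneg_left hLg1 (by positivity : 0 ≤ k)
    -- The gain of the cycle is 21·37.8/57600 < 0.014, so L²X on the right is absorbed at the price
    -- of slightly larger constants.
    have h3 : K * (L ^ 2 * X) ≤ 1 / 57600 * (L ^ 2 * X) := by gcongr
    have h4 : k * (m * (D + 37.8 * (L ^ 2 * X))) = K * D + 37.8 * (K * (L ^ 2 * X)) := by
      rw [hK]; ring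
    have h5 : 0 ≤ K * D := by positivity
    have h6 : 0 ≤ l ^ 2 * B := by positivity
    linarith
  have hLg2 : L ^ 2 * g ≤ 1.02 * (m * D) + 157 * (m * (l ^ 2 * B)) := by
    have h1 : K * D ≤ 1 / 57600 * D := by gcongr
    have h2 : D + 37.8 * (L ^ 2 * X) ≤ 1.02 * D + 157 * (l ^ 2 * B) := by linarith
    have h3 := mul_le_mul_of_nonneg_left h2 hm0
    linarith
  refine ⟨hLX, ?_⟩
  have hmml : m * (l ^ 2 * B) ≤ 1 / 6144 * (1 / 6144) * (τ ^ 2 * B) := by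
    rw [← hmτ]
    calc m * (m * τ ^ 2 * B) ≤ 1 / 6144 * (1 / 6144 * τ ^ 2 * B) := by gcongr
      _ = _ := by ring
  have hrl : r * (l ^ 2 * B) ≤ 1 / 57600 * (τ ^ 2 * B) := by
    have hl0 := hc.l_nonneg
    have : p * l / δ ≤ 1 / 240 * τ := by
      rw [div_le_iff₀ hδ]
      have h1 := hc.p_mul_l_le
      have h2 : τ ≤ δ := by linarith [hc.gossip.tau_le, hc.gossip.p_le, hp]
      have h3 : τ * τ ≤ τ * δ := by gcongr
      linarith
    calc r * (l ^ 2 * B) = (p * l / δ) ^ 2 * B := by rw [hrdef]; ring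
      _ ≤ (1 / 240 * τ) ^ 2 * B := by gcongr
      _ = _ := by ring
  have hLA : τ ^ 2 * (L ^ 2 * A) ≤ τ ^ 2 * (4.3 * (m / τ ^ 2 * D) + 0.01 * B) := by
    have h1 := mul_le_mul_of_nonneg_left hA1 (sq_nonneg L)
    have h2 : L ^ 2 * (r * b) = r * (l ^ 2 * B) := by rw [← hLb]; ring
    have h3 : τ ^ 2 * (4.3 * (m / τ ^ 2 * D) + 0.01 * B) = 4.3 * (m * D) + 0.01 * (τ ^ 2 * B) := by
      have aux : ∀ x y : ℝ, τ ^ 2 * (x / τ ^ 2 * y) = x * y := fun x y => by field_simp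
      rw [mul_add, mul_left_comm, aux]; ring
    have h4 : 0 ≤ m * D := by positivity
    have h5 : 0 ≤ τ ^ 2 * B := by positivity
    rw [h3]
    linarith
  exact le_of_mul_le_mul_left hLA (by positivity)

/-- The left side is n² times the error that the descent inequality leaves, and n/4·B is n² times
the ¼‖v̄‖² that it offers in return. All directions B must fit under this credit; the other
contributions are put over the common denominator κ, using 1/β ≤ 1/κ and 8/τ ≤ 1/κ. -/
lemma sum_le {L A B X G₀ E₀ N : ℝ} (hc : StepConsts n l τ p δ β κ)
    (hB0 : 0 ≤ B) (hG₀ : 0 ≤ G₀) (hE₀ : 0 ≤ E₀) (hN : 0 ≤ N)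
    (hX : L ^ 2 * X ≤ 4.15 * (l ^ 2 * B)
        + 21.5 * ((p / τ) ^ 2 * (l ^ 2 / τ ^ 2) * (2.15 * τ * G₀ + 37.8 * N + 12.6 * β * E₀)))
    (hA : L ^ 2 * A ≤ 4.3 * (l ^ 2 / τ ^ 2 / τ ^ 2 * (2.15 * τ * G₀ + 37.8 * N + 12.6 * β * E₀))
        + 0.01 * B) :
    2 * n * L ^ 2 * A + 1 / β * (E₀ + 2 * N + 2 * L ^ 2 * X)
      ≤ n / 4 * B + (8 + 1344 * n * l ^ 2 / τ ^ 3) * N / κ + 4 * E₀ / κ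
        + 384 * n * l ^ 2 * G₀ / (κ * τ ^ 2) := by
  have hτ := hc.gossip.tau_pos
  have hp := hc.gossip.p_pos
  have hβ := hc.beta_pos
  have hκ := hc.kappa_pos
  have hn := hc.one_le
  have hn0 : 0 < n := by linarith
  have hκβ : 1 / β ≤ 1 / κ := one_div_le_one_div_of_le hκ hc.kappa_le_beta
  have hκτ : 8 / τ ≤ 1 / κ := by
    rw [div_le_div_iff₀ hτ hκ]; linarith [hc.kappa_le_tau]
  set m := l ^ 2 / τ ^ 2 with hm
  have hm0 : 0 ≤ m := by positivity
  set K := (p / τ) ^ 2 * m with hK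
  have hK0 : 0 ≤ K := by positivity
  have hmτ : m * τ ^ 2 = l ^ 2 := by rw [hm]; field_simp
  have hK1 : K ≤ 1 / 57600 := by
    have : p * l / τ ^ 2 ≤ 1 / 240 := by
      rw [div_le_div_iff₀ (by positivity) (by norm_num)]; linarith [hc.p_mul_l_le]
    have hl0 := hc.l_nonneg
    calc K = (p * l / τ ^ 2) ^ 2 := by rw [hK, hm]; field_simp
      _ ≤ (1 / 240) ^ 2 := by gcongr
      _ = _ := by norm_num
  have hKτ : K * τ ≤ m / 259 := by
    have h1 : (p / τ) ^ 2 * τ ≤ 1 / 259 := by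
      have : (p / τ) ^ 2 * τ = p ^ 2 / τ := by field_simp
      rw [this, div_le_div_iff₀ hτ (by norm_num)]
      have := mul_le_mul_of_nonneg_right hc.gossip.delta_le hτ.le
      linarith [hc.gossip.p_sq_le]
    calc K * τ = (p / τ) ^ 2 * τ * m := by rw [hK]; ring
      _ ≤ 1 / 259 * m := by gcongr
      _ = _ := by ring
  -- the contribution of the averaged directions
  have tB : l ^ 2 / β ≤ 1 / 768 := by
    rw [div_le_div_iff₀ hβ (by norm_num)]
    have := mul_le_mul hc.kappa_le_beta hc.tau_le hτ.le hβ.le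
    linarith [hc.l_sq_le]
  have tB' : l ^ 2 / β * B ≤ 1 / 768 * (n * B) := by
    calc l ^ 2 / β * B ≤ 1 / 768 * B := by gcongr
      _ ≤ 1 / 768 * (n * B) := by
        have := mul_le_mul_of_nonneg_right hn hB0
        linarith
  -- the contribution of the initial gradients
  have tG : n * (m / τ) * G₀ ≤ 1 / 8 * (n * m * G₀ / κ) := by
    calc n * (m / τ) * G₀ = n * m * G₀ / 8 * (8 / τ) := by ring
      _ ≤ n * m * G₀ / 8 * (1 / κ) := by gcongr
      _ = _ := by ring
  have tG' : K * τ / β * G₀ ≤ 1 / 259 * (n * m * G₀ / κ) := by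
    calc K * τ / β * G₀ = K * τ * G₀ * (1 / β) := by ring
      _ ≤ m / 259 * G₀ * (1 / κ) := by gcongr
      _ ≤ n * (m / 259 * G₀ * (1 / κ)) := le_mul_of_one_le_left (by positivity) hn
      _ = _ := by ring
  -- the contribution of the sampling noise
  have tN : n * (m / τ ^ 2) * N ≤ 1 / 8 * (n * (m / τ) * N / κ) := by
    calc n * (m / τ ^ 2) * N = n * (m / τ) * N / 8 * (8 / τ) := by ring
      _ ≤ n * (m / τ) * N / 8 * (1 / κ) := by gcongr
      _ = _ := by ring
  have tN' : K / β * N ≤ 1 / 259 * (n * (m / τ) * N / κ) := by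
    have : K ≤ m / τ / 259 := by rw [div_right_comm, le_div_iff₀ hτ]; exact hKτ
    calc K / β * N = K * N * (1 / β) := by ring
      _ ≤ m / τ / 259 * N * (1 / κ) := by gcongr
      _ ≤ n * (m / τ / 259 * N * (1 / κ)) := le_mul_of_one_le_left (by positivity) hn
      _ = _ := by ring
  -- the contribution of the initial noise
  have tE : n * (m / τ ^ 2) * β * E₀ ≤ 1 / 16200 * (E₀ / κ) := by
    have h1 : n * m * β ≤ τ / 2025 := by
      have := hc.l_sq_mul_le
      rw [← hmτ] at this
      have : τ ^ 2 * (n * m * β) ≤ τ ^ 2 * (τ / 2025) := by linarith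
      exact le_of_mul_le_mul_left this (by positivity)
    calc n * (m / τ ^ 2) * β * E₀ = n * m * β / τ ^ 2 * E₀ := by ring
      _ ≤ τ / 2025 / τ ^ 2 * E₀ := by gcongr
      _ = E₀ / 16200 * (8 / τ) := by field_simp; ring
      _ ≤ E₀ / 16200 * (1 / κ) := by gcongr
      _ = _ := by ring
  have tE' : K * E₀ ≤ 1 / 57600 * (E₀ / κ) := by
    have h1 : 1 ≤ 1 / κ := by
      rw [le_div_iff₀ hκ]; linarith [hc.kappa_le_beta, hc.beta_le]
    calc K * E₀ ≤ 1 / 57600 * E₀ := by gcongr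
      _ ≤ 1 / 57600 * E₀ * (1 / κ) := le_mul_of_one_le_right (by positivity) h1
      _ = _ := by ring
  have dN : 1 / β * N ≤ N / κ := by
    calc 1 / β * N ≤ 1 / κ * N := by gcongr
      _ = _ := by ring
  have dE : 1 / β * E₀ ≤ E₀ / κ := by
    calc 1 / β * E₀ ≤ 1 / κ * E₀ := by gcongr
      _ = _ := by ring
  have hA' := mul_le_mul_of_nonneg_left hA (by positivity : 0 ≤ 2 * n)
  have hX' := mul_le_mul_of_nonneg_left hX (by positivity : 0 ≤ 2 / β)
  have eA : 2 * n * (4.3 * (m / τ ^ 2 * (2.15 * τ * G₀ + 37.8 * N + 12.6 * β * E₀)) + 0.01 * B)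
      = 18.49 * (n * (m / τ) * G₀) + 325.08 * (n * (m / τ ^ 2) * N)
        + 108.36 * (n * (m / τ ^ 2) * β * E₀) + 0.02 * (n * B) := by
    field_simp
    ring
  have eX : 2 / β * (4.15 * (l ^ 2 * B) + 21.5 * (K * (2.15 * τ * G₀ + 37.8 * N + 12.6 * β * E₀)))
      = 8.3 * (l ^ 2 / β * B) + 92.45 * (K * τ / β * G₀) + 1625.4 * (K / β * N)
        + 541.8 * (K * E₀) := by
    field_simp
    ring
  rw [eA] at hA'
  rw [eX] at hX'
  have eR : n / 4 * B + (8 + 1344 * n * l ^ 2 / τ ^ 3) * N / κ + 4 * E₀ / κ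
        + 384 * n * l ^ 2 * G₀ / (κ * τ ^ 2)
      = 1 / 4 * (n * B) + 8 * (N / κ) + 1344 * (n * (m / τ) * N / κ) + 4 * (E₀ / κ)
        + 384 * (n * m * G₀ / κ) := by
    rw [hm]; field_simp; ring
  have eL : 2 * n * L ^ 2 * A + 1 / β * (E₀ + 2 * N + 2 * L ^ 2 * X)
      = 2 * n * (L ^ 2 * A) + 1 / β * E₀ + 2 * (1 / β * N) + 2 / β * (L ^ 2 * X) := by ring
  rw [eR, eL]
  have p1 : 0 ≤ n * B := by positivity
  have p2 : 0 ≤ N / κ := by positivity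
  have p3 : 0 ≤ n * (m / τ) * N / κ := by positivity
  have p4 : 0 ≤ E₀ / κ := by positivity
  have p5 : 0 ≤ n * m * G₀ / κ := by positivity
  linarith

end StepConsts

end Recursions

/-! ### One compressed gossip step -/

section Gossip

variable {n d : ℕ} {Z Ξ : Type*} [MeasurableSpace Z] [MeasurableSpace Ξ] {S : Setup n d Z Ξ}
  {ρ ω γ δ : ℝ}

lemma Setup.Mixing.sq_smul_lap_le (hS : S.Mixing ρ ω) (γ : ℝ) (x : Fin n → Vec d) :
    sq (γ • lap S.W x) ≤ (γ * ω) ^ 2 * sq (dev x) := by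
  rw [sq_smul, mul_pow, mul_assoc]
  exact mul_le_mul_of_nonneg_left (hS.sq_lap_le x) (sq_nonneg _)

lemma Setup.Mixing.sq_smul_lap_le' (hS : S.Mixing ρ ω) (hn : 1 ≤ n) (γ : ℝ) (x : Fin n → Vec d) :
    sq (γ • lap S.W x) ≤ (γ * ω) ^ 2 * sq x :=
  (hS.sq_smul_lap_le γ x).trans (mul_le_mul_of_nonneg_left (sq_dev_le hn x) (sq_nonneg _))

/-- The consensus error after a gossip step with increment `u` and compression error `q`. -/
lemma Setup.Mixing.sq_dev_gossip_le (hS : S.Mixing ρ ω) (hn : 1 ≤ n) (h0 : 0 < γ) (h1 : γ ≤ 1)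
    (hτ : ρ * γ < 1) (x u q : Fin n → Vec d) :
    sq (dev (x + u + γ • lap S.W (x + u + q))) ≤ (1 - ρ * γ / 2) * sq (dev x)
      + (2 / (ρ * γ) * sq (dev u) + (γ * ω) ^ 2 / (ρ * γ) * sq q) := by
  set τ := ρ * γ with hτdef
  have hτ0 : 0 < τ := mul_pos hS.rho_pos h0
  have h1τ : 0 < 1 - τ := by linarith
  have e1 : x + u + γ • lap S.W (x + u + q)
      = (x + u + γ • lap S.W (x + u)) + γ • lap S.W q := by
    rw [lap_add _ (x + u), smul_add]; abel
  rw [e1, dev_add]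
  -- The weight τ/(1−τ) turns the factor (1−τ)² of the exact mixing step into 1−τ and charges the
  -- compression error 1/τ.
  have a1 := sq_add_le_young (dev (x + u + γ • lap S.W (x + u))) (dev (γ • lap S.W q))
    (div_pos hτ0 h1τ)
  have a2 := hS.sq_dev_mix_le h0.le h1 (x + u)
  rw [← hτdef] at a2
  have a3 : sq (dev (γ • lap S.W q)) ≤ (γ * ω) ^ 2 * sq q :=
    (sq_dev_le hn _).trans (hS.sq_smul_lap_le' hn γ q)
  -- Half of the remaining contraction is spent on separating the increment.
  have a4 := sq_add_le_young (dev x) (dev u) (by positivity : 0 < τ / 2)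
  rw [← dev_add] at a4
  have b1 : 1 + τ / (1 - τ) = 1 / (1 - τ) := by field_simp; ring
  have b2 : 1 + 1 / (τ / (1 - τ)) = 1 / τ := by field_simp; ring
  rw [b1, b2] at a1
  have c1 : 1 / (1 - τ) * sq (dev (x + u + γ • lap S.W (x + u)))
      ≤ (1 - τ) * sq (dev (x + u)) := by
    calc _ ≤ 1 / (1 - τ) * ((1 - τ) ^ 2 * sq (dev (x + u))) := by gcongr
      _ = _ := by field_simp
  have c2 : 1 / τ * sq (dev (γ • lap S.W q)) ≤ (γ * ω) ^ 2 / τ * sq q := by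
    calc _ ≤ 1 / τ * ((γ * ω) ^ 2 * sq q) := by gcongr
      _ = _ := by ring
  have c3 : (1 - τ) * sq (dev (x + u)) ≤ (1 - τ / 2) * sq (dev x) + 2 / τ * sq (dev u) := by
    have d1 : (1 - τ) * (1 + τ / 2) ≤ 1 - τ / 2 := by nlinarith
    have d2 : (1 - τ) * (1 + 1 / (τ / 2)) ≤ 2 / τ := by
      have : 2 / τ - (1 - τ) * (1 + 1 / (τ / 2)) = 1 + τ := by field_simp; ring
      linarith
    calc (1 - τ) * sq (dev (x + u))
        ≤ (1 - τ) * ((1 + τ / 2) * sq (dev x) + (1 + 1 / (τ / 2)) * sq (dev u)) := by gcongr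
      _ = (1 - τ) * (1 + τ / 2) * sq (dev x) + (1 - τ) * (1 + 1 / (τ / 2)) * sq (dev u) := by ring
      _ ≤ _ := add_le_add (mul_le_mul_of_nonneg_right d1 (sq_nonneg' _))
          (mul_le_mul_of_nonneg_right d2 (sq_nonneg' _))
  linarith

/-- The distance to the compressed copies after a gossip step. -/
lemma Setup.Mixing.sq_gossip_sub_copy_le (hS : S.Mixing ρ ω) (hn : 1 ≤ n) (h0 : 0 < γ)
    (hδ : 0 < δ) (hδ1 : δ ≤ 1) (hp : 259 * (γ * ω) ≤ δ) (x u q : Fin n → Vec d) :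
    sq (x + u + γ • lap S.W (x + u + q) - (x + u + q)) ≤ (1 + 0.26 * δ) * sq q
      + 20 * (γ * ω) ^ 2 / δ * (sq (dev x) + sq (dev u)) := by
  -- The new copy is x + u + q. Its distance to the new value is the compression error plus a gossip
  -- move, and the latter carries a factor γω.
  have e1 : x + u + γ • lap S.W (x + u + q) - (x + u + q)
      = -q + (γ • lap S.W q + γ • lap S.W (x + u)) := by
    rw [lap_add _ (x + u), smul_add]; abel
  rw [e1]
  have hp0 : 0 < γ * ω := mul_pos h0 hS.omega_pos
  set p := γ * ω with hpdef
  have a1 := sq_add_le_young (-q) (γ • lap S.W q + γ • lap S.W (x + u))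
    (by positivity : 0 < δ / 4)
  rw [sq_neg] at a1
  have a2 := sq_add_le_two (γ • lap S.W q) (γ • lap S.W (x + u))
  have a3 := hS.sq_smul_lap_le' hn γ q
  have a4 := hS.sq_smul_lap_le γ (x + u)
  have a5 := sq_add_le_two (dev x) (dev u)
  rw [← dev_add] at a5
  rw [← hpdef] at a3 a4
  have b1 : 1 + 1 / (δ / 4) ≤ 5 / δ := by
    rw [le_div_iff₀ hδ]; field_simp; linarith
  have b2 : sq (γ • lap S.W q + γ • lap S.W (x + u))
      ≤ 2 * p ^ 2 * sq q + 4 * p ^ 2 * (sq (dev x) + sq (dev u)) := by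
    have := mul_le_mul_of_nonneg_left a5 (sq_nonneg p)
    linarith
  -- The reaction of gossip to the compression error costs another δ/100, because p ≤ δ/259; with
  -- the δ/4 of Young's inequality this is the 0.26δ.
  have b3 : 5 / δ * (2 * p ^ 2) ≤ 0.01 * δ := by
    have : p ^ 2 ≤ (δ / 259) ^ 2 := by gcongr; linarith
    have h2 : 5 / δ * (2 * p ^ 2) ≤ 5 / δ * (2 * (δ / 259) ^ 2) := by gcongr
    have h3 : 5 / δ * (2 * (δ / 259) ^ 2) = 10 / 259 ^ 2 * δ := by field_simp; ring
    rw [h3] at h2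
    refine h2.trans ?_
    gcongr
    norm_num
  have c1 : (1 + 1 / (δ / 4)) * sq (γ • lap S.W q + γ • lap S.W (x + u))
      ≤ 5 / δ * (2 * p ^ 2 * sq q + 4 * p ^ 2 * (sq (dev x) + sq (dev u))) :=
    mul_le_mul b1 b2 (sq_nonneg' _) (by positivity)
  have c2 := mul_le_mul_of_nonneg_right b3 (sq_nonneg' q)
  have c3 : 5 / δ * (2 * p ^ 2 * sq q + 4 * p ^ 2 * (sq (dev x) + sq (dev u)))
      = 5 / δ * (2 * p ^ 2) * sq q + 20 * p ^ 2 / δ * (sq (dev x) + sq (dev u)) := by ring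
  linarith

/-- Here y is the copy. This spends a second quarter of the gain δ of the compressor. -/
lemma sq_compressor_input_le (hδ : 0 < δ) (hδ1 : δ ≤ 1) (x u y : Fin n → Vec d) :
    sq (x + u - y) ≤ (1 + δ / 4) * sq (x - y) + 5 / δ * sq u := by
  have a1 := sq_add_le_young (x - y) u (by positivity : 0 < δ / 4)
  have b1 : 1 + 1 / (δ / 4) ≤ 5 / δ := by
    rw [le_div_iff₀ hδ]; field_simp; linarith
  have b2 := mul_le_mul_of_nonneg_right b1 (sq_nonneg' u)
  rw [show x + u - y = x - y + u by abel]
  linarith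

lemma sq_add_four_le (x y z w : Fin n → Vec d) :
    sq (x + y + (z + w)) ≤ 4 * (sq x + sq y + sq z + sq w) := by
  have a1 := sq_add_le_two (x + y) (z + w)
  have a2 := sq_add_le_two x y
  have a3 := sq_add_le_two z w
  linarith

/-- The length of a gossip step. -/
lemma Setup.Mixing.sq_gossip_sub_self_le (hS : S.Mixing ρ ω) (hn : 1 ≤ n)
    (x u q : Fin n → Vec d) :
    sq (x + u + γ • lap S.W (x + u + q) - x) ≤ 4 * (sq u + (γ * ω) ^ 2 * sq (dev x)
      + (γ * ω) ^ 2 * sq (dev u) + (γ * ω) ^ 2 * sq q) := by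
  have e1 : x + u + γ • lap S.W (x + u + q) - x
      = u + γ • lap S.W x + (γ • lap S.W u + γ • lap S.W q) := by
    rw [lap_add _ (x + u), lap_add, smul_add, smul_add]; abel
  rw [e1]
  have a := sq_add_four_le u (γ • lap S.W x) (γ • lap S.W u) (γ • lap S.W q)
  have a1 := hS.sq_smul_lap_le' hn γ q
  have a2 := hS.sq_smul_lap_le γ x
  have a3 := hS.sq_smul_lap_le γ u
  linarith

end Gossip

/-! ### Gradients -/

section Gradients

/-- The defect φ along the segment is nonincreasing on [0,1]: by Cauchy–Schwarz the inner product in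
its derivative is at most L·t·‖v‖², which the quadratic term cancels. No convexity is involved. -/
lemma le_of_lipschitz_gradient {E : Type*} [NormedAddCommGroup E] [InnerProductSpace ℝ E]
    [CompleteSpace E] {f : E → ℝ} {L : ℝ} (hf : Differentiable ℝ f)
    (hL : ∀ x y, ‖gradient f x - gradient f y‖ ≤ L * ‖x - y‖) (x v : E) :
    f (x + v) ≤ f x + inner ℝ (gradient f x) v + L / 2 * ‖v‖ ^ 2 := by
  let φ : ℝ → ℝ := fun t => f (x + t • v) - t * inner ℝ (gradient f x) v - L / 2 * t ^ 2 * ‖v‖ ^ 2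
  have hφ : ∀ t, HasDerivAt φ
      (inner ℝ (gradient f (x + t • v)) v - inner ℝ (gradient f x) v - L * t * ‖v‖ ^ 2) t := by
    intro t
    have h1 : HasDerivAt (fun t : ℝ => x + t • v) v t := by
      simpa using ((hasDerivAt_id t).smul_const v).const_add x
    have h2 := (hf (x + t • v)).hasFDerivAt.comp_hasDerivAt t h1
    rw [← inner_gradient_left] at h2
    have h3 := (hasDerivAt_id t).mul_const (inner ℝ (gradient f x) v)
    have h4 := (((hasDerivAt_id t).pow 2).const_mul (L / 2)).mul_const (‖v‖ ^ 2)
    convert! (h2.sub h3).sub h4 using 1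
    simp only [id, Nat.cast_ofNat, Nat.add_one_sub_one, pow_one]
    ring
  have hanti : AntitoneOn φ (Set.Icc 0 1) := by
    refine antitoneOn_of_deriv_nonpos (convex_Icc 0 1)
      (fun t _ => (hφ t).continuousAt.continuousWithinAt)
      (fun t _ => (hφ t).differentiableAt.differentiableWithinAt) fun t ht => ?_
    rw [interior_Icc] at ht
    rw [(hφ t).deriv, ← inner_sub_left]
    have h1 := real_inner_le_norm (gradient f (x + t • v) - gradient f x) v
    have h2 := hL (x + t • v) x
    rw [add_sub_cancel_left, norm_smul, Real.norm_of_nonneg ht.1.le] at h2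
    have h3 := mul_le_mul_of_nonneg_right h2 (norm_nonneg v)
    nlinarith
  have := hanti (by simp) (by simp) (zero_le_one)
  simp only [φ, one_smul, one_mul, one_pow, mul_one, zero_smul, add_zero, zero_mul, sub_zero,
    ne_eq, OfNat.ofNat_ne_zero, not_false_eq_true, zero_pow, mul_zero] at this
  linarith

variable {n d : ℕ} {Z Ξ : Type*} [MeasurableSpace Z] [MeasurableSpace Ξ] {S : Setup n d Z Ξ}
  {L σ : ℝ}

/-- The local gradients, each at the iterate of its agent. -/
def Setup.gradStack (S : Setup n d Z Ξ) (x : Fin n → Vec d) : Fin n → Vec d :=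
  fun i => gradient (S.localObj i) (x i)

/-- Unbiasedness makes ∇f_i a mean of L-Lipschitz maps, so the smoothness of the samples passes to
the local objective without differentiating under the integral. -/
lemma norm_gradient_localObj_sub_le (hr : S.Regular) (hs : S.Smooth L) (hv : S.BoundedVariance σ)
    (i : Fin n) (x y : Vec d) :
    ‖gradient (S.localObj i) x - gradient (S.localObj i) y‖ ≤ L * ‖x - y‖ := by
  have := hr.dist_prob i
  rw [← hv.unbiased, ← hv.unbiased, ← integral_sub (hv.integrable i x) (hv.integrable i y)]
  have h := norm_integral_le_of_norm_le_const (μ := S.dist i) (C := L * ‖x - y‖)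
    (f := fun z => S.stochGrad i x z - S.stochGrad i y z)
    ((hs.2 i).mono fun z hz => hz x y)
  simpa using h

lemma hasGradientAt_obj (hr : S.Regular) (x : Vec d) :
    HasGradientAt S.obj (avg (fun i => gradient (S.localObj i) x)) x := by
  have h1 : ∀ i, HasGradientAt (S.localObj i) (gradient (S.localObj i) x) x := fun i =>
    (((hr.localObj_contDiff i).differentiable one_ne_zero) x).hasGradientAt
  have h2 : HasFDerivAt (fun y => ∑ i, S.localObj i y)
      (∑ i, InnerProductSpace.toDual ℝ (Vec d) (gradient (S.localObj i) x)) x :=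
    HasFDerivAt.fun_sum fun i _ => (h1 i).hasFDerivAt
  have h3 := h2.const_mul (1 / (n : ℝ))
  rw [hasGradientAt_iff_hasFDerivAt]
  rw [avg, map_smul, map_sum]
  exact h3

lemma gradient_obj (hr : S.Regular) (x : Vec d) :
    gradient S.obj x = avg (S.gradStack fun _ => x) := (hasGradientAt_obj hr x).gradient

lemma sq_gradStack_sub_le (hr : S.Regular) (hs : S.Smooth L) (hv : S.BoundedVariance σ)
    (x y : Fin n → Vec d) :
    sq (S.gradStack x - S.gradStack y) ≤ L ^ 2 * sq (x - y) := by
  unfold sq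
  rw [Finset.mul_sum]
  refine Finset.sum_le_sum fun i _ => ?_
  rw [← mul_pow]
  exact pow_le_pow_left₀ (norm_nonneg _) (norm_gradient_localObj_sub_le hr hs hv i _ _) 2

lemma norm_gradient_obj_sub_le (hn : 1 ≤ n) (hr : S.Regular) (hs : S.Smooth L)
    (hv : S.BoundedVariance σ) (x y : Vec d) :
    ‖gradient S.obj x - gradient S.obj y‖ ≤ L * ‖x - y‖ := by
  have hn0 : (0 : ℝ) < n := by positivity
  rw [gradient_obj hr, gradient_obj hr, ← avg_sub]
  have h1 := card_mul_norm_avg_sq_le hn (S.gradStack (fun _ => x) - S.gradStack (fun _ => y))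
  have h2 := sq_gradStack_sub_le hr hs hv (fun _ => x) (fun _ => y)
  have h3 : sq ((fun _ => x) - (fun _ => y) : Fin n → Vec d) = n * ‖x - y‖ ^ 2 := by simp [sq]
  rw [h3] at h2
  have h4 : ‖avg (S.gradStack (fun _ => x) - S.gradStack (fun _ => y))‖ ^ 2
      ≤ (L * ‖x - y‖) ^ 2 := by
    have : n * ‖avg (S.gradStack (fun _ => x) - S.gradStack (fun _ => y))‖ ^ 2
      ≤ n * (L * ‖x - y‖) ^ 2 := by rw [mul_pow]; linarith
    exact le_of_mul_le_mul_left this hn0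
  exact le_of_sq_le_sq h4 (mul_nonneg hs.1 (norm_nonneg _))

lemma continuous_gradient_obj (hn : 1 ≤ n) (hr : S.Regular) (hs : S.Smooth L)
    (hv : S.BoundedVariance σ) : Continuous (gradient S.obj) :=
  (LipschitzWith.of_dist_le_mul (K := ⟨L, hs.1⟩) fun x y => by
    rw [dist_eq_norm, dist_eq_norm]
    exact norm_gradient_obj_sub_le hn hr hs hv x y).continuous

lemma continuous_gradient_localObj (hr : S.Regular) (hs : S.Smooth L)
    (hv : S.BoundedVariance σ) (i : Fin n) : Continuous (gradient (S.localObj i)) :=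
  (LipschitzWith.of_dist_le_mul (K := ⟨L, hs.1⟩) fun x y => by
    rw [dist_eq_norm, dist_eq_norm]
    exact norm_gradient_localObj_sub_le hr hs hv i x y).continuous

/-- The direction errs for two reasons: local gradients are taken at the agents' own iterates
instead of the average, and v̄ only estimates their mean. The first error is paid by consensus. -/
lemma norm_gradient_obj_avg_sub_sq_le (hn : 1 ≤ n) (hr : S.Regular) (hs : S.Smooth L)
    (hv : S.BoundedVariance σ) (x v : Fin n → Vec d) :
    ‖gradient S.obj (avg x) - avg v‖ ^ 2
      ≤ 2 * (L ^ 2 / n * sq (dev x)) + 2 * ‖avg (v - S.gradStack x)‖ ^ 2 := by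
  have hn0 : (0 : ℝ) < n := by positivity
  have e : gradient S.obj (avg x) - avg v
      = avg (S.gradStack (fun _ => avg x) - S.gradStack x) + -avg (v - S.gradStack x) := by
    rw [gradient_obj hr, avg_sub, avg_sub]; abel
  have h1 := norm_add_sq_le_young (avg (S.gradStack (fun _ => avg x) - S.gradStack x))
    (-avg (v - S.gradStack x)) one_pos
  rw [← e, norm_neg] at h1
  have h2 := card_mul_norm_avg_sq_le hn (S.gradStack (fun _ => avg x) - S.gradStack x)
  have h3 := sq_gradStack_sub_le hr hs hv (fun _ => avg x) x
  have h4 : sq ((fun _ => avg x) - x) = sq (dev x) := by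
    rw [← sq_neg]; congr 1; ext1 i; simp [dev]
  rw [h4] at h3
  have h5 : ‖avg (S.gradStack (fun _ => avg x) - S.gradStack x)‖ ^ 2 ≤ L ^ 2 / n * sq (dev x) := by
    rw [div_mul_eq_mul_div, le_div_iff₀ hn0]; linarith
  linarith

/-- Descent of the objective along the averaged iterates. -/
lemma obj_avg_sub_smul_le (hn : 1 ≤ n) (hr : S.Regular) (hs : S.Smooth L)
    (hv : S.BoundedVariance σ) {η : ℝ} (hη : 0 < η) (hηL : η * L ≤ 1 / 2) (x v : Fin n → Vec d) :
    S.obj (avg x - η • avg v) ≤ S.obj (avg x) - η * (1 / 2 * ‖gradient S.obj (avg x)‖ ^ 2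
      + 1 / 4 * ‖avg v‖ ^ 2 - (L ^ 2 / n * sq (dev x) + ‖avg (v - S.gradStack x)‖ ^ 2)) := by
  have h1 := le_of_lipschitz_gradient (f := S.obj)
    (fun y => (hasGradientAt_obj hr y).differentiableAt)
    (norm_gradient_obj_sub_le hn hr hs hv) (avg x) (-(η • avg v))
  rw [← sub_eq_add_neg, inner_neg_right, inner_smul_right, norm_neg, norm_smul,
    Real.norm_of_nonneg hη.le] at h1
  have h2 := norm_gradient_obj_avg_sub_sq_le hn hr hs hv x v
  rw [norm_sub_sq_real] at h2
  set a := ‖gradient S.obj (avg x)‖ ^ 2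
  set I := inner ℝ (gradient S.obj (avg x)) (avg v)
  set w := L ^ 2 / n * sq (dev x) + ‖avg (v - S.gradStack x)‖ ^ 2
  -- Polarization replaces the inner product by half of both squares. Of the resulting ½‖v̄‖², one
  -- half absorbs the curvature term because ηL ≤ 1/2; the other half is kept to pay for step
  -- lengths.
  have h3 : I ≥ 1 / 2 * a + 1 / 2 * ‖avg v‖ ^ 2 - w := by simp only [w]; linarith
  have h4 := mul_le_mul_of_nonneg_left h3 hη.le
  have h5 := mul_le_mul_of_nonneg_right hηL (by positivity : 0 ≤ η * ‖avg v‖ ^ 2)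
  have h6 : L / 2 * (η * ‖avg v‖) ^ 2 = 1 / 2 * (η * L * (η * ‖avg v‖ ^ 2)) := by ring
  rw [h6] at h1
  linarith

end Gradients

/-! ### Probability -/

section Probability

variable {Ω : Type*} [MeasurableSpace Ω] {P : Measure Ω}

/-- Bounds on conditional means of nonnegative quantities integrate. -/
lemma integrable_and_integral_le_of_hasCondDistrib {A B : Type*} [MeasurableSpace A]
    [MeasurableSpace B] [IsProbabilityMeasure P] {X : Ω → A} {Y : Ω → B} {κ : Kernel A B}
    [IsMarkovKernel κ] (h : HasCondDistrib Y X κ P) {F : A → B → ℝ}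
    (hF : Measurable (fun p : A × B => F p.1 p.2)) (h0 : ∀ a b, 0 ≤ F a b) {R : A → ℝ}
    (hRm : Measurable R) (hFi : ∀ a, Integrable (F a) (κ a)) (hFR : ∀ a, ∫ b, F a b ∂κ a ≤ R a)
    (hR : Integrable (fun ω => R (X ω)) P) :
    Integrable (fun ω => F (X ω) (Y ω)) P ∧ ∫ ω, F (X ω) (Y ω) ∂P ≤ ∫ ω, R (X ω) ∂P := by
  have hX := h.aemeasurable_fst
  have hRi : Integrable R (P.map X) :=
    (integrable_map_measure hRm.aestronglyMeasurable hX).2 hR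
  -- Integrability need not be assumed: the inner integral is nonnegative and dominated by R.
  have hI : Integrable (fun a => ∫ b, F a b ∂κ a) (P.map X) := by
    refine hRi.mono' ?_ (Filter.Eventually.of_forall fun a => ?_)
    · exact (hF.stronglyMeasurable.integral_kernel_prod_right' (κ := κ)).aestronglyMeasurable
    · rw [Real.norm_of_nonneg (integral_nonneg fun b => h0 a b)]
      exact hFR a
  have hJ : Integrable (fun p : A × B => F p.1 p.2) ((P.map X) ⊗ₘ κ) := by
    have := Measure.isProbabilityMeasure_map hX
    refine (Measure.integrable_compProd_iff hF.aestronglyMeasurable).2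
      ⟨Filter.Eventually.of_forall hFi, ?_⟩
    refine hI.congr (Filter.Eventually.of_forall fun a => ?_)
    simp only [Real.norm_of_nonneg (h0 _ _)]
  have := Measure.isProbabilityMeasure_map hX
  constructor
  · rw [← h.map_eq] at hJ
    exact (integrable_map_measure hF.aestronglyMeasurable h.aemeasurable).1 hJ
  · have e1 := h.integral_comp (f := fun p : A × B => F p.1 p.2) hF.aestronglyMeasurable
    have e2 := Measure.integral_compProd hJ
    calc ∫ ω, F (X ω) (Y ω) ∂P = ∫ a, ∫ b, F a b ∂κ a ∂(P.map X) := e1.trans e2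
      _ ≤ ∫ a, R a ∂(P.map X) := integral_mono hI hRi hFR
      _ = _ := integral_map hX hRm.aestronglyMeasurable

variable {d : ℕ}

lemma integral_inner_eq_zero_of_indepFun {φ ψ : Ω → Vec d} (h : IndepFun φ ψ P)
    [IsProbabilityMeasure P] (hφ : Integrable φ P) (hψ : Integrable ψ P) (h0 : ∫ ω, φ ω ∂P = 0) :
    ∫ ω, inner ℝ (φ ω) (ψ ω) ∂P = 0 := by
  have := h.integral_bilin hφ hψ (innerSL ℝ)
  rw [h0, map_zero] at this
  exact this

lemma integrable_inner_of_memLp {φ ψ : Ω → Vec d} (hφ : MemLp φ 2 P) (hψ : MemLp ψ 2 P) :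
    Integrable (fun ω => inner ℝ (φ ω) (ψ ω)) P := by
  refine ((hφ.integrable_norm_pow (p := 2) two_ne_zero).add
    (hψ.integrable_norm_pow (p := 2) two_ne_zero)).mono'
    (hφ.aestronglyMeasurable.inner hψ.aestronglyMeasurable)
    (Filter.Eventually.of_forall fun ω => ?_)
  refine (norm_inner_le_norm (𝕜 := ℝ) (φ ω) (ψ ω)).trans ?_
  simp only [Pi.add_apply]
  nlinarith [sq_nonneg (‖φ ω‖ - ‖ψ ω‖), sq_nonneg ‖φ ω‖, sq_nonneg ‖ψ ω‖]

/-- The second moment of a sum of independent centered vectors. -/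
lemma integral_norm_sum_sq {ι : Type*} [IsProbabilityMeasure P] (s : Finset ι)
    {φ : ι → Ω → Vec d} (hφ : ∀ i, MemLp (φ i) 2 P) (h0 : ∀ i, ∫ ω, φ i ω ∂P = 0)
    (hind : ∀ i j, i ≠ j → IndepFun (φ i) (φ j) P) :
    ∫ ω, ‖∑ i ∈ s, φ i ω‖ ^ 2 ∂P = ∑ i ∈ s, ∫ ω, ‖φ i ω‖ ^ 2 ∂P := by
  classical
  have hI : ∀ i, Integrable (φ i) P := fun i => (hφ i).integrable one_le_two
  induction s using Finset.induction_on with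
  | empty => simp
  | insert a s ha ih =>
    have hs : MemLp (fun ω => ∑ i ∈ s, φ i ω) 2 P := memLp_finsetSum _ fun i _ => hφ i
    have e : ∀ ω, ‖∑ i ∈ insert a s, φ i ω‖ ^ 2 = ‖φ a ω‖ ^ 2
        + 2 * (∑ i ∈ s, inner ℝ (φ a ω) (φ i ω)) + ‖∑ i ∈ s, φ i ω‖ ^ 2 := by
      intro ω
      rw [Finset.sum_insert ha, norm_add_sq_real, inner_sum]
    have hin : ∀ i, Integrable (fun ω => inner ℝ (φ a ω) (φ i ω)) P := fun i =>
      integrable_inner_of_memLp (hφ a) (hφ i)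
    have hsum : Integrable (fun ω => ∑ i ∈ s, inner ℝ (φ a ω) (φ i ω)) P :=
      integrable_finsetSum _ fun i _ => hin i
    simp only [e]
    have ia := (hφ a).integrable_norm_pow (p := 2) two_ne_zero
    have is := hs.integrable_norm_pow (p := 2) two_ne_zero
    rw [integral_add (f := fun ω => ‖φ a ω‖ ^ 2 + 2 * _) (ia.add (hsum.const_mul 2)) is,
      integral_add ia (hsum.const_mul 2), integral_const_mul, integral_finsetSum _ fun i _ => hin i,
      ih, Finset.sum_insert ha]
    have : ∑ i ∈ s, ∫ ω, inner ℝ (φ a ω) (φ i ω) ∂P = 0 := by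
      refine Finset.sum_eq_zero fun i hi => ?_
      exact integral_inner_eq_zero_of_indepFun (hind a i fun h => ha (h ▸ hi)) (hI a) (hI i) (h0 a)
    rw [this]; ring

lemma integral_norm_const_add_sq [IsProbabilityMeasure P] {φ : Ω → Vec d} (hφ : MemLp φ 2 P)
    (h0 : ∫ ω, φ ω ∂P = 0) (c : Vec d) :
    ∫ ω, ‖c + φ ω‖ ^ 2 ∂P = ‖c‖ ^ 2 + ∫ ω, ‖φ ω‖ ^ 2 ∂P := by
  have hI := hφ.integrable one_le_two
  have i2 := hφ.integrable_norm_pow (p := 2) two_ne_zero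
  simp only [norm_add_sq_real]
  rw [integral_add (f := fun ω => ‖c‖ ^ 2 + 2 * inner ℝ c (φ ω))
    ((integrable_const _).add ((hI.const_inner c).const_mul 2)) i2,
    integral_add (integrable_const _) ((hI.const_inner c).const_mul 2), integral_const_mul,
    integral_inner hI, h0]
  simp

/-- Centering reduces the second moment. -/
lemma integral_norm_sub_integral_sq_le [IsProbabilityMeasure P] {φ : Ω → Vec d}
    (hφ : MemLp φ 2 P) :
    ∫ ω, ‖φ ω - ∫ ω', φ ω' ∂P‖ ^ 2 ∂P ≤ ∫ ω, ‖φ ω‖ ^ 2 ∂P := by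
  have hI := hφ.integrable one_le_two
  have h1 := integral_norm_const_add_sq (φ := fun ω => φ ω - ∫ ω', φ ω' ∂P)
    (hφ.sub (memLp_const _)) (by rw [integral_sub hI (integrable_const _)]; simp)
    (∫ ω', φ ω' ∂P)
  simp only [add_sub_cancel] at h1
  rw [h1]
  have := sq_nonneg ‖∫ ω', φ ω' ∂P‖
  linarith

variable {n : ℕ}

/-- A random stack with square integrable entries. -/
def SqInt (P : Measure Ω) (x : Ω → Fin n → Vec d) : Prop := ∀ i, MemLp (fun ω => x ω i) 2 P

namespace SqInt

variable {x y : Ω → Fin n → Vec d}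

lemma add (hx : SqInt P x) (hy : SqInt P y) : SqInt P (fun ω => x ω + y ω) :=
  fun i => (hx i).add (hy i)

lemma sub (hx : SqInt P x) (hy : SqInt P y) : SqInt P (fun ω => x ω - y ω) :=
  fun i => (hx i).sub (hy i)

lemma const_smul (hx : SqInt P x) (c : ℝ) : SqInt P (fun ω => c • x ω) :=
  fun i => (hx i).const_smul c

lemma lap (hx : SqInt P x) (W : Matrix (Fin n) (Fin n) ℝ) : SqInt P (fun ω => lap W (x ω)) :=
  fun i => memLp_finsetSum _ fun j _ => ((hx j).sub (hx i)).const_smul (W i j)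

lemma memLp_avg (hx : SqInt P x) : MemLp (fun ω => avg (x ω)) 2 P :=
  (memLp_finsetSum Finset.univ fun j _ => hx j).const_smul (1 / (n : ℝ))

lemma dev (hx : SqInt P x) : SqInt P (fun ω => dev (x ω)) :=
  fun i => (hx i).sub hx.memLp_avg

lemma integrable_sq (hx : SqInt P x) : Integrable (fun ω => sq (x ω)) P :=
  integrable_finsetSum _ fun i _ => (hx i).integrable_norm_pow (p := 2) two_ne_zero

lemma integrable_avg (hx : SqInt P x) : Integrable (fun ω => ‖avg (x ω)‖ ^ 2) P :=
  hx.memLp_avg.integrable_norm_pow (p := 2) two_ne_zero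

end SqInt

lemma sqInt_of_integrable_sq {x : Ω → Fin n → Vec d} (hm : ∀ i, Measurable fun ω => x ω i)
    (h : Integrable (fun ω => sq (x ω)) P) : SqInt P x := fun i => by
  rw [memLp_two_iff_integrable_sq_norm (hm i).aestronglyMeasurable]
  refine h.mono' ((hm i).norm.pow_const 2).aestronglyMeasurable
    (Filter.Eventually.of_forall fun ω => ?_)
  rw [Real.norm_of_nonneg (by positivity)]
  exact Finset.single_le_sum (f := fun i => ‖x ω i‖ ^ 2) (fun _ _ => by positivity)
    (Finset.mem_univ i)

/-- Second moments of a deterministic stack plus independent centered noise. -/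
lemma integral_sq_const_add [IsProbabilityMeasure P] {φ : Fin n → Ω → Vec d}
    (hφ : ∀ i, MemLp (φ i) 2 P) (h0 : ∀ i, ∫ ω, φ i ω ∂P = 0) (c : Fin n → Vec d) :
    ∫ ω, sq (c + fun i => φ i ω) ∂P = sq c + ∑ i, ∫ ω, ‖φ i ω‖ ^ 2 ∂P := by
  unfold sq
  rw [integral_finsetSum, ← Finset.sum_add_distrib]
  · exact Finset.sum_congr rfl fun i _ => integral_norm_const_add_sq (hφ i) (h0 i) (c i)
  · exact fun i _ => ((memLp_const (c i)).add (hφ i)).integrable_norm_pow (p := 2) two_ne_zero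

/-- Pairwise independence removes the cross terms, so 1/n² meets a sum of only n variances. This
gain of 1/n is the source of the speedup in the number of agents. -/
lemma integral_norm_avg_const_add_sq [IsProbabilityMeasure P] {φ : Fin n → Ω → Vec d}
    (hφ : ∀ i, MemLp (φ i) 2 P) (h0 : ∀ i, ∫ ω, φ i ω ∂P = 0)
    (hind : ∀ i j, i ≠ j → IndepFun (φ i) (φ j) P) (c : Fin n → Vec d) :
    ∫ ω, ‖avg (c + fun i => φ i ω)‖ ^ 2 ∂P
      = ‖avg c‖ ^ 2 + 1 / (n : ℝ) ^ 2 * ∑ i, ∫ ω, ‖φ i ω‖ ^ 2 ∂P := by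
  have hI : ∀ i, Integrable (φ i) P := fun i => (hφ i).integrable one_le_two
  have hs : MemLp (fun ω => avg (fun i => φ i ω)) 2 P :=
    SqInt.memLp_avg (x := fun ω i => φ i ω) hφ
  simp only [avg_add]
  rw [integral_norm_const_add_sq hs, ← integral_norm_sum_sq _ hφ h0 hind]
  · simp only [avg, norm_smul, mul_pow]
    rw [integral_const_mul]
    simp
  · simp only [avg]
    rw [integral_smul, integral_finsetSum _ fun i _ => hI i]
    simp [h0]

end Probability

/-! ### Sampling noise at fixed iterates -/

section Sampling

variable {n d : ℕ} {Z Ξ : Type*} [MeasurableSpace Z] [MeasurableSpace Ξ] {S : Setup n d Z Ξ}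
  {L σ β : ℝ}

/-- The momentum update, as a function of the new iterates, the old iterates, the old momentum
and the samples. -/
def Setup.momentum (S : Setup n d Z Ξ) (β : ℝ) (x' x v : Fin n → Vec d) (z : Fin n → Z) :
    Fin n → Vec d :=
  fun i => β • S.stochGrad i (x' i) (z i) +
    (1 - β) • (v i + S.stochGrad i (x' i) (z i) - S.stochGrad i (x i) (z i))

/-- The centered part of the momentum update of one agent. -/
def Setup.noise (S : Setup n d Z Ξ) (β : ℝ) (i : Fin n) (x' x : Vec d) (z : Z) : Vec d :=
  β • (S.stochGrad i x' z - gradient (S.localObj i) x') +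
    (1 - β) • ((S.stochGrad i x' z - S.stochGrad i x z)
      - (gradient (S.localObj i) x' - gradient (S.localObj i) x))

/-- The recursive variance reduction identity: the old error survives with weight 1−β, and what the
sample adds has mean zero. -/
lemma momentum_sub_gradStack (x' x v : Fin n → Vec d) (z : Fin n → Z) :
    S.momentum β x' x v z - S.gradStack x'
      = (1 - β) • (v - S.gradStack x) + fun i => S.noise β i (x' i) (x i) (z i) := by
  ext1 i
  simp only [Setup.momentum, Setup.gradStack, Setup.noise, Pi.sub_apply, Pi.add_apply,
    Pi.smul_apply]
  module

/-- The increment is not centered, but each of its three parts is small: a gradient difference at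
one sample, β times noise, and β times the old error. -/
lemma momentum_sub_self (x' x v : Fin n → Vec d) (z : Fin n → Z) (i : Fin n) :
    (S.momentum β x' x v z - v) i = (S.stochGrad i (x' i) (z i) - S.stochGrad i (x i) (z i))
      + (β • (S.stochGrad i (x i) (z i) - gradient (S.localObj i) (x i))
        + -(β • (v - S.gradStack x) i)) := by
  simp only [Setup.momentum, Setup.gradStack, Pi.sub_apply]
  module

lemma measurable_stochGrad_right (hr : S.Regular) (i : Fin n) (x : Vec d) :
    Measurable (S.stochGrad i x) :=
  (hr.stochGrad_measurable i).comp measurable_prodMk_left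

lemma memLp_stochGrad_sub (hr : S.Regular) (hv : S.BoundedVariance σ) (i : Fin n) (x : Vec d) :
    MemLp (fun z => S.stochGrad i x z - gradient (S.localObj i) x) 2 (S.dist i) := by
  have := hr.dist_prob i
  rw [memLp_two_iff_integrable_sq_norm
    ((measurable_stochGrad_right hr i x).sub_const _).aestronglyMeasurable]
  exact hv.variance_integrable i x

lemma memLp_stochGrad (hr : S.Regular) (hv : S.BoundedVariance σ) (i : Fin n) (x : Vec d) :
    MemLp (S.stochGrad i x) 2 (S.dist i) := by
  have := hr.dist_prob i
  have h := (memLp_stochGrad_sub hr hv i x).add (memLp_const (gradient (S.localObj i) x))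
  refine h.ae_eq (Filter.Eventually.of_forall fun z => ?_)
  simp

lemma integral_stochGrad_sub (hr : S.Regular) (hv : S.BoundedVariance σ) (i : Fin n) (x : Vec d) :
    ∫ z, (S.stochGrad i x z - gradient (S.localObj i) x) ∂(S.dist i) = 0 := by
  have := hr.dist_prob i
  rw [integral_sub (hv.integrable i x) (integrable_const _), hv.unbiased]
  simp

lemma memLp_noise (hr : S.Regular) (hv : S.BoundedVariance σ) (β : ℝ) (i : Fin n) (x' x : Vec d) :
    MemLp (S.noise β i x' x) 2 (S.dist i) := by
  have := hr.dist_prob i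
  exact ((memLp_stochGrad_sub hr hv i x').const_smul β).add
    ((((memLp_stochGrad hr hv i x').sub (memLp_stochGrad hr hv i x)).sub
      (memLp_const _)).const_smul (1 - β))

lemma measurable_noise (hr : S.Regular) (β : ℝ) (i : Fin n) (x' x : Vec d) :
    Measurable (S.noise β i x' x) :=
  (((measurable_stochGrad_right hr i x').sub_const _).const_smul β).add
    ((((measurable_stochGrad_right hr i x').sub (measurable_stochGrad_right hr i x)).sub_const
      _).const_smul (1 - β))

lemma integral_noise (hr : S.Regular) (hv : S.BoundedVariance σ) (β : ℝ) (i : Fin n)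
    (x' x : Vec d) : ∫ z, S.noise β i x' x z ∂(S.dist i) = 0 := by
  have := hr.dist_prob i
  have e : ∀ z, S.noise β i x' x z = (S.stochGrad i x' z - gradient (S.localObj i) x')
      - (1 - β) • (S.stochGrad i x z - gradient (S.localObj i) x) := by
    intro z; simp only [Setup.noise]; module
  simp only [e]
  have i1 := (memLp_stochGrad_sub hr hv i x').integrable one_le_two
  have i2 := (memLp_stochGrad_sub hr hv i x).integrable one_le_two
  have i3 : Integrable (fun z => (1 - β) • (S.stochGrad i x z - gradient (S.localObj i) x))
    (S.dist i) := i2.smul (1 - β)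
  rw [integral_sub i1 i3, integral_smul, integral_stochGrad_sub hr hv,
    integral_stochGrad_sub hr hv]
  simp

/-- The variance σ² appears only with weight β². The rest is a centered difference of gradients at
one sample, whose variance is at most its second moment, hence at most L² times the squared step. -/
lemma integral_norm_noise_sq_le (hr : S.Regular) (hs : S.Smooth L) (hv : S.BoundedVariance σ)
    (β : ℝ) (i : Fin n) (x' x : Vec d) :
    ∫ z, ‖S.noise β i x' x z‖ ^ 2 ∂(S.dist i)
      ≤ 2 * β ^ 2 * σ ^ 2 + 2 * (1 - β) ^ 2 * L ^ 2 * ‖x' - x‖ ^ 2 := by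
  have := hr.dist_prob i
  set A := fun z => S.stochGrad i x' z - gradient (S.localObj i) x'
  set B := fun z => (S.stochGrad i x' z - S.stochGrad i x z)
      - (gradient (S.localObj i) x' - gradient (S.localObj i) x)
  have hA : MemLp A 2 (S.dist i) := memLp_stochGrad_sub hr hv i x'
  have hD := (memLp_stochGrad hr hv i x').sub (memLp_stochGrad hr hv i x)
  have hB : MemLp B 2 (S.dist i) := hD.sub (memLp_const _)
  have iA := hA.integrable_norm_pow (p := 2) two_ne_zero
  have iB := hB.integrable_norm_pow (p := 2) two_ne_zero
  have iN := (memLp_noise hr hv β i x' x).integrable_norm_pow (p := 2) two_ne_zero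
  have h1 : ∀ z, ‖S.noise β i x' x z‖ ^ 2
      ≤ 2 * β ^ 2 * ‖A z‖ ^ 2 + 2 * (1 - β) ^ 2 * ‖B z‖ ^ 2 := by
    intro z
    have := norm_add_sq_le_young (β • A z) ((1 - β) • B z) one_pos
    rw [norm_smul, norm_smul, mul_pow, mul_pow, Real.norm_eq_abs, Real.norm_eq_abs, sq_abs,
      sq_abs] at this
    simp only [Setup.noise]
    refine this.trans (le_of_eq ?_)
    ring
  have h2 : ∫ z, ‖S.noise β i x' x z‖ ^ 2 ∂(S.dist i)
      ≤ 2 * β ^ 2 * ∫ z, ‖A z‖ ^ 2 ∂(S.dist i)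
        + 2 * (1 - β) ^ 2 * ∫ z, ‖B z‖ ^ 2 ∂(S.dist i) := by
    rw [← integral_const_mul, ← integral_const_mul,
      ← integral_add (iA.const_mul _) (iB.const_mul _)]
    exact integral_mono iN ((iA.const_mul _).add (iB.const_mul _)) h1
  have h3 : ∫ z, ‖A z‖ ^ 2 ∂(S.dist i) ≤ σ ^ 2 := hv.variance_le i x'
  have h4 : ∫ z, ‖B z‖ ^ 2 ∂(S.dist i) ≤ L ^ 2 * ‖x' - x‖ ^ 2 := by
    have h5 := integral_norm_sub_integral_sq_le hD
    have h6 : ∫ z, (S.stochGrad i x' - S.stochGrad i x) z ∂(S.dist i)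
        = gradient (S.localObj i) x' - gradient (S.localObj i) x := by
      simp only [Pi.sub_apply]
      rw [integral_sub (hv.integrable i x') (hv.integrable i x), hv.unbiased, hv.unbiased]
    rw [h6] at h5
    refine h5.trans ?_
    have h7 := integral_mono_ae (hD.integrable_norm_pow (p := 2) two_ne_zero)
      (integrable_const (L ^ 2 * ‖x' - x‖ ^ 2)) ((hs.2 i).mono fun z hz => ?_)
    · simpa using h7
    · rw [← mul_pow]
      exact pow_le_pow_left₀ (norm_nonneg _) (hz x' x) 2
  calc _ ≤ _ := h2
    _ ≤ 2 * β ^ 2 * σ ^ 2 + 2 * (1 - β) ^ 2 * (L ^ 2 * ‖x' - x‖ ^ 2) := by gcongr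
    _ = _ := by ring

/-- The joint law of one round of samples. -/
abbrev Setup.sampleLaw (S : Setup n d Z Ξ) : Measure (Fin n → Z) := Measure.pi S.dist

lemma Setup.Regular.isProbabilityMeasure_sampleLaw (hr : S.Regular) :
    IsProbabilityMeasure S.sampleLaw := by
  have := hr.dist_prob
  infer_instance

lemma memLp_comp_eval (hr : S.Regular) {φ : Z → Vec d} {i : Fin n} (h : MemLp φ 2 (S.dist i)) :
    MemLp (fun z : Fin n → Z => φ (z i)) 2 S.sampleLaw := by
  have := hr.dist_prob
  exact h.comp_measurePreserving (measurePreserving_eval S.dist i)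

lemma integral_comp_eval' {E : Type*} [NormedAddCommGroup E] [NormedSpace ℝ E]
    (hr : S.Regular) {φ : Z → E} (i : Fin n) (h : AEStronglyMeasurable φ (S.dist i)) :
    ∫ z, φ (z i) ∂S.sampleLaw = ∫ z, φ z ∂(S.dist i) := by
  have := hr.dist_prob
  have hm := (measurePreserving_eval S.dist i).map_eq
  rw [← hm] at h ⊢
  exact (integral_map (measurable_pi_apply i).aemeasurable h).symm

lemma indepFun_noise (hr : S.Regular) (β : ℝ) (x' x : Fin n → Vec d) (i j : Fin n) (hij : i ≠ j) :
    IndepFun (fun z : Fin n → Z => S.noise β i (x' i) (x i) (z i))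
      (fun z => S.noise β j (x' j) (x j) (z j)) S.sampleLaw := by
  have := hr.dist_prob
  exact (iIndepFun_pi (μ := S.dist) (X := fun i => S.noise β i (x' i) (x i))
    fun i => (measurable_noise hr β i (x' i) (x i)).aemeasurable).indepFun hij

lemma sum_integral_norm_noise_sq_le (hr : S.Regular) (hs : S.Smooth L) (hv : S.BoundedVariance σ)
    (β : ℝ) (x' x : Fin n → Vec d) :
    ∑ i, ∫ z, ‖S.noise β i (x' i) (x i) (z i)‖ ^ 2 ∂S.sampleLaw
      ≤ 2 * n * β ^ 2 * σ ^ 2 + 2 * (1 - β) ^ 2 * L ^ 2 * sq (x' - x) := by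
  have h : ∀ i, ∫ z, ‖S.noise β i (x' i) (x i) (z i)‖ ^ 2 ∂S.sampleLaw
      ≤ 2 * β ^ 2 * σ ^ 2 + 2 * (1 - β) ^ 2 * L ^ 2 * ‖x' i - x i‖ ^ 2 := fun i => by
    rw [integral_comp_eval' hr i (φ := fun z => ‖S.noise β i (x' i) (x i) z‖ ^ 2)
      ((measurable_noise hr β i (x' i) (x i)).norm.pow_const 2).aestronglyMeasurable]
    exact integral_norm_noise_sq_le hr hs hv β i (x' i) (x i)
  refine (Finset.sum_le_sum fun i _ => h i).trans (le_of_eq ?_)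
  simp only [sq, Finset.sum_add_distrib, ← Finset.mul_sum, Finset.sum_const, Finset.card_univ,
    Fintype.card_fin, nsmul_eq_mul, Pi.sub_apply]
  ring

lemma sqInt_momentum_sub_gradStack (hr : S.Regular) (hv : S.BoundedVariance σ)
    (β : ℝ) (x' x v : Fin n → Vec d) :
    SqInt S.sampleLaw (fun z => S.momentum β x' x v z - S.gradStack x') := by
  have := hr.isProbabilityMeasure_sampleLaw
  intro i
  have e : (fun z => (S.momentum β x' x v z - S.gradStack x') i)
      = fun z => ((1 - β) • (v - S.gradStack x)) i + S.noise β i (x' i) (x i) (z i) := by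
    ext1 z; rw [momentum_sub_gradStack]; rfl
  rw [e]
  exact (memLp_const (((1 - β) • (v - S.gradStack x)) i)).add
    (memLp_comp_eval hr (memLp_noise hr hv β i (x' i) (x i)))

lemma sqInt_momentum_sub_self (hr : S.Regular) (hv : S.BoundedVariance σ)
    (β : ℝ) (x' x v : Fin n → Vec d) :
    SqInt S.sampleLaw (fun z => S.momentum β x' x v z - v) := by
  have := hr.isProbabilityMeasure_sampleLaw
  intro i
  have e : (fun z => (S.momentum β x' x v z - v) i)
      = fun z => (S.stochGrad i (x' i) (z i) - S.stochGrad i (x i) (z i))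
        + (β • (S.stochGrad i (x i) (z i) - gradient (S.localObj i) (x i))
          + -(β • (v - S.gradStack x) i)) := by
    ext1 z; rw [momentum_sub_self]
  rw [e]
  exact ((memLp_comp_eval hr (memLp_stochGrad hr hv i (x' i))).sub
    (memLp_comp_eval hr (memLp_stochGrad hr hv i (x i)))).add
    (((memLp_comp_eval hr (memLp_stochGrad_sub hr hv i (x i))).const_smul β).add
      (memLp_const (β • (v - S.gradStack x) i)).neg)

lemma integral_sq_momentum_sub_gradStack_le (hr : S.Regular) (hs : S.Smooth L)
    (hv : S.BoundedVariance σ) (β : ℝ) (x' x v : Fin n → Vec d) :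
    ∫ z, sq (S.momentum β x' x v z - S.gradStack x') ∂S.sampleLaw
      ≤ (1 - β) ^ 2 * sq (v - S.gradStack x)
        + (2 * n * β ^ 2 * σ ^ 2 + 2 * (1 - β) ^ 2 * L ^ 2 * sq (x' - x)) := by
  have := hr.isProbabilityMeasure_sampleLaw
  simp only [momentum_sub_gradStack]
  rw [integral_sq_const_add (P := S.sampleLaw) (φ := fun i z => S.noise β i (x' i) (x i) (z i)),
    sq_smul]
  · have := sum_integral_norm_noise_sq_le hr hs hv β x' x
    linarith
  · exact fun i => memLp_comp_eval hr (memLp_noise hr hv β i (x' i) (x i))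
  · intro i
    rw [integral_comp_eval' hr i (measurable_noise hr β i (x' i) (x i)).aestronglyMeasurable]
    exact integral_noise hr hv β i (x' i) (x i)

lemma integral_norm_avg_momentum_sub_gradStack_le (hr : S.Regular) (hs : S.Smooth L)
    (hv : S.BoundedVariance σ) (β : ℝ) (x' x v : Fin n → Vec d) :
    ∫ z, ‖avg (S.momentum β x' x v z - S.gradStack x')‖ ^ 2 ∂S.sampleLaw
      ≤ (1 - β) ^ 2 * ‖avg (v - S.gradStack x)‖ ^ 2 + 1 / (n : ℝ) ^ 2 *
        (2 * n * β ^ 2 * σ ^ 2 + 2 * (1 - β) ^ 2 * L ^ 2 * sq (x' - x)) := by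
  have := hr.isProbabilityMeasure_sampleLaw
  simp only [momentum_sub_gradStack]
  rw [integral_norm_avg_const_add_sq (P := S.sampleLaw)
    (φ := fun i z => S.noise β i (x' i) (x i) (z i)), avg_smul,
    norm_smul, mul_pow, Real.norm_eq_abs, sq_abs]
  · have := sum_integral_norm_noise_sq_le hr hs hv β x' x
    gcongr
  · exact fun i => memLp_comp_eval hr (memLp_noise hr hv β i (x' i) (x i))
  · intro i
    rw [integral_comp_eval' hr i (measurable_noise hr β i (x' i) (x i)).aestronglyMeasurable]
    exact integral_noise hr hv β i (x' i) (x i)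
  · exact fun i j hij => indepFun_noise hr β x' x i j hij

lemma integral_sq_momentum_sub_self_le (hr : S.Regular) (hs : S.Smooth L)
    (hv : S.BoundedVariance σ) (β : ℝ) (x' x v : Fin n → Vec d) :
    ∫ z, sq (S.momentum β x' x v z - v) ∂S.sampleLaw
      ≤ 3 * L ^ 2 * sq (x' - x) + 3 * (n * β ^ 2 * σ ^ 2)
        + 3 * (β ^ 2 * sq (v - S.gradStack x)) := by
  have := hr.isProbabilityMeasure_sampleLaw
  have := hr.dist_prob
  have hi : ∀ i, ∫ z, ‖(S.momentum β x' x v z - v) i‖ ^ 2 ∂S.sampleLaw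
      ≤ 3 * L ^ 2 * ‖(x' - x) i‖ ^ 2 + 3 * (β ^ 2 * σ ^ 2)
        + 3 * (β ^ 2 * ‖(v - S.gradStack x) i‖ ^ 2) := by
    intro i
    have hA := memLp_comp_eval hr (memLp_stochGrad_sub hr hv i (x i))
    have iA := hA.integrable_norm_pow (p := 2) two_ne_zero
    have hL : ∀ᵐ z ∂S.sampleLaw, ‖S.stochGrad i (x' i) (z i) - S.stochGrad i (x i) (z i)‖ ^ 2
        ≤ L ^ 2 * ‖(x' - x) i‖ ^ 2 := by
      have := (measurePreserving_eval S.dist i).quasiMeasurePreserving.ae (hs.2 i)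
      refine this.mono fun z hz => ?_
      rw [← mul_pow]
      exact pow_le_pow_left₀ (norm_nonneg _) (hz (x' i) (x i)) 2
    have hb : ∀ᵐ z ∂S.sampleLaw, ‖(S.momentum β x' x v z - v) i‖ ^ 2
        ≤ 3 * L ^ 2 * ‖(x' - x) i‖ ^ 2 + 3 * (β ^ 2 * ‖(v - S.gradStack x) i‖ ^ 2)
          + 3 * β ^ 2 * ‖S.stochGrad i (x i) (z i) - gradient (S.localObj i) (x i)‖ ^ 2 := by
      refine hL.mono fun z hz => ?_
      rw [momentum_sub_self]
      -- Weights 2 and then 1 give all three parts the same factor 3.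
      have h1 := norm_add_sq_le_young (S.stochGrad i (x' i) (z i) - S.stochGrad i (x i) (z i))
        (β • (S.stochGrad i (x i) (z i) - gradient (S.localObj i) (x i))
          + -(β • (v - S.gradStack x) i)) two_pos
      have h2 := norm_add_sq_le_young
        (β • (S.stochGrad i (x i) (z i) - gradient (S.localObj i) (x i)))
        (-(β • (v - S.gradStack x) i)) one_pos
      rw [norm_neg, norm_smul, norm_smul, mul_pow, mul_pow, Real.norm_eq_abs, sq_abs] at h2
      linarith
    have h3 := integral_mono_ae
      ((sqInt_momentum_sub_self hr hv β x' x v i).integrable_norm_pow (p := 2) two_ne_zero)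
      ((integrable_const (3 * L ^ 2 * ‖(x' - x) i‖ ^ 2
        + 3 * (β ^ 2 * ‖(v - S.gradStack x) i‖ ^ 2))).add (iA.const_mul (3 * β ^ 2))) hb
    refine h3.trans ?_
    rw [integral_add' (integrable_const _) (iA.const_mul _), integral_const_mul,
      integral_comp_eval' hr i
        (φ := fun z => ‖S.stochGrad i (x i) z - gradient (S.localObj i) (x i)‖ ^ 2)
        (((measurable_stochGrad_right hr i (x i)).sub_const _).norm.pow_const
          2).aestronglyMeasurable]
    have h4 := mul_le_mul_of_nonneg_left (hv.variance_le i (x i))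
      (by positivity : 0 ≤ 3 * β ^ 2)
    simp only [integral_const, probReal_univ, one_smul]
    linarith
  have hsum : ∫ z, sq (S.momentum β x' x v z - v) ∂S.sampleLaw
      = ∑ i, ∫ z, ‖(S.momentum β x' x v z - v) i‖ ^ 2 ∂S.sampleLaw :=
    integral_finsetSum _ fun i _ =>
      (sqInt_momentum_sub_self hr hv β x' x v i).integrable_norm_pow (p := 2) two_ne_zero
  rw [hsum]
  refine (Finset.sum_le_sum fun i _ => hi i).trans (le_of_eq ?_)
  simp only [sq, Finset.sum_add_distrib, ← Finset.mul_sum, Finset.sum_const, Finset.card_univ,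
    Fintype.card_fin, nsmul_eq_mul]
  ring

end Sampling

/-! ### One iteration in terms of stacks -/

section Steps

variable {n d : ℕ} {Z Ξ : Type*} [MeasurableSpace Z] [MeasurableSpace Ξ] {S : Setup n d Z Ξ}

/-- The compression errors of the agents. -/
def Setup.compErr (S : Setup n d Z Ξ) (x : Fin n → Vec d) (ξ : Fin n → Ξ) : Fin n → Vec d :=
  fun i => S.comp (x i) (ξ i) - x i

lemma inputθ_eq (η : ℝ) (s : State n d) : inputθ η s = s.θ + (-η) • s.g - s.θhat := by
  ext1 i; simp only [inputθ, Pi.sub_apply, Pi.add_apply, Pi.smul_apply]; module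

/-- The old copy cancels: the new copy is the uncommunicated update plus the compression error. Both
halves of the iteration thus get the form x + u + γ(W−I)(x + u + q). -/
lemma nextθhat_eq (η : ℝ) (s : State n d) (ξ : Fin n → Ξ) :
    nextθhat S η s ξ = s.θ + (-η) • s.g + S.compErr (inputθ η s) ξ := by
  ext1 i
  simp only [nextθhat, Setup.compErr, inputθ, Pi.add_apply, Pi.smul_apply]; module

lemma nextθ_eq (η γ : ℝ) (s : State n d) (ξ : Fin n → Ξ) :
    nextθ S η γ s ξ = s.θ + (-η) • s.g
      + γ • lap S.W (s.θ + (-η) • s.g + S.compErr (inputθ η s) ξ) := by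
  rw [← nextθhat_eq]
  ext1 i
  simp only [nextθ, lap, Pi.add_apply, Pi.smul_apply]; module

lemma inputg_eq (η γ β : ℝ) (s : State n d) (ξ : Fin n → Ξ) (z : Fin n → Z) :
    inputg S η γ β s ξ z = s.g + (nextv S η γ β s ξ z - s.v) - s.ghat := by
  ext1 i; simp only [inputg, Pi.sub_apply, Pi.add_apply]; module

lemma nextghat_eq (η γ β : ℝ) (s : State n d) (ξ : Fin n → Ξ) (z : Fin n → Z) (χ : Fin n → Ξ) :
    nextghat S η γ β s ξ z χ = s.g + (nextv S η γ β s ξ z - s.v)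
      + S.compErr (inputg S η γ β s ξ z) χ := by
  ext1 i
  simp only [nextghat, Setup.compErr, inputg, Pi.add_apply, Pi.sub_apply]; module

lemma nextg_eq (η γ β : ℝ) (s : State n d) (ξ : Fin n → Ξ) (z : Fin n → Z) (χ : Fin n → Ξ) :
    nextg S η γ β s ξ z χ = s.g + (nextv S η γ β s ξ z - s.v)
      + γ • lap S.W (s.g + (nextv S η γ β s ξ z - s.v)
        + S.compErr (inputg S η γ β s ξ z) χ) := by
  rw [← nextghat_eq]
  ext1 i
  simp only [nextg, lap, Pi.add_apply, Pi.sub_apply, Pi.smul_apply]; module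

/-! ### Measurability -/

/-- All variables of a random state are measurable. -/
structure MeasurableState {Ω : Type*} [MeasurableSpace Ω] (s : Ω → State n d) : Prop where
  θ : ∀ i, Measurable fun ω => (s ω).θ i
  θhat : ∀ i, Measurable fun ω => (s ω).θhat i
  v : ∀ i, Measurable fun ω => (s ω).v i
  g : ∀ i, Measurable fun ω => (s ω).g i
  ghat : ∀ i, Measurable fun ω => (s ω).ghat i

variable {Ω : Type*} [MeasurableSpace Ω]

lemma Setup.Regular.measurable_stochGrad_comp (hr : S.Regular) (i : Fin n) {x : Ω → Vec d}
    {z : Ω → Z} (hx : Measurable x) (hz : Measurable z) :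
    Measurable fun ω => S.stochGrad i (x ω) (z ω) :=
  (hr.stochGrad_measurable i).comp (hx.prodMk hz)

lemma Setup.Regular.measurable_comp_comp (hr : S.Regular) {x : Ω → Vec d}
    {ξ : Ω → Ξ} (hx : Measurable x) (hξ : Measurable ξ) :
    Measurable fun ω => S.comp (x ω) (ξ ω) :=
  hr.comp_measurable.comp (hx.prodMk hξ)

lemma Setup.Regular.measurable_momentum (hr : S.Regular) (β : ℝ) {x' x v : Ω → Fin n → Vec d}
    {z : Ω → Fin n → Z} (hx' : ∀ i, Measurable fun ω => x' ω i)
    (hx : ∀ i, Measurable fun ω => x ω i) (hv : ∀ i, Measurable fun ω => v ω i)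
    (hz : ∀ i, Measurable fun ω => z ω i) (i : Fin n) :
    Measurable fun ω => S.momentum β (x' ω) (x ω) (v ω) (z ω) i := by
  have h1 := hr.measurable_stochGrad_comp i (hx' i) (hz i)
  have h2 := hr.measurable_stochGrad_comp i (hx i) (hz i)
  exact (h1.const_smul β).add ((((hv i).add h1).sub h2).const_smul (1 - β))

namespace MeasurableState

variable {s : Ω → State n d} {η γ β : ℝ} {ξ χ : Ω → Fin n → Ξ} {z : Ω → Fin n → Z}

lemma inputθ (hs : MeasurableState s) (i : Fin n) : Measurable fun ω => inputθ η (s ω) i :=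
  ((hs.θ i).sub ((hs.g i).const_smul η)).sub (hs.θhat i)

lemma nextθhat (hr : S.Regular) (hs : MeasurableState s) (hξ : ∀ i, Measurable fun ω => ξ ω i)
    (i : Fin n) : Measurable fun ω => nextθhat S η (s ω) (ξ ω) i :=
  (hs.θhat i).add (hr.measurable_comp_comp (hs.inputθ i) (hξ i))

lemma nextθ (hr : S.Regular) (hs : MeasurableState s) (hξ : ∀ i, Measurable fun ω => ξ ω i)
    (i : Fin n) : Measurable fun ω => nextθ S η γ (s ω) (ξ ω) i := by
  have h := hs.nextθhat (η := η) hr hξ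
  exact ((hs.θ i).sub ((hs.g i).const_smul η)).add ((Finset.measurable_sum _ fun j _ =>
    ((h j).sub (h i)).const_smul (S.W i j)).const_smul γ)

lemma nextv (hr : S.Regular) (hs : MeasurableState s) (hξ : ∀ i, Measurable fun ω => ξ ω i)
    (hz : ∀ i, Measurable fun ω => z ω i) (i : Fin n) :
    Measurable fun ω => nextv S η γ β (s ω) (ξ ω) (z ω) i :=
  hr.measurable_momentum β (hs.nextθ hr hξ) hs.θ hs.v hz i

lemma inputg (hr : S.Regular) (hs : MeasurableState s) (hξ : ∀ i, Measurable fun ω => ξ ω i)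
    (hz : ∀ i, Measurable fun ω => z ω i) (i : Fin n) :
    Measurable fun ω => inputg S η γ β (s ω) (ξ ω) (z ω) i :=
  (((hs.g i).add (hs.nextv hr hξ hz i)).sub (hs.v i)).sub (hs.ghat i)

lemma nextghat (hr : S.Regular) (hs : MeasurableState s) (hξ : ∀ i, Measurable fun ω => ξ ω i)
    (hz : ∀ i, Measurable fun ω => z ω i) (hχ : ∀ i, Measurable fun ω => χ ω i) (i : Fin n) :
    Measurable fun ω => nextghat S η γ β (s ω) (ξ ω) (z ω) (χ ω) i :=
  (hs.ghat i).add (hr.measurable_comp_comp (hs.inputg hr hξ hz i) (hχ i))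

lemma nextg (hr : S.Regular) (hs : MeasurableState s) (hξ : ∀ i, Measurable fun ω => ξ ω i)
    (hz : ∀ i, Measurable fun ω => z ω i) (hχ : ∀ i, Measurable fun ω => χ ω i) (i : Fin n) :
    Measurable fun ω => nextg S η γ β (s ω) (ξ ω) (z ω) (χ ω) i := by
  have h := hs.nextghat (η := η) (γ := γ) (β := β) hr hξ hz hχ
  exact (((hs.g i).add (hs.nextv hr hξ hz i)).sub (hs.v i)).add ((Finset.measurable_sum _ fun j _ =>
    ((h j).sub (h i)).const_smul (S.W i j)).const_smul γ)

lemma step (hr : S.Regular) (hs : MeasurableState s) (hξ : ∀ i, Measurable fun ω => ξ ω i)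
    (hz : ∀ i, Measurable fun ω => z ω i) (hχ : ∀ i, Measurable fun ω => χ ω i) :
    MeasurableState fun ω => step S η γ β (s ω) (ξ ω) (z ω) (χ ω) where
  θ := hs.nextθ hr hξ
  θhat := hs.nextθhat hr hξ
  v := hs.nextv hr hξ hz
  g := hs.nextg hr hξ hz hχ
  ghat := hs.nextghat hr hξ hz hχ

end MeasurableState

/-- Only draws before time t are required to be measurable, so the lemma also applies to the
σ-algebra generated by the history. -/
lemma measurableState_iter (hr : S.Regular) {p : Params d} {D : Ω → Draws n p.b₀ Z Ξ} (t : ℕ)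
    (h0 : ∀ i r, Measurable fun ω => (D ω).init i r)
    (hz : ∀ s < t, ∀ i, Measurable fun ω => (D ω).sample s i)
    (hξ : ∀ s < t, ∀ i, Measurable fun ω => (D ω).noiseθ s i)
    (hχ : ∀ s < t, ∀ i, Measurable fun ω => (D ω).noiseg s i) :
    MeasurableState fun ω => iter S p (D ω) t := by
  induction t with
  | zero =>
    have hv : ∀ i, Measurable fun ω =>
        (1 / (p.b₀ : ℝ)) • ∑ r, S.stochGrad i p.θ₀ ((D ω).init i r) := fun i =>
      (Finset.measurable_sum _ fun r _ =>
        hr.measurable_stochGrad_comp i measurable_const (h0 i r)).const_smul (1 / (p.b₀ : ℝ))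
    exact ⟨fun i => measurable_const, fun i => measurable_const, hv, hv, fun i => measurable_const⟩
  | succ t ih =>
    exact (ih (fun s hs => hz s (by omega)) (fun s hs => hξ s (by omega))
      (fun s hs => hχ s (by omega))).step hr (hξ t (by omega)) (hz t (by omega)) (hχ t (by omega))

end Steps

/-! ### The law of one iteration -/

section Run

variable {n d : ℕ} {Z Ξ : Type*} [MeasurableSpace Z] [MeasurableSpace Ξ] {S : Setup n d Z Ξ}
  {p : Params d} {Ω : Type*} [MeasurableSpace Ω] {P : Measure Ω} {D : Ω → Draws n p.b₀ Z Ξ}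

lemma IsRun.measurableState (hD : IsRun S p P D) (hr : S.Regular) (t : ℕ) :
    MeasurableState fun ω => iter S p (D ω) t :=
  measurableState_iter hr t hD.init_measurable (fun s _ => hD.sample_measurable s)
    (fun s _ => hD.noiseθ_measurable s) (fun s _ => hD.noiseg_measurable s)

/-- The new iterates, the old iterates and the old momentum of iteration `t`. -/
def momentumInput (S : Setup n d Z Ξ) (p : Params d) (D : Draws n p.b₀ Z Ξ) (t : ℕ) :
    (Fin n → Vec d) × (Fin n → Vec d) × (Fin n → Vec d) :=
  (nextθ S p.η p.γ (iter S p D t) (D.noiseθ t), (iter S p D t).θ, (iter S p D t).v)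

/-- The new iterates use the compressor noise of round t but not its sample, so they are functions
of a history that is independent of that sample. -/
lemma measurable_momentumInput_comap_history {Ω' : Type*} {D : Ω' → Draws n p.b₀ Z Ξ}
    (hr : S.Regular) (t : ℕ) :
    Measurable[MeasurableSpace.comap (fun ω => (D ω).history t) inferInstance]
      fun ω => momentumInput S p (D ω) t := by
  -- With this σ-algebra as the instance, the general measurability lemmas prove measurability with
  -- respect to the history.
  let _ : MeasurableSpace Ω' := MeasurableSpace.comap (fun ω => (D ω).history t) inferInstance
  have hH : Measurable fun ω => (D ω).history t := comap_measurable _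
  have h0 : ∀ i r, Measurable fun ω => (D ω).init i r := fun i r =>
    (measurable_pi_apply r).comp ((measurable_pi_apply i).comp hH.fst)
  have hz : ∀ s < t, ∀ i, Measurable fun ω => (D ω).sample s i := fun s hs i =>
    (measurable_pi_apply i).comp ((measurable_pi_apply (⟨s, hs⟩ : Fin t)).comp hH.snd.fst)
  have hξ : ∀ s < t + 1, ∀ i, Measurable fun ω => (D ω).noiseθ s i := fun s hs i =>
    (measurable_pi_apply i).comp
      ((measurable_pi_apply (⟨s, hs⟩ : Fin (t + 1))).comp hH.snd.snd.fst)
  have hχ : ∀ s < t, ∀ i, Measurable fun ω => (D ω).noiseg s i := fun s hs i =>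
    (measurable_pi_apply i).comp ((measurable_pi_apply (⟨s, hs⟩ : Fin t)).comp hH.snd.snd.snd)
  have hs := measurableState_iter (S := S) (p := p) (D := D) hr t h0 hz
    (fun s hs => hξ s (by omega)) hχ
  have hn := hs.nextθ (η := p.η) (γ := p.γ) hr (hξ t (by omega))
  exact (measurable_pi_lambda _ hn).prodMk
    ((measurable_pi_lambda _ hs.θ).prodMk (measurable_pi_lambda _ hs.v))

lemma IsRun.measurable_momentumInput (hD : IsRun S p P D) (hr : S.Regular) (t : ℕ) :
    Measurable fun ω => momentumInput S p (D ω) t := by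
  have hs := hD.measurableState hr t
  have hn := hs.nextθ (η := p.η) (γ := p.γ) hr (hD.noiseθ_measurable t)
  exact (measurable_pi_lambda _ hn).prodMk
    ((measurable_pi_lambda _ hs.θ).prodMk (measurable_pi_lambda _ hs.v))

/-- Given the new iterates, the fresh samples follow the product of the data distributions. -/
lemma IsRun.hasCondDistrib_sample [IsProbabilityMeasure P] (hD : IsRun S p P D) (hr : S.Regular)
    (t : ℕ) :
    HasCondDistrib (fun ω => (D ω).sample t) (fun ω => momentumInput S p (D ω) t)
      (Kernel.const _ S.sampleLaw) P := by
  have hX := hD.measurable_momentumInput hr t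
  have hY : Measurable fun ω => (D ω).sample t := measurable_pi_lambda _ (hD.sample_measurable t)
  have := hr.isProbabilityMeasure_sampleLaw
  have hind : IndepFun (fun ω => (D ω).sample t) (fun ω => momentumInput S p (D ω) t) P := by
    have h := hD.sample_indep_history t
    rw [IndepFun_iff_Indep] at h ⊢
    exact indep_of_indep_of_le_right h
      (measurable_momentumInput_comap_history hr t).comap_le
  have hlaw : P.map (fun ω => (D ω).sample t) = S.sampleLaw := by
    have h := (iIndepFun_iff_map_fun_eq_pi_map
      (f := fun (i : Fin n) ω => (D ω).sample t i)
      fun i => (hD.sample_measurable t i).aemeasurable).1 (hD.sample_indep t)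
    simp only [hD.sample_law] at h
    exact h
  have h2 := (indepFun_iff_map_prod_eq_prod_map_map hX.aemeasurable hY.aemeasurable).1 hind.symm
  refine ⟨(hX.prodMk hY).aemeasurable, ?_⟩
  rw [h2, hlaw]
  have := Measure.isProbabilityMeasure_map (μ := P) hX.aemeasurable
  rw [Measure.compProd_const]

/-- The compression error contracts in mean square. -/
lemma compErr_sqInt_and_integral_le [IsProbabilityMeasure P] {δ : ℝ} (hr : S.Regular)
    (hc : S.Contractive δ) {x : Ω → Fin n → Vec d} {ξ : Ω → Fin n → Ξ}
    (hxm : ∀ i, Measurable fun ω => x ω i) (hξm : ∀ i, Measurable fun ω => ξ ω i)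
    (hlaw : ∀ i, HasCondDistrib (fun ω => ξ ω i) (fun ω => x ω i) S.compLaw P)
    (hx : SqInt P x) :
    SqInt P (fun ω => S.compErr (x ω) (ξ ω)) ∧
      ∫ ω, sq (S.compErr (x ω) (ξ ω)) ∂P ≤ (1 - δ) * ∫ ω, sq (x ω) ∂P := by
  have := hr.compLaw_markov
  -- The bound is obtained agent by agent and then summed, so no joint law of the agents'
  -- compressors is needed.
  have key : ∀ i, Integrable (fun ω => ‖S.compErr (x ω) (ξ ω) i‖ ^ 2) P ∧
      ∫ ω, ‖S.compErr (x ω) (ξ ω) i‖ ^ 2 ∂P ≤ ∫ ω, (1 - δ) * ‖x ω i‖ ^ 2 ∂P := by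
    intro i
    refine integrable_and_integral_le_of_hasCondDistrib (hlaw i)
      (F := fun a b => ‖S.comp a b - a‖ ^ 2) (R := fun a => (1 - δ) * ‖a‖ ^ 2)
      ((hr.comp_measurable.sub measurable_fst).norm.pow_const 2) (fun _ _ => by positivity)
      (by fun_prop) (fun a => ?_) (fun a => ?_)
      (((hx i).integrable_norm_pow (p := 2) two_ne_zero).const_mul _)
    · simp only [norm_sub_rev _ a]; exact hc.error_integrable a
    · simp only [norm_sub_rev _ a]; exact hc.error_le a
  constructor
  · intro i
    exact (memLp_two_iff_integrable_sq_norm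
      ((hr.measurable_comp_comp (hxm i) (hξm i)).sub (hxm i)).aestronglyMeasurable).2 (key i).1
  · unfold sq
    rw [integral_finsetSum _ fun i _ => (key i).1,
      integral_finsetSum _ fun i _ => (hx i).integrable_norm_pow (p := 2) two_ne_zero,
      Finset.mul_sum]
    exact Finset.sum_le_sum fun i _ => (key i).2.trans (integral_const_mul _ _).le

end Run

/-! ### Square integrability -/

section SquareIntegrability

variable {n d : ℕ} {Z Ξ : Type*} [MeasurableSpace Z] [MeasurableSpace Ξ] {S : Setup n d Z Ξ}
  {p : Params d} {Ω : Type*} [MeasurableSpace Ω] {P : Measure Ω} {D : Ω → Draws n p.b₀ Z Ξ}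
  {L ρ ω σ δ : ℝ}

/-- All variables of a random state are square integrable. -/
structure SqIntState (P : Measure Ω) (s : Ω → State n d) : Prop where
  θ : SqInt P fun ω => (s ω).θ
  θhat : SqInt P fun ω => (s ω).θhat
  v : SqInt P fun ω => (s ω).v
  g : SqInt P fun ω => (s ω).g
  ghat : SqInt P fun ω => (s ω).ghat

lemma sqInt_gradStack [IsProbabilityMeasure P] (hr : S.Regular) (hs : S.Smooth L)
    (hv : S.BoundedVariance σ) {x : Ω → Fin n → Vec d} (hm : ∀ i, Measurable fun ω => x ω i)
    (hx : SqInt P x) : SqInt P fun ω => S.gradStack (x ω) := fun i => by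
  refine ((memLp_const ‖gradient (S.localObj i) 0‖).add ((hx i).norm.const_mul L)).mono'
    (g := fun ω => ‖gradient (S.localObj i) 0‖ + L * ‖x ω i‖)
    ((continuous_gradient_localObj hr hs hv i).measurable.comp (hm i)).aestronglyMeasurable
    (Filter.Eventually.of_forall fun ω => ?_)
  have h := norm_gradient_localObj_sub_le hr hs hv i (x ω i) 0
  rw [sub_zero] at h
  have h2 := norm_sub_norm_le (gradient (S.localObj i) (x ω i)) (gradient (S.localObj i) 0)
  simp only [Setup.gradStack]
  linarith

/-- The compression errors of the first compression step of iteration `t`. -/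
def errθ (S : Setup n d Z Ξ) (p : Params d) (D : Draws n p.b₀ Z Ξ) (t : ℕ) : Fin n → Vec d :=
  S.compErr (inputθ p.η (iter S p D t)) (D.noiseθ t)

/-- The compression errors of the second compression step of iteration `t`. -/
def errg (S : Setup n d Z Ξ) (p : Params d) (D : Draws n p.b₀ Z Ξ) (t : ℕ) : Fin n → Vec d :=
  S.compErr (inputg S p.η p.γ p.β (iter S p D t) (D.noiseθ t) (D.sample t)) (D.noiseg t)

/-- The increment of the momentum in iteration `t`. -/
def incv (S : Setup n d Z Ξ) (p : Params d) (D : Draws n p.b₀ Z Ξ) (t : ℕ) : Fin n → Vec d :=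
  (iter S p D (t + 1)).v - (iter S p D t).v

lemma inputθ_iter_eq (D : Draws n p.b₀ Z Ξ) (t : ℕ) : inputθ p.η (iter S p D t)
    = (iter S p D t).θ + (-p.η) • (iter S p D t).g - (iter S p D t).θhat := inputθ_eq _ _

lemma inputg_iter_eq (D : Draws n p.b₀ Z Ξ) (t : ℕ) :
    inputg S p.η p.γ p.β (iter S p D t) (D.noiseθ t) (D.sample t)
      = (iter S p D t).g + incv S p D t - (iter S p D t).ghat := inputg_eq _ _ _ _ _ _

lemma iter_succ_θ (D : Draws n p.b₀ Z Ξ) (t : ℕ) : (iter S p D (t + 1)).θ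
    = (iter S p D t).θ + (-p.η) • (iter S p D t).g + p.γ • lap S.W
      ((iter S p D t).θ + (-p.η) • (iter S p D t).g + errθ S p D t) := nextθ_eq _ _ _ _

lemma iter_succ_θhat (D : Draws n p.b₀ Z Ξ) (t : ℕ) : (iter S p D (t + 1)).θhat
    = (iter S p D t).θ + (-p.η) • (iter S p D t).g + errθ S p D t := nextθhat_eq _ _ _

lemma iter_succ_g (D : Draws n p.b₀ Z Ξ) (t : ℕ) : (iter S p D (t + 1)).g
    = (iter S p D t).g + incv S p D t + p.γ • lap S.W
      ((iter S p D t).g + incv S p D t + errg S p D t) := nextg_eq _ _ _ _ _ _ _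

lemma iter_succ_ghat (D : Draws n p.b₀ Z Ξ) (t : ℕ) : (iter S p D (t + 1)).ghat
    = (iter S p D t).g + incv S p D t + errg S p D t := nextghat_eq _ _ _ _ _ _ _

variable [IsProbabilityMeasure P]

lemma integrable_affine {f g : Ω → ℝ} (hf : Integrable f P) (hg : Integrable g P) (a b c : ℝ) :
    Integrable (fun ω => a * f ω + b * g ω + c) P :=
  ((hf.const_mul a).add (hg.const_mul b)).add (integrable_const c)

lemma integral_affine {f g : Ω → ℝ} (hf : Integrable f P) (hg : Integrable g P) (a b c : ℝ) :
    ∫ ω, (a * f ω + b * g ω + c) ∂P = a * ∫ ω, f ω ∂P + b * ∫ ω, g ω ∂P + c := by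
  rw [integral_add (f := fun ω => a * f ω + b * g ω) ((hf.const_mul a).add (hg.const_mul b))
    (integrable_const c), integral_add (hf.const_mul a) (hg.const_mul b), integral_const_mul,
    integral_const_mul]
  simp

/-! ### One iteration in mean square -/

section OneStep

variable (hA : S.Assumptions L ρ ω σ δ) (hD : IsRun S p P D) (t : ℕ)
  (hI : SqIntState P fun ω => iter S p (D ω) t)

include hA hD hI

lemma sqInt_errθ : SqInt P (fun ω => errθ S p (D ω) t) ∧
    ∫ ω, sq (errθ S p (D ω) t) ∂P ≤ (1 - δ) * ∫ ω, sq ((iter S p (D ω) t).θ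
      + (-p.η) • (iter S p (D ω) t).g - (iter S p (D ω) t).θhat) ∂P := by
  have hin := (hI.θ.add (hI.g.const_smul (-p.η))).sub hI.θhat
  simp only [← inputθ_iter_eq] at hin ⊢
  exact compErr_sqInt_and_integral_le hA.regular hA.contractive
    ((hD.measurableState hA.regular t).inputθ) (hD.noiseθ_measurable t) (hD.noiseθ_law t) hin

lemma sqInt_succ_θ : SqInt P (fun ω => (iter S p (D ω) (t + 1)).θ) := by
  have hu := hI.θ.add (hI.g.const_smul (-p.η))
  simp only [iter_succ_θ]
  exact hu.add (((hu.add (sqInt_errθ hA hD t hI).1).lap S.W).const_smul p.γ)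

lemma sqInt_err_v : SqInt P (fun ω => (iter S p (D ω) t).v
    - S.gradStack (iter S p (D ω) t).θ) :=
  hI.v.sub (sqInt_gradStack hA.regular hA.smooth hA.boundedVariance
    (hD.measurableState hA.regular t).θ hI.θ)

-- Conditioning on all that precedes the fresh sample: its conditional law is the constant kernel
-- `S.sampleLaw`, so bounds proved at fixed iterates integrate. Two terms and a constant are the
-- common shape of the three momentum estimates.
omit hI in
lemma integral_le_of_sample {F : (Fin n → Vec d) × (Fin n → Vec d) × (Fin n → Vec d) →
      (Fin n → Z) → ℝ}
    (hF : Measurable (fun q : ((Fin n → Vec d) × (Fin n → Vec d) × (Fin n → Vec d)) ×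
      (Fin n → Z) => F q.1 q.2)) (h0 : ∀ a b, 0 ≤ F a b)
    {f g : (Fin n → Vec d) × (Fin n → Vec d) × (Fin n → Vec d) → ℝ}
    (hfm : Measurable f) (hgm : Measurable g) (a b c : ℝ)
    (hFi : ∀ y, Integrable (F y) S.sampleLaw)
    (hFR : ∀ y, ∫ z, F y z ∂S.sampleLaw ≤ a * f y + b * g y + c)
    (hf : Integrable (fun ω => f (momentumInput S p (D ω) t)) P)
    (hg : Integrable (fun ω => g (momentumInput S p (D ω) t)) P) :
    Integrable (fun ω => F (momentumInput S p (D ω) t) ((D ω).sample t)) P ∧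
    ∫ ω, F (momentumInput S p (D ω) t) ((D ω).sample t) ∂P
      ≤ a * ∫ ω, f (momentumInput S p (D ω) t) ∂P + b * ∫ ω, g (momentumInput S p (D ω) t) ∂P
        + c := by
  have := hA.regular.isProbabilityMeasure_sampleLaw
  rw [← integral_affine hf hg]
  exact integrable_and_integral_le_of_hasCondDistrib
    (hD.hasCondDistrib_sample hA.regular t) hF h0
    (((hfm.const_mul a).add (hgm.const_mul b)).add_const c)
    hFi hFR (integrable_affine hf hg a b c)

omit [IsProbabilityMeasure P] hD hI in
lemma measurable_gradStack_apply {A : Type*} [MeasurableSpace A] {x : A → Fin n → Vec d}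
    (hx : Measurable x) (i : Fin n) : Measurable fun a => S.gradStack (x a) i :=
  (continuous_gradient_localObj hA.regular hA.smooth hA.boundedVariance i).measurable.comp
    ((measurable_pi_apply i).comp hx)

end OneStep

omit [IsProbabilityMeasure P] in
lemma measurable_sq {A : Type*} [MeasurableSpace A] {x : A → Fin n → Vec d}
    (hx : ∀ i, Measurable fun a => x a i) : Measurable fun a => sq (x a) :=
  Finset.measurable_sum _ fun i _ => (hx i).norm.pow_const 2

omit [IsProbabilityMeasure P] in
lemma measurable_avg {A : Type*} [MeasurableSpace A] {x : A → Fin n → Vec d}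
    (hx : ∀ i, Measurable fun a => x a i) : Measurable fun a => avg (x a) :=
  (Finset.measurable_sum Finset.univ fun i _ => hx i).const_smul (1 / (n : ℝ))

section OneStep

variable (hA : S.Assumptions L ρ ω σ δ) (hD : IsRun S p P D) (t : ℕ)
  (hI : SqIntState P fun ω => iter S p (D ω) t)

omit [MeasurableSpace Ω] [IsProbabilityMeasure P] in
lemma measurable_momentum_apply (hr : S.Regular) (β : ℝ) (i : Fin n) :
    Measurable fun q : ((Fin n → Vec d) × (Fin n → Vec d) × (Fin n → Vec d)) × (Fin n → Z) =>
      S.momentum β q.1.1 q.1.2.1 q.1.2.2 q.2 i :=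
  hr.measurable_momentum β (fun i => by fun_prop) (fun i => by fun_prop) (fun i => by fun_prop)
    (fun i => by fun_prop) i

include hA hD hI

/-- Both claims come from one conditional bound: its finiteness makes the new momentum square
integrable and lets the induction over time proceed. -/
lemma sqInt_incv : SqInt P (fun ω => incv S p (D ω) t) ∧
    ∫ ω, sq (incv S p (D ω) t) ∂P
      ≤ 3 * L ^ 2 * ∫ ω, sq ((iter S p (D ω) (t + 1)).θ - (iter S p (D ω) t).θ) ∂P
        + 3 * p.β ^ 2 * ∫ ω, sq ((iter S p (D ω) t).v - S.gradStack (iter S p (D ω) t).θ) ∂P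
        + 3 * (n * p.β ^ 2 * σ ^ 2) := by
  have key := integral_le_of_sample hA hD t
    (F := fun a z => sq (S.momentum p.β a.1 a.2.1 a.2.2 z - a.2.2))
    (f := fun a => sq (a.1 - a.2.1)) (g := fun a => sq (a.2.2 - S.gradStack a.2.1))
    (measurable_sq fun i => (measurable_momentum_apply hA.regular p.β i).sub (by fun_prop))
    (fun _ _ => sq_nonneg' _) (measurable_sq fun i => by simp only [Pi.sub_apply]; fun_prop)
    (measurable_sq fun i => Measurable.sub (by fun_prop)
      (measurable_gradStack_apply hA (by fun_prop) i))
    (3 * L ^ 2) (3 * p.β ^ 2) (3 * (n * p.β ^ 2 * σ ^ 2))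
    (fun a => (sqInt_momentum_sub_self hA.regular hA.boundedVariance p.β _ _ _).integrable_sq)
    (fun a => (integral_sq_momentum_sub_self_le hA.regular hA.smooth hA.boundedVariance p.β
      _ _ _).trans_eq (by ring))
    ((sqInt_succ_θ hA hD t hI).sub hI.θ).integrable_sq (sqInt_err_v hA hD t hI).integrable_sq
  exact ⟨sqInt_of_integrable_sq (fun i => ((hD.measurableState hA.regular (t + 1)).v i).sub
    ((hD.measurableState hA.regular t).v i)) key.1, key.2⟩

lemma integral_sq_err_v_succ_le :
    ∫ ω, sq ((iter S p (D ω) (t + 1)).v - S.gradStack (iter S p (D ω) (t + 1)).θ) ∂P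
      ≤ (1 - p.β) ^ 2 * ∫ ω, sq ((iter S p (D ω) t).v - S.gradStack (iter S p (D ω) t).θ) ∂P
        + 2 * (1 - p.β) ^ 2 * L ^ 2 *
          ∫ ω, sq ((iter S p (D ω) (t + 1)).θ - (iter S p (D ω) t).θ) ∂P
        + 2 * (n * p.β ^ 2 * σ ^ 2) :=
  (integral_le_of_sample hA hD t
    (F := fun a z => sq (S.momentum p.β a.1 a.2.1 a.2.2 z - S.gradStack a.1))
    (f := fun a => sq (a.2.2 - S.gradStack a.2.1)) (g := fun a => sq (a.1 - a.2.1))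
    (measurable_sq fun i => (measurable_momentum_apply hA.regular p.β i).sub
      (measurable_gradStack_apply hA (by fun_prop) i))
    (fun _ _ => sq_nonneg' _) (measurable_sq fun i => Measurable.sub (by fun_prop)
      (measurable_gradStack_apply hA (by fun_prop) i))
    (measurable_sq fun i => by simp only [Pi.sub_apply]; fun_prop)
    ((1 - p.β) ^ 2) (2 * (1 - p.β) ^ 2 * L ^ 2) (2 * (n * p.β ^ 2 * σ ^ 2))
    (fun a => (sqInt_momentum_sub_gradStack hA.regular hA.boundedVariance p.β _ _ _).integrable_sq)
    (fun a => (integral_sq_momentum_sub_gradStack_le hA.regular hA.smooth hA.boundedVariance p.β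
      _ _ _).trans_eq (by ring))
    (sqInt_err_v hA hD t hI).integrable_sq
    ((sqInt_succ_θ hA hD t hI).sub hI.θ).integrable_sq).2

lemma integral_norm_avg_err_v_succ_le :
    ∫ ω, ‖avg ((iter S p (D ω) (t + 1)).v - S.gradStack (iter S p (D ω) (t + 1)).θ)‖ ^ 2 ∂P
      ≤ (1 - p.β) ^ 2 *
          ∫ ω, ‖avg ((iter S p (D ω) t).v - S.gradStack (iter S p (D ω) t).θ)‖ ^ 2 ∂P
        + 1 / (n : ℝ) ^ 2 * (2 * (1 - p.β) ^ 2 * L ^ 2) *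
          ∫ ω, sq ((iter S p (D ω) (t + 1)).θ - (iter S p (D ω) t).θ) ∂P
        + 1 / (n : ℝ) ^ 2 * (2 * (n * p.β ^ 2 * σ ^ 2)) :=
  (integral_le_of_sample hA hD t
    (F := fun a z => ‖avg (S.momentum p.β a.1 a.2.1 a.2.2 z - S.gradStack a.1)‖ ^ 2)
    (f := fun a => ‖avg (a.2.2 - S.gradStack a.2.1)‖ ^ 2) (g := fun a => sq (a.1 - a.2.1))
    ((measurable_avg fun i => (measurable_momentum_apply hA.regular p.β i).sub
      (measurable_gradStack_apply hA (by fun_prop) i)).norm.pow_const 2)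
    (fun _ _ => sq_nonneg _)
    ((measurable_avg fun i => Measurable.sub (by fun_prop)
      (measurable_gradStack_apply hA (by fun_prop) i)).norm.pow_const 2)
    (measurable_sq fun i => by simp only [Pi.sub_apply]; fun_prop)
    ((1 - p.β) ^ 2) (1 / (n : ℝ) ^ 2 * (2 * (1 - p.β) ^ 2 * L ^ 2))
    (1 / (n : ℝ) ^ 2 * (2 * (n * p.β ^ 2 * σ ^ 2)))
    (fun a => (sqInt_momentum_sub_gradStack hA.regular hA.boundedVariance p.β _ _ _).integrable_avg)
    (fun a => (integral_norm_avg_momentum_sub_gradStack_le hA.regular hA.smooth hA.boundedVariance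
      p.β _ _ _).trans_eq (by ring))
    (sqInt_err_v hA hD t hI).integrable_avg
    ((sqInt_succ_θ hA hD t hI).sub hI.θ).integrable_sq).2

lemma sqInt_errg : SqInt P (fun ω => errg S p (D ω) t) ∧
    ∫ ω, sq (errg S p (D ω) t) ∂P ≤ (1 - δ) * ∫ ω, sq ((iter S p (D ω) t).g
      + incv S p (D ω) t - (iter S p (D ω) t).ghat) ∂P := by
  have hin := (hI.g.add (sqInt_incv hA hD t hI).1).sub hI.ghat
  simp only [← inputg_iter_eq] at hin ⊢
  exact compErr_sqInt_and_integral_le hA.regular hA.contractive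
    ((hD.measurableState hA.regular t).inputg hA.regular (hD.noiseθ_measurable t)
      (hD.sample_measurable t)) (hD.noiseg_measurable t) (hD.noiseg_law t) hin

lemma sqIntState_succ : SqIntState P fun ω => iter S p (D ω) (t + 1) where
  θ := sqInt_succ_θ hA hD t hI
  θhat := by
    simp only [iter_succ_θhat]
    exact (hI.θ.add (hI.g.const_smul (-p.η))).add (sqInt_errθ hA hD t hI).1
  v := by
    have h := hI.v.add (sqInt_incv hA hD t hI).1
    simpa only [incv, add_sub_cancel] using h
  g := by
    have hu := hI.g.add (sqInt_incv hA hD t hI).1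
    simp only [iter_succ_g]
    exact hu.add (((hu.add (sqInt_errg hA hD t hI).1).lap S.W).const_smul p.γ)
  ghat := by
    simp only [iter_succ_ghat]
    exact (hI.g.add (sqInt_incv hA hD t hI).1).add (sqInt_errg hA hD t hI).1

end OneStep

/-! ### Initialization -/

section Init

omit [IsProbabilityMeasure P] in
lemma IsRun.memLp_init {φ : Z → Vec d} (hD : IsRun S p P D) (i : Fin n) (r : Fin p.b₀)
    (h : MemLp φ 2 (S.dist i)) : MemLp (fun ω => φ ((D ω).init i r)) 2 P := by
  rw [← hD.init_law i r] at h
  exact h.comp_of_map (hD.init_measurable i r).aemeasurable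

omit [IsProbabilityMeasure P] in
lemma IsRun.integral_comp_init {E : Type*} [NormedAddCommGroup E] [NormedSpace ℝ E] {φ : Z → E}
    (hD : IsRun S p P D) (i : Fin n) (r : Fin p.b₀) (h : AEStronglyMeasurable φ (S.dist i)) :
    ∫ ω, φ ((D ω).init i r) ∂P = ∫ z, φ z ∂(S.dist i) := by
  rw [← hD.init_law i r] at h ⊢
  exact (integral_map (hD.init_measurable i r).aemeasurable h).symm

variable (hA : S.Assumptions L ρ ω σ δ) (hD : IsRun S p P D)

include hA hD

lemma sqIntState_zero : SqIntState P fun ω => iter S p (D ω) 0 := by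
  have hv : SqInt P fun ω => (fun i => (1 / (p.b₀ : ℝ)) •
      ∑ r, S.stochGrad i p.θ₀ ((D ω).init i r) : Fin n → Vec d) := fun i =>
    (memLp_finsetSum Finset.univ fun r _ => hD.memLp_init i r
      (memLp_stochGrad hA.regular hA.boundedVariance i p.θ₀)).const_smul (1 / (p.b₀ : ℝ))
  exact ⟨fun i => memLp_const _, fun i => memLp_const _, hv, hv, fun i => memLp_const _⟩

lemma sqIntState (t : ℕ) : SqIntState P fun ω => iter S p (D ω) t := by
  induction t with
  | zero => exact sqIntState_zero hA hD
  | succ t ih => exact sqIntState_succ hA hD t ih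

/-- The noise of one initial sample. -/
def initNoise (S : Setup n d Z Ξ) (p : Params d) (D : Draws n p.b₀ Z Ξ) (k : Fin n × Fin p.b₀) :
    Vec d :=
  S.stochGrad k.1 p.θ₀ (D.init k.1 k.2) - gradient (S.localObj k.1) p.θ₀

/-- An arbitrary index set serves two purposes: the batch of one agent bounds the local errors, and
all batches together bound the averaged error, which gains 1/n. -/
lemma integral_norm_sum_initNoise_sq_le (s : Finset (Fin n × Fin p.b₀)) :
    ∫ ω, ‖∑ k ∈ s, initNoise S p (D ω) k‖ ^ 2 ∂P ≤ s.card * σ ^ 2 := by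
  have hm : ∀ k : Fin n × Fin p.b₀, Measurable fun z =>
      S.stochGrad k.1 p.θ₀ z - gradient (S.localObj k.1) p.θ₀ := fun k =>
    (measurable_stochGrad_right hA.regular k.1 p.θ₀).sub_const _
  rw [integral_norm_sum_sq s (φ := fun k ω => initNoise S p (D ω) k)]
  · refine (Finset.sum_le_card_nsmul s _ (σ ^ 2) fun k _ => ?_).trans_eq (nsmul_eq_mul _ _)
    simp only [initNoise]
    rw [hD.integral_comp_init k.1 k.2
      (φ := fun z => ‖S.stochGrad k.1 p.θ₀ z - gradient (S.localObj k.1) p.θ₀‖ ^ 2)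
      ((hm k).norm.pow_const 2).aestronglyMeasurable]
    exact hA.boundedVariance.variance_le k.1 p.θ₀
  · exact fun k => hD.memLp_init k.1 k.2 (memLp_stochGrad_sub hA.regular hA.boundedVariance _ _)
  · intro k
    simp only [initNoise]
    rw [hD.integral_comp_init k.1 k.2
      (φ := fun z => S.stochGrad k.1 p.θ₀ z - gradient (S.localObj k.1) p.θ₀)
      (hm k).aestronglyMeasurable]
    exact integral_stochGrad_sub hA.regular hA.boundedVariance _ _
  · exact fun k l hkl => (hD.init_indep.indepFun hkl).comp (hm k) (hm l)

omit hA hD [IsProbabilityMeasure P] in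
lemma err_v_zero (hb : 1 ≤ p.b₀) (D : Draws n p.b₀ Z Ξ) (i : Fin n) :
    ((iter S p D 0).v - S.gradStack (iter S p D 0).θ) i
      = (1 / (p.b₀ : ℝ)) • ∑ r, initNoise S p D (i, r) := by
  have hb0 : (p.b₀ : ℝ) ≠ 0 := by positivity
  simp [iter, initState, initNoise, Setup.gradStack, smul_sub, ← Nat.cast_smul_eq_nsmul ℝ,
    smul_smul, hb0]

lemma integral_sq_err_v_zero_le (hb : 1 ≤ p.b₀) :
    ∫ ω, sq ((iter S p (D ω) 0).v - S.gradStack (iter S p (D ω) 0).θ) ∂P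
      ≤ n * σ ^ 2 / p.b₀ := by
  have hb0 : (0 : ℝ) < p.b₀ := by positivity
  have hw := sqInt_err_v hA hD 0 (sqIntState_zero hA hD)
  unfold sq
  rw [integral_finsetSum _ fun i _ => (hw i).integrable_norm_pow (p := 2) two_ne_zero]
  refine (Finset.sum_le_card_nsmul Finset.univ _ (σ ^ 2 / p.b₀) fun i _ => ?_).trans_eq ?_
  · have h := integral_norm_sum_initNoise_sq_le hA hD
      ((Finset.univ : Finset (Fin p.b₀)).map ⟨fun r => (i, r), Prod.mk_right_injective i⟩)
    simp only [Finset.sum_map, Function.Embedding.coeFn_mk, Finset.card_map, Finset.card_univ,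
      Fintype.card_fin] at h
    simp only [err_v_zero hb, norm_smul, mul_pow]
    rw [integral_const_mul, Real.norm_of_nonneg (by positivity)]
    calc _ ≤ (1 / (p.b₀ : ℝ)) ^ 2 * (p.b₀ * σ ^ 2) := by gcongr
      _ = _ := by field_simp
  · simp [mul_div_assoc]

lemma integral_norm_avg_err_v_zero_le (hn : 1 ≤ n) (hb : 1 ≤ p.b₀) :
    ∫ ω, ‖avg ((iter S p (D ω) 0).v - S.gradStack (iter S p (D ω) 0).θ)‖ ^ 2 ∂P
      ≤ 1 / (n : ℝ) ^ 2 * (n * σ ^ 2 / p.b₀) := by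
  have hb0 : (0 : ℝ) < p.b₀ := by positivity
  have hn0 : (0 : ℝ) < n := by positivity
  have h := integral_norm_sum_initNoise_sq_le hA hD Finset.univ
  simp only [Finset.card_univ, Fintype.card_prod, Fintype.card_fin, Nat.cast_mul,
    Fintype.sum_prod_type] at h
  simp only [avg, err_v_zero hb, norm_smul, mul_pow, ← Finset.smul_sum]
  rw [integral_const_mul, integral_const_mul, Real.norm_of_nonneg (by positivity),
    Real.norm_of_nonneg (by positivity)]
  calc _ ≤ (1 / (n : ℝ)) ^ 2 * ((1 / (p.b₀ : ℝ)) ^ 2 * (n * p.b₀ * σ ^ 2)) := by gcongr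
    _ = _ := by field_simp

end Init

end SquareIntegrability

/-! ### Compressed gossip in mean square -/

section MeanGossip

variable {n d : ℕ} {Z Ξ : Type*} [MeasurableSpace Z] [MeasurableSpace Ξ] {S : Setup n d Z Ξ}
  {Ω : Type*} [MeasurableSpace Ω] {P : Measure Ω} {ρ ω γ δ : ℝ}

lemma integral_le_affine {F f g h : Ω → ℝ} (hF : Integrable F P) (hf : Integrable f P)
    (hg : Integrable g P) (hh : Integrable h P) {a b c : ℝ}
    (hle : ∀ x, F x ≤ a * f x + b * g x + c * h x) :
    ∫ x, F x ∂P ≤ a * ∫ x, f x ∂P + b * ∫ x, g x ∂P + c * ∫ x, h x ∂P := by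
  refine (integral_mono hF (((hf.const_mul a).add (hg.const_mul b)).add (hh.const_mul c))
    hle).trans_eq ?_
  simp only [Pi.add_apply]
  rw [integral_add (f := fun x => a * f x + b * g x) ((hf.const_mul a).add (hg.const_mul b))
    (hh.const_mul c), integral_add (hf.const_mul a) (hg.const_mul b), integral_const_mul,
    integral_const_mul, integral_const_mul]

variable {x y u q : Ω → Fin n → Vec d}

lemma SqInt.gossip (hx : SqInt P x) (hu : SqInt P u) (hq : SqInt P q) (γ : ℝ)
    (W : Matrix (Fin n) (Fin n) ℝ) :
    SqInt P fun w => x w + u w + γ • DoCoM.lap W (x w + u w + q w) :=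
  (hx.add hu).add ((((hx.add hu).add hq).lap W).const_smul γ)

lemma Setup.Mixing.integral_sq_dev_gossip_le (hS : S.Mixing ρ ω) (hn : 1 ≤ n) (h0 : 0 < γ)
    (h1 : γ ≤ 1) (hτ : ρ * γ < 1) (hx : SqInt P x) (hu : SqInt P u) (hq : SqInt P q) :
    ∫ w, sq (dev (x w + u w + γ • lap S.W (x w + u w + q w))) ∂P
      ≤ (1 - ρ * γ / 2) * ∫ w, sq (dev (x w)) ∂P + (2 / (ρ * γ) * ∫ w, sq (dev (u w)) ∂P
        + (γ * ω) ^ 2 / (ρ * γ) * ∫ w, sq (q w) ∂P) := by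
  rw [← add_assoc]
  exact integral_le_affine (hx.gossip hu hq γ S.W).dev.integrable_sq hx.dev.integrable_sq
    hu.dev.integrable_sq hq.integrable_sq
    fun w => (hS.sq_dev_gossip_le hn h0 h1 hτ (x w) (u w) (q w)).trans_eq (by ring)

lemma integral_sq_input_le (hδ : 0 < δ) (hδ1 : δ ≤ 1) (hx : SqInt P x) (hu : SqInt P u)
    (hy : SqInt P y) :
    ∫ w, sq (x w + u w - y w) ∂P
      ≤ (1 + δ / 4) * ∫ w, sq (x w - y w) ∂P + 5 / δ * ∫ w, sq (u w) ∂P := by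
  have h := integral_le_affine (a := 1 + δ / 4) (b := 5 / δ) (c := 0)
    ((hx.add hu).sub hy).integrable_sq (hx.sub hy).integrable_sq hu.integrable_sq hu.integrable_sq
    fun w => (sq_compressor_input_le hδ hδ1 (x w) (u w) (y w)).trans_eq
      (by rw [zero_mul, add_zero])
  simpa using h

lemma integral_sq_err_le_two (hδ : 0 < δ) (hx : SqInt P x) (hu : SqInt P u)
    (hy : SqInt P y)
    (he : ∫ w, sq (q w) ∂P ≤ (1 - δ) * ∫ w, sq (x w + u w - y w) ∂P) :
    ∫ w, sq (q w) ∂P ≤ 2 * ∫ w, sq (x w - y w) ∂P + 2 * ∫ w, sq (u w) ∂P := by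
  have h := integral_le_affine (a := 2) (b := 2) (c := 0) ((hx.add hu).sub hy).integrable_sq
    (hx.sub hy).integrable_sq hu.integrable_sq hu.integrable_sq
    fun w => by
      rw [zero_mul, add_zero, show x w + u w - y w = x w - y w + u w by abel]
      exact sq_add_le_two _ _
  have h0 : 0 ≤ ∫ w, sq (x w + u w - y w) ∂P := integral_nonneg fun w => sq_nonneg' _
  nlinarith

lemma Setup.Mixing.integral_sq_gossip_sub_copy_le (hS : S.Mixing ρ ω) (hn : 1 ≤ n) (h0 : 0 < γ)
    (hδ : 0 < δ) (hδ1 : δ ≤ 1) (hp : 259 * (γ * ω) ≤ δ) (hx : SqInt P x) (hu : SqInt P u)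
    (hy : SqInt P y) (hq : SqInt P q)
    (he : ∫ w, sq (q w) ∂P ≤ (1 - δ) * ∫ w, sq (x w + u w - y w) ∂P) :
    ∫ w, sq (x w + u w + γ • lap S.W (x w + u w + q w) - (x w + u w + q w)) ∂P
      ≤ (1 - 2 * δ / 5) * ∫ w, sq (x w - y w) ∂P + (8 / δ * ∫ w, sq (u w) ∂P
        + 20 * (γ * ω) ^ 2 / δ * ∫ w, sq (dev (x w)) ∂P) := by
  have h1 := integral_le_affine ((hx.gossip hu hq γ S.W).sub ((hx.add hu).add hq)).integrable_sq
    hq.integrable_sq hx.dev.integrable_sq hu.integrable_sq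
    (a := 1 + 0.26 * δ) (b := 20 * (γ * ω) ^ 2 / δ) (c := 20 * (γ * ω) ^ 2 / δ)
    fun w => (hS.sq_gossip_sub_copy_le hn h0 hδ hδ1 hp (x w) (u w) (q w)).trans (by
      have h2 := sq_dev_le hn (u w)
      have h3 : 0 ≤ 20 * (γ * ω) ^ 2 / δ := by positivity
      nlinarith)
  have h2 := integral_sq_input_le hδ hδ1 hx hu hy
  have hh : 0 ≤ ∫ w, sq (x w - y w) ∂P := integral_nonneg fun w => sq_nonneg' _
  have hU : 0 ≤ ∫ w, sq (u w) ∂P := integral_nonneg fun w => sq_nonneg' _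
  set H := ∫ w, sq (x w - y w) ∂P
  set V := ∫ w, sq (u w) ∂P
  set I := ∫ w, sq (x w + u w - y w) ∂P
  have h3 : (1 + 0.26 * δ) * ∫ w, sq (q w) ∂P
      ≤ (1 + 0.26 * δ) * ((1 - δ) * ((1 + δ / 4) * H + 5 / δ * V)) := by
    have : (1 - δ) * I ≤ (1 - δ) * ((1 + δ / 4) * H + 5 / δ * V) :=
      mul_le_mul_of_nonneg_left h2 (by linarith)
    exact mul_le_mul_of_nonneg_left (he.trans this) (by positivity)
  -- The budget of the compressor: it gains δ, gossip takes 0.26δ and the new increment 0.25δ, which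
  -- leaves 0.49δ to first order.
  have c1 : (1 + 0.26 * δ) * ((1 - δ) * (1 + δ / 4)) ≤ 1 - 2 * δ / 5 := by
    nlinarith [mul_nonneg hδ.le hδ.le, mul_nonneg (mul_nonneg hδ.le hδ.le) hδ.le]
  have c2 : (1 + 0.26 * δ) * ((1 - δ) * (5 / δ)) + 20 * (γ * ω) ^ 2 / δ ≤ 8 / δ := by
    have hp0 : 0 < γ * ω := mul_pos h0 hS.omega_pos
    have : (γ * ω) ^ 2 ≤ 1 / 259 ^ 2 := by
      have : γ * ω ≤ 1 / 259 := by linarith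
      calc (γ * ω) ^ 2 ≤ (1 / 259) ^ 2 := by gcongr
        _ = _ := by norm_num
    have e : (1 + 0.26 * δ) * ((1 - δ) * (5 / δ)) + 20 * (γ * ω) ^ 2 / δ
      = ((1 + 0.26 * δ) * (1 - δ) * 5 + 20 * (γ * ω) ^ 2) / δ := by ring
    rw [e]
    gcongr
    nlinarith [mul_nonneg hδ.le hδ.le]
  have d1 := mul_le_mul_of_nonneg_right c1 hh
  have d2 := mul_le_mul_of_nonneg_right c2 hU
  linarith

end MeanGossip

section Main

variable {n d : ℕ} {Z Ξ : Type*} [MeasurableSpace Z] [MeasurableSpace Ξ] {S : Setup n d Z Ξ}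
  {p : Params d} {Ω : Type*} [MeasurableSpace Ω] {P : Measure Ω} [IsProbabilityMeasure P]
  {D : Ω → Draws n p.b₀ Z Ξ} {L ρ ω σ δ : ℝ}

/-! ### Averages -/

/-- The tracking invariant: both start equal, g receives exactly the increments of v, and gossip
does not touch averages. It holds for every outcome of the compressors. -/
lemma avg_g_eq_avg_v (hS : S.Mixing ρ ω) (D : Draws n p.b₀ Z Ξ) (t : ℕ) :
    avg (iter S p D t).g = avg (iter S p D t).v := by
  induction t with
  | zero => rfl
  | succ t ih =>
    rw [iter_succ_g, avg_add, avg_smul, avg_lap hS.row_sum hS.col_sum, smul_zero, add_zero,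
      avg_add, ih, ← avg_add, incv, add_sub_cancel]

lemma avg_θ_succ (hS : S.Mixing ρ ω) (D : Draws n p.b₀ Z Ξ) (t : ℕ) :
    avg (iter S p D (t + 1)).θ = avg (iter S p D t).θ - p.η • avg (iter S p D t).v := by
  rw [iter_succ_θ, avg_add, avg_smul, avg_lap hS.row_sum hS.col_sum, smul_zero, add_zero,
    avg_add, avg_smul, avg_g_eq_avg_v hS, neg_smul, sub_eq_add_neg]

/-- Telescoping of the objective, pathwise; expectations are taken only afterwards, so integrability
of the objective itself is never needed. -/
lemma sum_descent_le (hn : 1 ≤ n) (hA : S.Assumptions L ρ ω σ δ) (hη : 0 < p.η)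
    (hηL : p.η * L ≤ 1 / 2) (D : Draws n p.b₀ Z Ξ) (T : ℕ) :
    ∑ t ∈ Finset.range T, (1 / 2 * ‖gradient S.obj (avg (iter S p D t).θ)‖ ^ 2
      + 1 / 4 * ‖avg (iter S p D t).v‖ ^ 2 - (L ^ 2 / n * sq (dev (iter S p D t).θ)
        + ‖avg ((iter S p D t).v - S.gradStack (iter S p D t).θ)‖ ^ 2))
      ≤ (S.obj p.θ₀ - S.optVal) / p.η := by
  have key : S.obj (avg (iter S p D T).θ) + p.η *
      ∑ t ∈ Finset.range T, (1 / 2 * ‖gradient S.obj (avg (iter S p D t).θ)‖ ^ 2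
      + 1 / 4 * ‖avg (iter S p D t).v‖ ^ 2 - (L ^ 2 / n * sq (dev (iter S p D t).θ)
        + ‖avg ((iter S p D t).v - S.gradStack (iter S p D t).θ)‖ ^ 2)) ≤ S.obj p.θ₀ := by
    induction T with
    | zero =>
      have : avg (iter S p D 0).θ = p.θ₀ := avg_const hn _
      simp [this]
    | succ T ih =>
      rw [Finset.sum_range_succ, avg_θ_succ hA.mixing]
      have := obj_avg_sub_smul_le hn hA.regular hA.smooth hA.boundedVariance hη hηL
        (iter S p D T).θ (iter S p D T).v
      linarith
  have hopt : S.optVal ≤ S.obj (avg (iter S p D T).θ) := ciInf_le hA.regular.obj_bddBelow _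
  rw [le_div_iff₀ hη]
  linarith

lemma merit_eq (L : ℝ) (s : State n d) : merit S L s
    = 1 / 2 * ‖gradient S.obj (avg s.θ)‖ ^ 2 + L ^ 2 / n * sq (dev s.θ) := rfl

lemma integrable_norm_gradient_obj_sq (hn : 1 ≤ n) (hA : S.Assumptions L ρ ω σ δ) {x : Ω → Vec d}
    (hx : MemLp x 2 P) : Integrable (fun w => ‖gradient S.obj (x w)‖ ^ 2) P := by
  have hc := continuous_gradient_obj hn hA.regular hA.smooth hA.boundedVariance
  have h : MemLp (fun w => gradient S.obj (x w)) 2 P := by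
    refine ((memLp_const ‖gradient S.obj 0‖).add (hx.norm.const_mul L)).mono'
      (g := fun w => ‖gradient S.obj 0‖ + L * ‖x w‖)
      (hc.comp_aestronglyMeasurable hx.aestronglyMeasurable)
      (Filter.Eventually.of_forall fun w => ?_)
    have h := norm_gradient_obj_sub_le hn hA.regular hA.smooth hA.boundedVariance (x w) 0
    rw [sub_zero] at h
    have h2 := norm_sub_norm_le (gradient S.obj (x w)) (gradient S.obj 0)
    linarith
  exact h.integrable_norm_pow (p := 2) two_ne_zero

lemma integrable_merit (hn : 1 ≤ n) (hA : S.Assumptions L ρ ω σ δ) (hD : IsRun S p P D) (t : ℕ) :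
    Integrable (fun w => merit S L (iter S p (D w) t)) P := by
  have hI := sqIntState hA hD t
  simp only [merit_eq]
  exact ((integrable_norm_gradient_obj_sq hn hA hI.θ.memLp_avg).const_mul _).add
    (hI.θ.dev.integrable_sq.const_mul _)

/-! ### The recursions in expectation -/

/-- `n E ‖ḡ‖²` at time `t`. -/
def meanDir (S : Setup n d Z Ξ) (p : Params d) (P : Measure Ω) (D : Ω → Draws n p.b₀ Z Ξ)
    (t : ℕ) : ℝ := ∫ w, n * ‖avg (iter S p (D w) t).v‖ ^ 2 ∂P

/-- The expected consensus error of the iterates. -/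
def meanDevθ (S : Setup n d Z Ξ) (p : Params d) (P : Measure Ω) (D : Ω → Draws n p.b₀ Z Ξ)
    (t : ℕ) : ℝ := ∫ w, sq (dev (iter S p (D w) t).θ) ∂P

/-- The expected consensus error of the trackers. -/
def meanDevg (S : Setup n d Z Ξ) (p : Params d) (P : Measure Ω) (D : Ω → Draws n p.b₀ Z Ξ)
    (t : ℕ) : ℝ := ∫ w, sq (dev (iter S p (D w) t).g) ∂P

/-- The expected squared distance of the iterates to their copies. -/
def meanCopyθ (S : Setup n d Z Ξ) (p : Params d) (P : Measure Ω) (D : Ω → Draws n p.b₀ Z Ξ)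
    (t : ℕ) : ℝ := ∫ w, sq ((iter S p (D w) t).θ - (iter S p (D w) t).θhat) ∂P

/-- The expected squared distance of the trackers to their copies. -/
def meanCopyg (S : Setup n d Z Ξ) (p : Params d) (P : Measure Ω) (D : Ω → Draws n p.b₀ Z Ξ)
    (t : ℕ) : ℝ := ∫ w, sq ((iter S p (D w) t).g - (iter S p (D w) t).ghat) ∂P

/-- The expected squared compression error of the iterates. -/
def meanErrθ (S : Setup n d Z Ξ) (p : Params d) (P : Measure Ω) (D : Ω → Draws n p.b₀ Z Ξ)
    (t : ℕ) : ℝ := ∫ w, sq (errθ S p (D w) t) ∂P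

/-- The expected squared compression error of the trackers. -/
def meanErrg (S : Setup n d Z Ξ) (p : Params d) (P : Measure Ω) (D : Ω → Draws n p.b₀ Z Ξ)
    (t : ℕ) : ℝ := ∫ w, sq (errg S p (D w) t) ∂P

/-- The expected squared step length. -/
def meanStep (S : Setup n d Z Ξ) (p : Params d) (P : Measure Ω) (D : Ω → Draws n p.b₀ Z Ξ)
    (t : ℕ) : ℝ := ∫ w, sq ((iter S p (D w) (t + 1)).θ - (iter S p (D w) t).θ) ∂P

/-- The expected squared increment of the momentum. -/
def meanInc (S : Setup n d Z Ξ) (p : Params d) (P : Measure Ω) (D : Ω → Draws n p.b₀ Z Ξ)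
    (t : ℕ) : ℝ := ∫ w, sq (incv S p (D w) t) ∂P

/-- The expected squared error of the local momenta. -/
def meanVar (S : Setup n d Z Ξ) (p : Params d) (P : Measure Ω) (D : Ω → Draws n p.b₀ Z Ξ)
    (t : ℕ) : ℝ := ∫ w, sq ((iter S p (D w) t).v - S.gradStack (iter S p (D w) t).θ) ∂P

/-- The expected squared error of the averaged momentum. -/
def meanAvgVar (S : Setup n d Z Ξ) (p : Params d) (P : Measure Ω) (D : Ω → Draws n p.b₀ Z Ξ)
    (t : ℕ) : ℝ := ∫ w, ‖avg ((iter S p (D w) t).v - S.gradStack (iter S p (D w) t).θ)‖ ^ 2 ∂P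

variable (hn : 1 ≤ n) (hA : S.Assumptions L ρ ω σ δ) (hD : IsRun S p P D)

include hn hA hD

/-- Pythagoras for the trackers, with ḡ = v̄: only the averaged part can be charged to descent, and
the disagreeing part must be controlled by gossip. -/
lemma integral_sq_dir (t : ℕ) : ∫ w, sq ((-p.η) • (iter S p (D w) t).g) ∂P
    = p.η ^ 2 * (meanDir S p P D t + meanDevg S p P D t) := by
  have hI := sqIntState hA hD t
  have e : ∀ w, sq ((-p.η) • (iter S p (D w) t).g) = p.η ^ 2 *
      (n * ‖avg (iter S p (D w) t).v‖ ^ 2 + sq (dev (iter S p (D w) t).g)) := fun w => by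
    rw [sq_smul, neg_sq, sq_eq_avg_add_dev hn, avg_g_eq_avg_v hA.mixing]
  simp only [e]
  rw [integral_const_mul, integral_add (hI.v.integrable_avg.const_mul _) hI.g.dev.integrable_sq]
  rfl

omit [IsProbabilityMeasure P] hn hA hD in
lemma integral_sq_dev_dir (t : ℕ) : ∫ w, sq (dev ((-p.η) • (iter S p (D w) t).g)) ∂P
    = p.η ^ 2 * meanDevg S p P D t := by
  simp only [dev_smul, sq_smul, neg_sq]
  rw [integral_const_mul]
  rfl

lemma meanDevθ_succ_le (h0 : 0 < p.γ) (h1 : p.γ ≤ 1) (hτ : ρ * p.γ < 1) (t : ℕ) :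
    meanDevθ S p P D (t + 1) ≤ (1 - ρ * p.γ / 2) * meanDevθ S p P D t
      + (2 / (ρ * p.γ) * (p.η ^ 2 * meanDevg S p P D t)
        + (p.γ * ω) ^ 2 / (ρ * p.γ) * meanErrθ S p P D t) := by
  have hI := sqIntState hA hD t
  have h := hA.mixing.integral_sq_dev_gossip_le hn h0 h1 hτ hI.θ (hI.g.const_smul (-p.η))
    (sqInt_errθ hA hD t hI).1
  rw [integral_sq_dev_dir] at h
  simpa only [meanDevθ, meanErrθ, iter_succ_θ] using h

lemma meanErrθ_le (t : ℕ) : meanErrθ S p P D t ≤ 2 * meanCopyθ S p P D t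
    + 2 * (p.η ^ 2 * (meanDir S p P D t + meanDevg S p P D t)) := by
  have hI := sqIntState hA hD t
  rw [← integral_sq_dir hn hA hD]
  exact integral_sq_err_le_two hA.contractive.delta_pos hI.θ
    (hI.g.const_smul (-p.η)) hI.θhat (sqInt_errθ hA hD t hI).2

lemma meanCopyθ_succ_le (h0 : 0 < p.γ) (hp : 259 * (p.γ * ω) ≤ δ) (t : ℕ) :
    meanCopyθ S p P D (t + 1) ≤ (1 - 2 * δ / 5) * meanCopyθ S p P D t
      + (8 / δ * (p.η ^ 2 * (meanDir S p P D t + meanDevg S p P D t))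
        + 20 * (p.γ * ω) ^ 2 / δ * meanDevθ S p P D t) := by
  have hI := sqIntState hA hD t
  rw [← integral_sq_dir hn hA hD]
  have h := hA.mixing.integral_sq_gossip_sub_copy_le hn h0 hA.contractive.delta_pos
    hA.contractive.delta_le_one hp hI.θ (hI.g.const_smul (-p.η)) hI.θhat
    (sqInt_errθ hA hD t hI).1 (sqInt_errθ hA hD t hI).2
  simpa only [meanCopyθ, meanDevθ, iter_succ_θ, iter_succ_θhat] using h

lemma meanStep_le (t : ℕ) : meanStep S p P D t
    ≤ 4 * (p.η ^ 2 * (meanDir S p P D t + meanDevg S p P D t)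
      + (p.γ * ω) ^ 2 * meanDevθ S p P D t + (p.γ * ω) ^ 2 * (p.η ^ 2 * meanDevg S p P D t)
      + (p.γ * ω) ^ 2 * meanErrθ S p P D t) := by
  have hI := sqIntState hA hD t
  have hu := hI.g.const_smul (-p.η)
  have hq := (sqInt_errθ hA hD t hI).1
  have hs := ((sqIntState hA hD (t + 1)).θ.sub hI.θ).integrable_sq
  rw [← integral_sq_dir hn hA hD, ← integral_sq_dev_dir]
  have h := integral_mono hs (((hu.integrable_sq.add
    (hI.θ.dev.integrable_sq.const_mul ((p.γ * ω) ^ 2))).add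
    ((hu.dev.integrable_sq.const_mul ((p.γ * ω) ^ 2)).add
      (hq.integrable_sq.const_mul ((p.γ * ω) ^ 2)))).const_mul 4) fun w => by
      have := hA.mixing.sq_gossip_sub_self_le (γ := p.γ) hn (iter S p (D w) t).θ
        ((-p.η) • (iter S p (D w) t).g) (errθ S p (D w) t)
      rw [← iter_succ_θ] at this
      simp only [Pi.add_apply]
      rw [← add_assoc]
      exact this
  refine h.trans_eq ?_
  rw [integral_const_mul, integral_add', integral_add', integral_add', integral_const_mul,
    integral_const_mul, integral_const_mul, ← add_assoc]
  · rfl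
  · exact hu.dev.integrable_sq.const_mul ((p.γ * ω) ^ 2)
  · exact hq.integrable_sq.const_mul ((p.γ * ω) ^ 2)
  · exact hu.integrable_sq
  · exact hI.θ.dev.integrable_sq.const_mul ((p.γ * ω) ^ 2)
  · exact hu.integrable_sq.add (hI.θ.dev.integrable_sq.const_mul ((p.γ * ω) ^ 2))
  · exact (hu.dev.integrable_sq.const_mul ((p.γ * ω) ^ 2)).add
      (hq.integrable_sq.const_mul ((p.γ * ω) ^ 2))

lemma meanDevg_succ_le (h0 : 0 < p.γ) (h1 : p.γ ≤ 1) (hτ : ρ * p.γ < 1) (t : ℕ) :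
    meanDevg S p P D (t + 1) ≤ (1 - ρ * p.γ / 2) * meanDevg S p P D t
      + (2 / (ρ * p.γ) * meanInc S p P D t
        + (p.γ * ω) ^ 2 / (ρ * p.γ) * meanErrg S p P D t) := by
  have hI := sqIntState hA hD t
  have hu := (sqInt_incv hA hD t hI).1
  have h := hA.mixing.integral_sq_dev_gossip_le hn h0 h1 hτ hI.g hu (sqInt_errg hA hD t hI).1
  have h2 : ∫ w, sq (dev (incv S p (D w) t)) ∂P ≤ meanInc S p P D t :=
    integral_mono hu.dev.integrable_sq hu.integrable_sq fun w => sq_dev_le hn _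
  have h3 : 0 ≤ 2 / (ρ * p.γ) := by
    have := hA.mixing.rho_pos
    positivity
  have h4 := mul_le_mul_of_nonneg_left h2 h3
  simp only [← iter_succ_g] at h
  refine h.trans ?_
  simp only [meanDevg, meanErrg]
  linarith

omit hn in
lemma meanErrg_le (t : ℕ) : meanErrg S p P D t ≤ 2 * meanCopyg S p P D t
    + 2 * meanInc S p P D t := by
  have hI := sqIntState hA hD t
  exact integral_sq_err_le_two hA.contractive.delta_pos hI.g
    (sqInt_incv hA hD t hI).1 hI.ghat (sqInt_errg hA hD t hI).2

lemma meanCopyg_succ_le (h0 : 0 < p.γ) (hp : 259 * (p.γ * ω) ≤ δ) (t : ℕ) :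
    meanCopyg S p P D (t + 1) ≤ (1 - 2 * δ / 5) * meanCopyg S p P D t
      + (8 / δ * meanInc S p P D t + 20 * (p.γ * ω) ^ 2 / δ * meanDevg S p P D t) := by
  have hI := sqIntState hA hD t
  have h := hA.mixing.integral_sq_gossip_sub_copy_le hn h0 hA.contractive.delta_pos
    hA.contractive.delta_le_one hp hI.g (sqInt_incv hA hD t hI).1 hI.ghat
    (sqInt_errg hA hD t hI).1 (sqInt_errg hA hD t hI).2
  simpa only [meanCopyg, meanDevg, meanInc, iter_succ_g, iter_succ_ghat] using h

end Main

/-! ### Consequences of the step size conditions -/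

namespace StepSizes

variable {n : ℕ} {L ρ ω δ η γ β : ℝ}

/-- At γ = 1 the factor √(1−γ) would make γ_∞ nonpositive. -/
lemma gamma_lt_one (h : StepSizes n L ρ ω δ η γ β) : γ < 1 := by
  refine lt_of_le_of_ne h.gamma_le_one fun h1 => ?_
  have h2 := (h.gamma_le.trans (min_le_right _ _)).trans (min_le_right _ _)
  rw [h1] at h2
  norm_num at h2

lemma betaBar_pos (h : StepSizes n L ρ ω δ η γ β) (hρ : 0 < ρ) (hδ : 0 < δ) :
    0 < betaBar ρ δ γ β := by
  have := h.gamma_pos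
  have := h.beta_pos
  unfold betaBar
  positivity

lemma mul_gamma_lt_one (h : StepSizes n L ρ ω δ η γ β) (hρ : 0 < ρ) : ρ * γ < 1 := by
  have h2 := (h.gamma_le.trans (min_le_left _ _)).trans (min_le_left _ _)
  rw [le_div_iff₀ (by positivity)] at h2
  linarith

lemma Cgbar_ge (hn : 1 ≤ n) (hρ : 0 < ρ) (hω : 0 < ω) (hγ : 0 < γ) :
    96 * L ^ 2 * n / (ρ * γ) ≤ Cgbar n L ρ ω γ β := by
  have h1 : 0 ≤ 8 * (1 - β) ^ 2 * L ^ 2 * (1 - ρ * γ) ^ 2 := by positivity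
  have h2 : 0 ≤ L ^ 2 * n / (ρ * γ) * (141 / 400 * (ρ ^ 2 / ω ^ 2)) := by positivity
  calc _ = L ^ 2 * n / (ρ * γ) * 96 := by ring
    _ ≤ _ := by unfold Cgbar; linarith

/-- From the square-root bound on η. Of C_ḡ only the term 96L²n/(ργ) is needed, and 768 = 8·96. -/
lemma l_sq_le (h : StepSizes n L ρ ω δ η γ β) (hn : 1 ≤ n) (hL : 0 ≤ L) (hρ : 0 < ρ)
    (hω : 0 < ω) (hδ : 0 < δ) : 768 * (η * L) ^ 2 ≤ betaBar ρ δ γ β * (ρ * γ) := by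
  have hγ := h.gamma_pos
  have hκ := h.betaBar_pos hρ hδ
  have hη := h.eta_pos
  have hn0 : (0 : ℝ) < n := by exact_mod_cast hn
  rcases hL.eq_or_lt with rfl | hL
  · simpa using (mul_pos hκ (mul_pos hρ hγ)).le
  have h1 := (h.eta_le hL).trans (min_le_right _ _)
  have hC := Cgbar_ge (L := L) (β := β) hn hρ hω hγ
  have hC0 : 0 < 96 * L ^ 2 * n / (ρ * γ) := by positivity
  have h2 : η ^ 2 ≤ betaBar ρ δ γ β * n / (8 * (96 * L ^ 2 * n / (ρ * γ))) := by
    rw [← Real.le_sqrt' hη]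
    exact h1.trans (Real.sqrt_le_sqrt (by gcongr))
  rw [le_div_iff₀ (by positivity)] at h2
  have e : η ^ 2 * (8 * (96 * L ^ 2 * n / (ρ * γ))) = 768 * (η * L) ^ 2 * n / (ρ * γ) := by ring
  rw [e, div_le_iff₀ (by positivity)] at h2
  have h3 : (768 * (η * L) ^ 2) * n ≤ (betaBar ρ δ γ β * (ρ * γ)) * n := by linarith
  exact le_of_mul_le_mul_right h3 hn0

lemma betaBar_le_beta : betaBar ρ δ γ β ≤ β := min_le_right _ _

lemma betaBar_le_tau : betaBar ρ δ γ β ≤ ρ * γ / 8 := (min_le_left _ _).trans (min_le_left _ _)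

lemma eta_mul_le (h : StepSizes n L ρ ω δ η γ β) (hn : 1 ≤ n) (hL : 0 ≤ L) (hρ : 0 < ρ)
    (hω : 0 < ω) (hδ : 0 < δ) : η * L ≤ 1 / 2 := by
  have h1 := h.l_sq_le hn hL hρ hω hδ
  have h2 := h.mul_gamma_lt_one hρ
  have h3 : betaBar ρ δ γ β ≤ 1 := betaBar_le_beta.trans h.beta_lt_one.le
  have h4 := h.gamma_pos
  have h5 : betaBar ρ δ γ β * (ρ * γ) ≤ 1 * 1 := by gcongr
  refine abs_le_of_sq_le_sq' ?_ (by norm_num) |>.2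
  linarith

/-- The last entry of γ_∞ gives 259p² ≤ δτ, and the two entries of η_∞ give the bounds on p·l and on
l²βn (2025 = 45²). For L = 0 the conditions on l are trivial. -/
lemma stepConsts (h : StepSizes n L ρ ω δ η γ β) (hn : 1 ≤ n) (hL : 0 ≤ L) (hρ : 0 < ρ)
    (hρω : ρ ≤ ω) (hδ : 0 < δ) (hδ1 : δ ≤ 1) :
    StepConsts n (η * L) (ρ * γ) (γ * ω) δ β (betaBar ρ δ γ β) := by
  have hω : 0 < ω := hρ.trans_le hρω
  have hγ := h.gamma_pos
  have hη := h.eta_pos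
  have hβ := h.beta_pos
  have hn0 : (0 : ℝ) < n := by exact_mod_cast hn
  refine ⟨⟨hδ, hδ1, by positivity, ?_, ?_⟩, by exact_mod_cast hn, by positivity, hβ,
    h.beta_lt_one.le, h.betaBar_pos hρ hδ, betaBar_le_beta, betaBar_le_tau,
    (h.mul_gamma_lt_one hρ).le, h.l_sq_le hn hL hρ hω hδ, ?_, ?_⟩
  · rw [mul_comm]; gcongr
  · have h2 := (h.gamma_le.trans (min_le_right _ _)).trans (min_le_right _ _)
    have h3 : √(1 - γ) ≤ 1 := Real.sqrt_le_one.2 (by linarith)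
    rw [le_div_iff₀ (by positivity)] at h2
    have h4 : γ * (259 * ω ^ 2) ≤ δ * ρ * 1 := h2.trans (by gcongr)
    have h5 := mul_le_mul_of_nonneg_left h4 hγ.le
    linarith
  · rcases hL.eq_or_lt with rfl | hL
    · simp only [mul_zero]; positivity
    have h1 := ((h.eta_le hL).trans (min_le_left _ _)).trans
      (mul_le_mul_of_nonneg_left (min_le_right _ _) (by positivity))
    rw [div_mul_div_comm, le_div_iff₀ (by positivity)] at h1
    have := mul_le_mul_of_nonneg_left h1 hγ.le
    linarith
  · rcases hL.eq_or_lt with rfl | hL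
    · simp only [mul_zero, ne_eq, OfNat.ofNat_ne_zero, not_false_eq_true, zero_pow, zero_mul]
      positivity
    have h1 := ((h.eta_le hL).trans (min_le_left _ _)).trans
      (mul_le_mul_of_nonneg_left (min_le_left _ _) (by positivity))
    have h2 : η * L ≤ γ * (√((1 - β) / (β * n)) * (√(γ * ρ ^ 3) / 45)) := by
      calc η * L ≤ γ / L * (√((1 - β) / (β * n)) * (√(γ * ρ ^ 3) / 45)) * L := by gcongr
        _ = _ := by field_simp
    have h3 : (η * L) ^ 2 ≤ γ ^ 2 * ((1 - β) / (β * n) * (γ * ρ ^ 3 / 2025)) := by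
      calc (η * L) ^ 2 ≤ (γ * (√((1 - β) / (β * n)) * (√(γ * ρ ^ 3) / 45))) ^ 2 := by gcongr
        _ = γ ^ 2 * (√((1 - β) / (β * n)) ^ 2 * (√(γ * ρ ^ 3) ^ 2 / 2025)) := by ring
        _ = _ := by
          rw [Real.sq_sqrt (div_nonneg (by linarith [h.beta_lt_one]) (by positivity)),
            Real.sq_sqrt (by positivity)]
    calc 2025 * ((η * L) ^ 2 * β * n)
        ≤ 2025 * (γ ^ 2 * ((1 - β) / (β * n) * (γ * ρ ^ 3 / 2025)) * β * n) := by gcongr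
      _ = (1 - β) * (ρ * γ) ^ 3 := by field_simp
      _ ≤ 1 * (ρ * γ) ^ 3 := by gcongr; linarith
      _ = _ := one_mul _

end StepSizes

/-! ### The summed errors of a run -/

section Sums

variable {n d : ℕ} {Z Ξ : Type*} [MeasurableSpace Z] [MeasurableSpace Ξ] {S : Setup n d Z Ξ}
  {p : Params d} {Ω : Type*} [MeasurableSpace Ω] {P : Measure Ω} [IsProbabilityMeasure P]
  {D : Ω → Draws n p.b₀ Z Ξ} {L ρ ω σ δ : ℝ}

omit [IsProbabilityMeasure P] in
lemma meanDir_nonneg (t : ℕ) : 0 ≤ meanDir S p P D t := integral_nonneg fun _ => by positivity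

omit [IsProbabilityMeasure P] in
lemma meanDevθ_nonneg (t : ℕ) : 0 ≤ meanDevθ S p P D t := integral_nonneg fun _ => sq_nonneg' _

omit [IsProbabilityMeasure P] in
lemma meanDevg_nonneg (t : ℕ) : 0 ≤ meanDevg S p P D t := integral_nonneg fun _ => sq_nonneg' _

omit [IsProbabilityMeasure P] in
lemma meanCopyθ_nonneg (t : ℕ) : 0 ≤ meanCopyθ S p P D t := integral_nonneg fun _ => sq_nonneg' _

omit [IsProbabilityMeasure P] in
lemma meanCopyg_nonneg (t : ℕ) : 0 ≤ meanCopyg S p P D t := integral_nonneg fun _ => sq_nonneg' _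

omit [IsProbabilityMeasure P] in
lemma meanStep_nonneg (t : ℕ) : 0 ≤ meanStep S p P D t := integral_nonneg fun _ => sq_nonneg' _

omit [IsProbabilityMeasure P] in
lemma meanInc_nonneg (t : ℕ) : 0 ≤ meanInc S p P D t := integral_nonneg fun _ => sq_nonneg' _

omit [IsProbabilityMeasure P] in
lemma meanVar_nonneg (t : ℕ) : 0 ≤ meanVar S p P D t := integral_nonneg fun _ => sq_nonneg' _

omit [IsProbabilityMeasure P] in
lemma meanAvgVar_nonneg (t : ℕ) : 0 ≤ meanAvgVar S p P D t := integral_nonneg fun _ => by positivity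

omit [IsProbabilityMeasure P] in
lemma meanDevθ_zero (hn : 1 ≤ n) : meanDevθ S p P D 0 = 0 := by
  have : ∀ w, dev (iter S p (D w) 0).θ = 0 := fun w => by
    funext i
    simp [dev, iter, initState, avg_const hn]
  simp [meanDevθ, this, sq]

omit [IsProbabilityMeasure P] in
lemma meanCopyθ_zero : meanCopyθ S p P D 0 = 0 := by
  simp [meanCopyθ, iter, initState, sq]

omit [IsProbabilityMeasure P] in
-- The tracker copies start at zero, so the initial gradients enter as a copy error. The copies of
-- the iterates start exact.
lemma meanCopyg_zero (hn : 1 ≤ n) : meanCopyg S p P D 0 = n * initGrad S p P D := by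
  have hn0 : (n : ℝ) ≠ 0 := by positivity
  rw [initGrad, ← mul_assoc, mul_one_div_cancel hn0, one_mul]
  simp [meanCopyg, iter, initState, sq]

omit [IsProbabilityMeasure P] in
lemma initGrad_nonneg : 0 ≤ initGrad S p P D :=
  mul_nonneg (by positivity) (integral_nonneg fun _ => by positivity)

lemma meanDevg_zero_le (hn : 1 ≤ n) (hA : S.Assumptions L ρ ω σ δ) (hD : IsRun S p P D) :
    meanDevg S p P D 0 ≤ n * initGrad S p P D := by
  have hn0 : (n : ℝ) ≠ 0 := by positivity
  have hI := (sqIntState hA hD 0).g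
  rw [initGrad, ← mul_assoc, mul_one_div_cancel hn0, one_mul]
  exact integral_mono hI.dev.integrable_sq hI.integrable_sq fun w => sq_dev_le hn _

/-- The square (1−β)² is weakened to 1−β on the old error and to 1 on the driving term. -/
lemma mul_sum_le_of_momentum {u w : ℕ → ℝ} {β N : ℝ} (h0 : 0 < β) (h1 : β ≤ 1)
    (hu : ∀ t, 0 ≤ u t) (hw : ∀ t, 0 ≤ w t)
    (h : ∀ t, u (t + 1) ≤ (1 - β) ^ 2 * u t + (1 - β) ^ 2 * w t + N) (T : ℕ) :
    β * ∑ t ∈ Finset.range T, u t ≤ u 0 + ∑ t ∈ Finset.range T, w t + T * N := by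
  have key := sum_le_of_contracting (r := β) (w := fun t => w t + N) hu (fun t => by
    have e1 : (1 - β) ^ 2 ≤ 1 - β := by nlinarith
    have e2 : (1 - β) ^ 2 ≤ 1 := e1.trans (by linarith)
    have e3 := mul_le_mul_of_nonneg_right e1 (hu t)
    have e4 := mul_le_mul_of_nonneg_right e2 (hw t)
    linarith [h t]) T
  rw [Finset.sum_add_distrib, Finset.sum_const, Finset.card_range, nsmul_eq_mul] at key
  linarith

variable (hn : 1 ≤ n) (hA : S.Assumptions L ρ ω σ δ) (hD : IsRun S p P D)
  (hs : StepSizes n L ρ ω δ p.η p.γ p.β) (hb : 1 ≤ p.b₀) (T : ℕ)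

include hA hD hs hb

lemma mul_sum_meanVar_le : p.β * ∑ t ∈ Finset.range T, meanVar S p P D t
    ≤ n * σ ^ 2 / p.b₀ + 2 * (n * p.β ^ 2 * σ ^ 2 * T)
      + 2 * L ^ 2 * ∑ t ∈ Finset.range T, meanStep S p P D t := by
  have h := mul_sum_le_of_momentum (u := meanVar S p P D)
    (w := fun t => 2 * L ^ 2 * meanStep S p P D t) (N := 2 * (n * p.β ^ 2 * σ ^ 2)) hs.beta_pos
    hs.beta_lt_one.le meanVar_nonneg (fun t => mul_nonneg (by positivity) (meanStep_nonneg t))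
    (fun t => (integral_sq_err_v_succ_le hA hD t (sqIntState hA hD t)).trans_eq (by
      simp only [meanVar, meanStep]; ring)) T
  rw [← Finset.mul_sum] at h
  have h0 : meanVar S p P D 0 ≤ n * σ ^ 2 / p.b₀ := integral_sq_err_v_zero_le hA hD hb
  linarith

include hn

lemma mul_sum_meanAvgVar_le : p.β * ∑ t ∈ Finset.range T, meanAvgVar S p P D t
    ≤ 1 / (n : ℝ) ^ 2 * (n * σ ^ 2 / p.b₀ + 2 * (n * p.β ^ 2 * σ ^ 2 * T)
      + 2 * L ^ 2 * ∑ t ∈ Finset.range T, meanStep S p P D t) := by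
  have h := mul_sum_le_of_momentum (u := meanAvgVar S p P D)
    (w := fun t => 1 / (n : ℝ) ^ 2 * (2 * L ^ 2) * meanStep S p P D t)
    (N := 1 / (n : ℝ) ^ 2 * (2 * (n * p.β ^ 2 * σ ^ 2))) hs.beta_pos
    hs.beta_lt_one.le meanAvgVar_nonneg (fun t => mul_nonneg (by positivity) (meanStep_nonneg t))
    (fun t => (integral_norm_avg_err_v_succ_le hA hD t (sqIntState hA hD t)).trans_eq (by
      simp only [meanAvgVar, meanStep]; ring)) T
  rw [← Finset.mul_sum] at h
  have h0 : meanAvgVar S p P D 0 ≤ 1 / (n : ℝ) ^ 2 * (n * σ ^ 2 / p.b₀) :=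
    integral_norm_avg_err_v_zero_le hA hD hn hb
  linarith

/-- Two agents give ρ ≤ ω, and with it the constants of the closed loop. The gossip recursion is
then summed twice, for iterates and for trackers. -/
lemma sum_errors_le_of_two_le (h2 : 2 ≤ n) :
    2 * n * L ^ 2 * ∑ t ∈ Finset.range T, meanDevθ S p P D t
      + 1 / p.β * (n * σ ^ 2 / p.b₀ + 2 * (n * p.β ^ 2 * σ ^ 2 * T)
        + 2 * L ^ 2 * ∑ t ∈ Finset.range T, meanStep S p P D t)
      ≤ n / 4 * ∑ t ∈ Finset.range T, meanDir S p P D t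
        + (8 + 1344 * n * (p.η * L) ^ 2 / (ρ * p.γ) ^ 3) * (n * p.β ^ 2 * σ ^ 2 * T)
          / betaBar ρ δ p.γ p.β
        + 4 * (n * σ ^ 2 / p.b₀) / betaBar ρ δ p.γ p.β
        + 384 * n * (p.η * L) ^ 2 * (n * initGrad S p P D)
          / (betaBar ρ δ p.γ p.β * (ρ * p.γ) ^ 2) := by
  have hc := hs.stepConsts hn hA.smooth.1 hA.mixing.rho_pos (hA.mixing.rho_le_omega h2)
    hA.contractive.delta_pos hA.contractive.delta_le_one
  have hp := hc.gossip.p_le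
  have hτ := hs.mul_gamma_lt_one hA.mixing.rho_pos
  have hτ0 := hc.gossip.tau_pos
  have hg0 : 0 ≤ n * initGrad S p P D := mul_nonneg (by positivity) initGrad_nonneg
  have hη := hs.eta_pos
  -- Averaged directions do not create disagreement, so v contains only the tracker disagreement;
  -- they do change the compressor input, so U contains both parts.
  obtain ⟨a1, a2⟩ := hc.gossip.sum_le (X := meanDevθ S p P D) (h := meanCopyθ S p P D)
    (v := fun t => p.η ^ 2 * meanDevg S p P D t)
    (U := fun t => p.η ^ 2 * (meanDir S p P D t + meanDevg S p P D t)) (Q := meanErrθ S p P D)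
    meanDevθ_nonneg meanCopyθ_nonneg (fun t => mul_nonneg (by positivity) (meanDevg_nonneg t))
    (fun t => mul_nonneg (by positivity) (add_nonneg (meanDir_nonneg t) (meanDevg_nonneg t)))
    (meanDevθ_succ_le hn hA hD hs.gamma_pos hs.gamma_le_one hτ)
    (meanCopyθ_succ_le hn hA hD hs.gamma_pos hp) (meanErrθ_le hn hA hD) T
  obtain ⟨b1, -⟩ := hc.gossip.sum_le (X := meanDevg S p P D) (h := meanCopyg S p P D)
    (v := meanInc S p P D) (U := meanInc S p P D) (Q := meanErrg S p P D)
    meanDevg_nonneg meanCopyg_nonneg meanInc_nonneg meanInc_nonneg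
    (meanDevg_succ_le hn hA hD hs.gamma_pos hs.gamma_le_one hτ)
    (meanCopyg_succ_le hn hA hD hs.gamma_pos hp) (meanErrg_le hA hD) T
  rw [meanDevθ_zero hn, meanCopyθ_zero] at a1
  rw [meanCopyθ_zero] at a2
  rw [meanCopyg_zero hn] at b1
  simp only [← Finset.mul_sum, Finset.sum_add_distrib] at a1 a2
  have hE := mul_sum_meanVar_le hA hD hs hb T
  have hY : ∑ t ∈ Finset.range T, meanInc S p P D t
      ≤ 3 * L ^ 2 * ∑ t ∈ Finset.range T, meanStep S p P D t
        + 3 * (n * p.β ^ 2 * σ ^ 2 * T)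
        + 3 * (p.β ^ 2 * ∑ t ∈ Finset.range T, meanVar S p P D t) := by
    refine (Finset.sum_le_sum fun t _ =>
      (sqInt_incv hA hD t (sqIntState hA hD t)).2).trans_eq ?_
    rw [Finset.sum_add_distrib, Finset.sum_add_distrib, Finset.sum_const, Finset.card_range,
      nsmul_eq_mul, ← Finset.mul_sum, ← Finset.mul_sum]
    simp only [meanStep, meanVar]
    ring
  have hX := Finset.sum_le_sum fun t (_ : t ∈ Finset.range T) => meanStep_le hn hA hD t
  simp only [← Finset.mul_sum, Finset.sum_add_distrib] at hX
  have g0 := mul_le_mul_of_nonneg_left (meanDevg_zero_le hn hA hD) hτ0.le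
  have n0 : ∀ u : ℕ → ℝ, (∀ t, 0 ≤ u t) → 0 ≤ ∑ t ∈ Finset.range T, u t := fun u hu =>
    Finset.sum_nonneg fun t _ => hu t
  have hE₀ : 0 ≤ n * σ ^ 2 / (p.b₀ : ℝ) := by positivity
  have hN : 0 ≤ n * p.β ^ 2 * σ ^ 2 * (T : ℝ) := by positivity
  obtain ⟨c1, c2⟩ := hc.closed_loop rfl (n0 _ meanDevg_nonneg) (n0 _ meanDir_nonneg)
    (n0 _ meanStep_nonneg) (n0 _ meanInc_nonneg) hg0 hE₀ hN (by linarith) (by linarith)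
    (by linarith) hX hY hE
  exact hc.sum_le (n0 _ meanDir_nonneg) hg0 hE₀ hN c1 c2

-- A single agent has no disagreement and its step is exactly −ηv̄, so compression plays no role.
-- The bound on l² alone absorbs the step lengths, without comparing ρ with ω.
omit [IsProbabilityMeasure P] in
lemma sum_errors_le_of_one (h1 : n = 1) :
    2 * n * L ^ 2 * ∑ t ∈ Finset.range T, meanDevθ S p P D t
      + 1 / p.β * (n * σ ^ 2 / p.b₀ + 2 * (n * p.β ^ 2 * σ ^ 2 * T)
        + 2 * L ^ 2 * ∑ t ∈ Finset.range T, meanStep S p P D t)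
      ≤ n / 4 * ∑ t ∈ Finset.range T, meanDir S p P D t
        + (8 + 1344 * n * (p.η * L) ^ 2 / (ρ * p.γ) ^ 3) * (n * p.β ^ 2 * σ ^ 2 * T)
          / betaBar ρ δ p.γ p.β
        + 4 * (n * σ ^ 2 / p.b₀) / betaBar ρ δ p.γ p.β
        + 384 * n * (p.η * L) ^ 2 * (n * initGrad S p P D)
          / (betaBar ρ δ p.γ p.β * (ρ * p.γ) ^ 2) := by
  have hdev : ∀ x : Fin n → Vec d, dev x = 0 := by
    subst h1
    intro x
    funext i
    rw [Subsingleton.elim i 0]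
    simp [dev, avg]
  have hA0 : ∀ t, meanDevθ S p P D t = 0 := fun t => by simp [meanDevθ, hdev, sq]
  have hX : ∀ t, meanStep S p P D t = p.η ^ 2 * meanDir S p P D t := fun t => by
    rw [meanStep, meanDir, ← integral_const_mul]
    congr 1
    funext w
    rw [sq_eq_avg_add_dev hn, hdev, avg_sub, avg_θ_succ hA.mixing, sub_sub_cancel_left, norm_neg,
      norm_smul, mul_pow, Real.norm_eq_abs, sq_abs]
    simp [sq]
    ring
  simp only [hA0, hX, ← Finset.mul_sum]
  have hρ := hA.mixing.rho_pos
  have hγ := hs.gamma_pos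
  have hβ := hs.beta_pos
  have hκ := hs.betaBar_pos hρ hA.contractive.delta_pos
  set κ := betaBar ρ δ p.γ p.β with hκdef
  have hκβ : κ ≤ p.β := StepSizes.betaBar_le_beta
  have hl : 768 * (p.η * L) ^ 2 ≤ κ * (ρ * p.γ) :=
    hs.l_sq_le hn hA.smooth.1 hρ hA.mixing.omega_pos hA.contractive.delta_pos
  have hτ := hs.mul_gamma_lt_one hρ
  have hκ1 : 1 / p.β ≤ 1 / κ := one_div_le_one_div_of_le hκ hκβ
  have hB : 0 ≤ ∑ t ∈ Finset.range T, meanDir S p P D t :=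
    Finset.sum_nonneg fun t _ => meanDir_nonneg t
  set B := ∑ t ∈ Finset.range T, meanDir S p P D t
  have hn1 : (n : ℝ) = 1 := by exact_mod_cast h1
  have hE₀ : 0 ≤ n * σ ^ 2 / (p.b₀ : ℝ) := by positivity
  have hN : 0 ≤ n * p.β ^ 2 * σ ^ 2 * (T : ℝ) := by positivity
  set E₀ := n * σ ^ 2 / (p.b₀ : ℝ)
  set N := n * p.β ^ 2 * σ ^ 2 * (T : ℝ)
  have t1 : 1 / p.β * (p.η * L) ^ 2 ≤ 1 / 768 := by
    rw [one_div_mul_eq_div, div_le_div_iff₀ hβ (by norm_num)]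
    have : κ * (ρ * p.γ) ≤ p.β * 1 := by gcongr
    linarith
  have t2 := mul_le_mul_of_nonneg_right t1 hB
  have t3 : 1 / p.β * E₀ ≤ 1 / κ * E₀ := by gcongr
  have t4 : 1 / p.β * N ≤ 1 / κ * N := by gcongr
  have t5 : 0 ≤ 1344 * n * (p.η * L) ^ 2 / (ρ * p.γ) ^ 3 * N / κ := by positivity
  have t6 : 0 ≤ 384 * n * (p.η * L) ^ 2 * (n * initGrad S p P D) / (κ * (ρ * p.γ) ^ 2) :=
    div_nonneg (mul_nonneg (by positivity) (mul_nonneg (by positivity) initGrad_nonneg))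
      (by positivity)
  have t7 : 0 ≤ 1 / κ * E₀ := by positivity
  have t8 : 0 ≤ 1 / κ * N := by positivity
  have e1 : (8 + 1344 * n * (p.η * L) ^ 2 / (ρ * p.γ) ^ 3) * N / κ
      = 8 * (1 / κ * N) + 1344 * n * (p.η * L) ^ 2 / (ρ * p.γ) ^ 3 * N / κ := by ring
  have e2 : 4 * E₀ / κ = 4 * (1 / κ * E₀) := by ring
  have e3 : 1 / p.β * (E₀ + 2 * N + 2 * L ^ 2 * (p.η ^ 2 * B))
      = 1 / p.β * E₀ + 2 * (1 / p.β * N) + 2 * (1 / p.β * (p.η * L) ^ 2 * B) := by ring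
  rw [e1, e2, e3, Finset.sum_const_zero, hn1]
  rw [hn1] at t5 t6
  linarith

/-- The main bound, in summed form and without the slack of `mainBound`. -/
theorem sum_merit_le : ∑ t ∈ Finset.range T, ∫ w, merit S L (iter S p (D w) t) ∂P
    ≤ (S.obj p.θ₀ - S.optVal) / p.η + 1 / (n : ℝ) ^ 2 *
      ((8 + 1344 * n * (p.η * L) ^ 2 / (ρ * p.γ) ^ 3) * (n * p.β ^ 2 * σ ^ 2 * T)
          / betaBar ρ δ p.γ p.β
        + 4 * (n * σ ^ 2 / p.b₀) / betaBar ρ δ p.γ p.β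
        + 384 * n * (p.η * L) ^ 2 * (n * initGrad S p P D)
          / (betaBar ρ δ p.γ p.β * (ρ * p.γ) ^ 2)) := by
  have herr := show _ from (eq_or_lt_of_le hn).elim
    (fun h => sum_errors_le_of_one hn hA hD hs hb T h.symm)
    (fun h => sum_errors_le_of_two_le hn hA hD hs hb T h)
  have hbar := mul_sum_meanAvgVar_le hn hA hD hs hb T
  have hβ := hs.beta_pos
  have hn0 : (0 : ℝ) < n := by exact_mod_cast hn
  have hint : ∀ t,
      Integrable (fun w => 1 / 2 * ‖gradient S.obj (avg (iter S p (D w) t).θ)‖ ^ 2) P :=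
    fun t => (integrable_norm_gradient_obj_sq hn hA (sqIntState hA hD t).θ.memLp_avg).const_mul _
  have hv := fun t => (sqIntState hA hD t).v.integrable_avg.const_mul (1 / 4)
  have hdev := fun t => (sqIntState hA hD t).θ.dev.integrable_sq.const_mul (L ^ 2 / n)
  have hea := fun t => (sqInt_err_v hA hD t (sqIntState hA hD t)).integrable_avg
  have hdesc : ∑ t ∈ Finset.range T,
      (∫ w, 1 / 2 * ‖gradient S.obj (avg (iter S p (D w) t).θ)‖ ^ 2 ∂P
        + 1 / (4 * n) * meanDir S p P D t
        - (L ^ 2 / n * meanDevθ S p P D t + meanAvgVar S p P D t))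
      ≤ (S.obj p.θ₀ - S.optVal) / p.η := by
    have h := integral_mono (μ := P) (integrable_finsetSum (Finset.range T) fun t _ =>
      ((hint t).add (hv t)).sub ((hdev t).add (hea t)))
      (integrable_const ((S.obj p.θ₀ - S.optVal) / p.η)) fun w =>
        sum_descent_le hn hA hs.eta_pos
          (hs.eta_mul_le hn hA.smooth.1 hA.mixing.rho_pos hA.mixing.omega_pos
            hA.contractive.delta_pos) (D w) T
    rw [integral_finsetSum _ fun t _ => ((hint t).add (hv t)).sub ((hdev t).add (hea t)),
      integral_const, probReal_univ, one_smul] at h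
    refine (Finset.sum_congr rfl fun t _ => ?_).trans_le h
    rw [integral_sub' ((hint t).add (hv t)) ((hdev t).add (hea t)), integral_add' (hint t) (hv t),
      integral_add' (hdev t) (hea t), integral_const_mul (1 / 4), integral_const_mul (L ^ 2 / n),
      meanDir, integral_const_mul (n : ℝ)]
    simp only [meanDevθ, meanAvgVar]
    field_simp
  have hmerit : ∀ t, ∫ w, merit S L (iter S p (D w) t) ∂P
      = ∫ w, 1 / 2 * ‖gradient S.obj (avg (iter S p (D w) t).θ)‖ ^ 2 ∂P
        + L ^ 2 / n * meanDevθ S p P D t := fun t => by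
    simp only [merit_eq]
    rw [integral_add (hint t) (hdev t), integral_const_mul (L ^ 2 / n)]
    rfl
  simp only [hmerit]
  simp only [Finset.sum_add_distrib, Finset.sum_sub_distrib, ← Finset.mul_sum] at hdesc ⊢
  set A := ∑ t ∈ Finset.range T, meanDevθ S p P D t
  set B := ∑ t ∈ Finset.range T, meanDir S p P D t
  set X := ∑ t ∈ Finset.range T, meanStep S p P D t
  set V := ∑ t ∈ Finset.range T, meanAvgVar S p P D t
  have hV : V ≤ 1 / (n : ℝ) ^ 2 * (1 / p.β * (n * σ ^ 2 / p.b₀ + 2 * (n * p.β ^ 2 * σ ^ 2 * T)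
      + 2 * L ^ 2 * X)) := by
    rw [← le_div_iff₀' hβ] at hbar
    exact hbar.trans_eq (by ring)
  have h3 := mul_le_mul_of_nonneg_left herr (by positivity : 0 ≤ 1 / (n : ℝ) ^ 2)
  -- The consensus error counts twice: once as a loss in the descent inequality and once as part of
  -- the merit.
  have e1 : 1 / (n : ℝ) ^ 2 * (2 * n * L ^ 2 * A) = 2 * (L ^ 2 / n * A) := by field_simp
  have e2 : 1 / (n : ℝ) ^ 2 * (n / 4 * B) = 1 / (4 * n) * B := by field_simp
  simp only [mul_add (1 / (n : ℝ) ^ 2)] at h3 hV ⊢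
  rw [e1, e2] at h3
  simp only [mul_add] at h3 hV ⊢
  linarith

end Sums

/-! ### Time averages and the bound of part (a) -/

section Averaged

variable {n d : ℕ} {Z Ξ : Type*} [MeasurableSpace Z] [MeasurableSpace Ξ] {S : Setup n d Z Ξ}
  {p : Params d} {Ω : Type*} [MeasurableSpace Ω] {P : Measure Ω} [IsProbabilityMeasure P]
  {D : Ω → Draws n p.b₀ Z Ξ} {L ρ ω σ δ : ℝ}
  (hn : 1 ≤ n) (hA : S.Assumptions L ρ ω σ δ) (hD : IsRun S p P D)
  (hs : StepSizes n L ρ ω δ p.η p.γ p.β) (hb : 1 ≤ p.b₀) {T : ℕ} (hT : 1 ≤ T)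

include hn hA hD hs hb hT

/-- The rate is derived from this form: it has no factor 1/(1−γ), so it does not matter how close γ
is to 1. -/
lemma average_merit_le :
    1 / (T : ℝ) * ∑ t ∈ Finset.range T, ∫ w, merit S L (iter S p (D w) t) ∂P
      ≤ (S.obj p.θ₀ - S.optVal) / (p.η * T)
        + (4 + 672 * n * (p.η * L) ^ 2 / (ρ * p.γ) ^ 3)
          * (2 * p.β ^ 2 * σ ^ 2 / (betaBar ρ δ p.γ p.β * n))
        + 4 * σ ^ 2 / (p.b₀ * betaBar ρ δ p.γ p.β * T * n)
        + p.η ^ 2 / (betaBar ρ δ p.γ p.β * T)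
          * (384 * L ^ 2 * initGrad S p P D / (ρ ^ 2 * p.γ ^ 2)) := by
  have hT0 : (0 : ℝ) < T := by exact_mod_cast hT
  have hn0 : (0 : ℝ) < n := by exact_mod_cast hn
  have hb0 : (0 : ℝ) < p.b₀ := by exact_mod_cast hb
  have hκ := hs.betaBar_pos hA.mixing.rho_pos hA.contractive.delta_pos
  have hρ := hA.mixing.rho_pos
  have hγ := hs.gamma_pos
  have hη := hs.eta_pos
  refine (mul_le_mul_of_nonneg_left (sum_merit_le hn hA hD hs hb T)
    (by positivity : 0 ≤ 1 / (T : ℝ))).trans_eq ?_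
  set κ := betaBar ρ δ p.γ p.β
  field_simp
  ring

/-- Pure weakening: a factor 2 on the initial gap, the last two terms of C_σ, and 1/(1−γ) ≥ 1. -/
theorem average_merit_le_mainBound :
    1 / (T : ℝ) * ∑ t ∈ Finset.range T, ∫ w, merit S L (iter S p (D w) t) ∂P
      ≤ mainBound n L ρ ω σ δ p.η p.γ p.β p.b₀ T (S.obj p.θ₀ - S.optVal) (initGrad S p P D) := by
  have hT0 : (0 : ℝ) < T := by exact_mod_cast hT
  have hn0 : (0 : ℝ) < n := by exact_mod_cast hn
  have hκ := hs.betaBar_pos hA.mixing.rho_pos hA.contractive.delta_pos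
  have hρ := hA.mixing.rho_pos
  have hω := hA.mixing.omega_pos
  have hδ := hA.contractive.delta_pos
  have hγ := hs.gamma_pos
  have hη := hs.eta_pos
  have hγ1 : 0 < 1 - p.γ := by linarith [hs.gamma_lt_one]
  have hΔ : 0 ≤ S.obj p.θ₀ - S.optVal := sub_nonneg.2 (ciInf_le hA.regular.obj_bddBelow _)
  have hG : 0 ≤ initGrad S p P D := initGrad_nonneg
  refine (average_merit_le hn hA hD hs hb hT).trans ?_
  unfold mainBound
  refine add_le_add (add_le_add_left (add_le_add ?_ ?_) _) ?_
  · refine div_le_div_of_nonneg_left hΔ (by positivity) ?_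
    have : 0 ≤ p.η * T := by positivity
    linarith
  · refine mul_le_mul_of_nonneg_right ?_ (by positivity)
    have h1 : 0 ≤ p.η ^ 2 / p.γ * (6 * L ^ 2 * n * ρ ^ 4 * δ / (25 * ω ^ 2)) := by positivity
    have h2 : 0 ≤ p.η ^ 2 / p.γ ^ 2 * (4 * L ^ 2 * n / ω ^ 2) := by positivity
    have e : 672 * n * (p.η * L) ^ 2 / (ρ * p.γ) ^ 3
      = p.η ^ 2 / p.γ ^ 3 * (672 * L ^ 2 * n / ρ ^ 3) := by field_simp
    rw [e]
    unfold Csigma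
    linarith
  · refine mul_le_mul_of_nonneg_left (div_le_div_of_nonneg_left (by positivity) (by positivity) ?_)
      (by positivity)
    exact mul_le_of_le_one_right (by positivity) (by linarith)

end Averaged

/-! ### The rate -/

section Local

variable {n d : ℕ} {Z Ξ : Type*} [MeasurableSpace Z] [MeasurableSpace Ξ] {S : Setup n d Z Ξ}
  {L ρ ω σ δ : ℝ}

/-- Lipschitz continuity moves the gradient from θ̄ to θ_i at the cost of the consensus error, which
the merit already contains; its factor ½ on the gradient makes the constant 4. -/
lemma average_norm_gradient_sq_le (hn : 1 ≤ n) (hA : S.Assumptions L ρ ω σ δ) (s : State n d) :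
    1 / (n : ℝ) * ∑ i, ‖gradient S.obj (s.θ i)‖ ^ 2 ≤ 4 * merit S L s := by
  have hn0 : (0 : ℝ) < n := by exact_mod_cast hn
  have h : ∀ i, ‖gradient S.obj (s.θ i)‖ ^ 2
      ≤ 2 * ‖gradient S.obj (avgθ s)‖ ^ 2 + 2 * L ^ 2 * ‖s.θ i - avgθ s‖ ^ 2 := fun i => by
    have h1 := norm_gradient_obj_sub_le hn hA.regular hA.smooth hA.boundedVariance (s.θ i) (avgθ s)
    have h2 := norm_le_norm_add_norm_sub' (gradient S.obj (s.θ i)) (gradient S.obj (avgθ s))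
    calc ‖gradient S.obj (s.θ i)‖ ^ 2
        ≤ (‖gradient S.obj (avgθ s)‖ + L * ‖s.θ i - avgθ s‖) ^ 2 := by gcongr; linarith
      _ ≤ _ := by nlinarith [sq_nonneg (‖gradient S.obj (avgθ s)‖ - L * ‖s.θ i - avgθ s‖)]
  calc 1 / (n : ℝ) * ∑ i, ‖gradient S.obj (s.θ i)‖ ^ 2
      ≤ 1 / (n : ℝ) * ∑ i, (2 * ‖gradient S.obj (avgθ s)‖ ^ 2
        + 2 * L ^ 2 * ‖s.θ i - avgθ s‖ ^ 2) := by gcongr; exact h _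
    _ = 2 * ‖gradient S.obj (avgθ s)‖ ^ 2
        + 2 * (L ^ 2 / n * ∑ i, ‖s.θ i - avgθ s‖ ^ 2) := by
      rw [Finset.sum_add_distrib, Finset.sum_const, Finset.card_univ, Fintype.card_fin,
        nsmul_eq_mul, ← Finset.mul_sum]
      field_simp
    _ ≤ _ := by
      have : 0 ≤ L ^ 2 / n * ∑ i, ‖s.θ i - avgθ s‖ ^ 2 := by positivity
      unfold merit
      linarith

variable {p : Params d} {Ω : Type*} [MeasurableSpace Ω] {P : Measure Ω} [IsProbabilityMeasure P]
  {D : Ω → Draws n p.b₀ Z Ξ}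

lemma average_integral_norm_gradient_sq_le (hn : 1 ≤ n) (hA : S.Assumptions L ρ ω σ δ)
    (hD : IsRun S p P D) (t : ℕ) :
    1 / (n : ℝ) * ∑ i, ∫ w, ‖gradient S.obj ((iter S p (D w) t).θ i)‖ ^ 2 ∂P
      ≤ 4 * ∫ w, merit S L (iter S p (D w) t) ∂P := by
  have hi : ∀ i, Integrable (fun w => ‖gradient S.obj ((iter S p (D w) t).θ i)‖ ^ 2) P :=
    fun i => integrable_norm_gradient_obj_sq hn hA ((sqIntState hA hD t).θ i)
  rw [← integral_finsetSum _ fun i _ => hi i, ← integral_const_mul, ← integral_const_mul]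
  exact integral_mono ((integrable_finsetSum _ fun i _ => hi i).const_mul _)
    ((integrable_merit hn hA hD t).const_mul _) fun w => average_norm_gradient_sq_le hn hA _

end Local

/-! ### A lower bound for γ, and exponents in thirds -/

lemma gammaInf_ge {n : ℕ} {ρ ω δ γ : ℝ} (hn : 1 ≤ n) (hρ : 0 < ρ) (hρ1 : ρ ≤ 1) (hω : 0 < ω)
    (hω2 : ω ≤ 2) (hδ : 0 < δ) (hδ1 : δ ≤ 1) (hγ : γ ≤ 1 / 2) :
    δ * ρ / 1500 ≤ gammaInf n ρ ω δ γ := by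
  have hn1 : (1 : ℝ) ≤ n := by exact_mod_cast hn
  have hδρ : δ * ρ ≤ 1 * 1 := by gcongr
  have hω4 : ω ^ 2 ≤ 4 := by nlinarith
  -- With ω² ≤ 4 the last entry of the minimum is the critical one: 259·4 ≤ 0.7·1500.
  have hsqrt : 7 / 10 ≤ √(1 - γ) := Real.le_sqrt_of_sq_le (by linarith)
  refine le_min (le_min ?_ ?_) (le_min ?_ ?_)
  · rw [div_le_div_iff₀ (by norm_num) (by positivity)]
    nlinarith
  · rw [div_le_div_iff₀ (by norm_num) (by positivity)]
    calc δ * ρ * (64 * ω ^ 2) ≤ 1 * ρ * (64 * 4) := by gcongr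
      _ ≤ ρ * 1 * 1500 := by linarith
      _ ≤ ρ * n * 1500 := by gcongr
  · rw [div_le_div_iff₀ (by norm_num) (by positivity)]
    calc δ * ρ * (10 * ω) ≤ δ * 1 * (10 * 2) := by gcongr
      _ ≤ δ * 1500 := by linarith
  · rw [div_le_div_iff₀ (by norm_num) (by positivity)]
    calc δ * ρ * (259 * ω ^ 2) ≤ δ * ρ * (259 * 4) := by gcongr
      _ ≤ δ * ρ * (7 / 10) * 1500 := by nlinarith [mul_pos hδ hρ]
      _ ≤ δ * ρ * √(1 - γ) * 1500 := by gcongr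

/-- A fixed point either exceeds 1/2 or keeps √(1−γ) away from zero. The resulting bound depends
neither on T nor on ω, so T₀ can be chosen before γ. -/
lemma le_of_eq_gammaInf {n : ℕ} {ρ ω δ γ : ℝ} (hn : 1 ≤ n) (hρ : 0 < ρ) (hρ1 : ρ ≤ 1)
    (hω : 0 < ω) (hω2 : ω ≤ 2) (hδ : 0 < δ) (hδ1 : δ ≤ 1) (hγ : γ = gammaInf n ρ ω δ γ) :
    δ * ρ / 1500 ≤ γ := by
  rcases le_total γ (1 / 2) with h | h
  · exact (gammaInf_ge hn hρ hρ1 hω hω2 hδ hδ1 h).trans_eq hγ.symm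
  · have hδρ : δ * ρ ≤ 1 * 1 := by gcongr
    linarith

lemma rpow_div_three {x : ℝ} (hx : 0 ≤ x) (k : ℕ) :
    x ^ ((k : ℝ) / 3) = (x ^ (1 / 3 : ℝ)) ^ k := by
  rw [← Real.rpow_natCast, ← Real.rpow_mul hx]
  ring_nf

lemma rpow_third_pow_three {x : ℝ} (hx : 0 ≤ x) : (x ^ (1 / 3 : ℝ)) ^ 3 = x := by
  have := rpow_div_three hx 3
  norm_num at this
  norm_num
  exact this.symm

lemma rpow_two_thirds {x : ℝ} (hx : 0 ≤ x) : x ^ (2 / 3 : ℝ) = (x ^ (1 / 3 : ℝ)) ^ 2 :=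
  rpow_div_three hx 2

lemma rateBound_eq (n T : ℕ) (L ρ σ δ Δ₀ G₀ : ℝ) :
    rateBound n L ρ σ δ T Δ₀ G₀
      = L * Δ₀ / (((n : ℝ) ^ (1 / 3 : ℝ)) ^ 2 * ((T : ℝ) ^ (1 / 3 : ℝ)) ^ 2)
        + σ ^ 2 / (((n : ℝ) ^ (1 / 3 : ℝ)) ^ 2 * ((T : ℝ) ^ (1 / 3 : ℝ)) ^ 2)
        + n * G₀ / (δ ^ 2 * ρ ^ 4 * T)
        + σ ^ 2 * (n : ℝ) ^ (5 / 3 : ℝ) / (δ ^ 3 * ρ ^ 6 * (T : ℝ) ^ (4 / 3 : ℝ)) := by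
  rw [rateBound, Real.mul_rpow (Nat.cast_nonneg n) (Nat.cast_nonneg T),
    rpow_two_thirds (Nat.cast_nonneg n), rpow_two_thirds (Nat.cast_nonneg T)]

lemma exists_forall_le_rpow_third (K : ℝ) :
    ∃ T₀ : ℕ, ∀ T : ℕ, T₀ ≤ T → 1 ≤ T ∧ 1 ≤ (T : ℝ) ^ (1 / 3 : ℝ) ∧ K ≤ (T : ℝ) ^ (1 / 3 : ℝ) := by
  have h : Filter.Tendsto (fun T : ℕ => (T : ℝ) ^ (1 / 3 : ℝ)) Filter.atTop Filter.atTop :=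
    (tendsto_rpow_atTop (by norm_num)).comp tendsto_natCast_atTop_atTop
  exact Filter.eventually_atTop.1 ((Filter.eventually_ge_atTop 1).and
    ((h.eventually_ge_atTop 1).and (h.eventually_ge_atTop K)))

/-- For small momentum the network rates are not the bottleneck, and β̄ is β itself. -/
lemma betaBar_eq {ρ δ γ β γ₀ : ℝ} (hρ : 0 < ρ) (hρ1 : ρ ≤ 1) (hδ : 0 < δ) (hδ1 : δ ≤ 1)
    (hγ₀ : 0 ≤ γ₀) (hγ : γ₀ ≤ γ) (h : 8 * β ≤ ρ * δ * γ₀) : betaBar ρ δ γ β = β := by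
  refine min_eq_right (le_min ?_ ?_)
  · have : ρ * δ * γ₀ ≤ ρ * 1 * γ := by gcongr
    linarith
  · have : ρ * δ * γ₀ ≤ 1 * δ * γ := by gcongr
    linarith

/-- The right-hand side of the averaged bound for parameters on the scales `n^{1/3} / T^{2/3}`,
`n^{2/3} / (L T^{1/3})`, `T^{1/3} / n^{2/3}`, with `a = n^{1/3}` and `s = T^{1/3}`. -/
lemma bound_le_rate {a s L ρ σ δ γ η β b aβ Aβ aη Aη ab Δ G : ℝ} (ha : 1 ≤ a) (hs : 1 ≤ s)
    (hL : 0 < L) (hρ : 0 < ρ) (hδ : 0 < δ) (hγ : δ * ρ / 1500 ≤ γ)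
    (haβ : 0 < aβ) (haη : 0 < aη) (hab : 0 < ab) (hΔ : 0 ≤ Δ) (hG : 0 ≤ G)
    (hβ1 : aβ * (a / s ^ 2) ≤ β) (hβ2 : β ≤ Aβ * (a / s ^ 2))
    (hη1 : aη * (a ^ 2 / (L * s)) ≤ η) (hη2 : η ≤ Aη * (a ^ 2 / (L * s)))
    (hb : ab * (s / a ^ 2) ≤ b)
    (hK : Aη ^ 2 * a ^ 7 / (ρ * (δ * ρ / 1500)) ^ 3 ≤ s) :
    4 * (Δ / (η * s ^ 3)
        + (4 + 672 * a ^ 3 * (η * L) ^ 2 / (ρ * γ) ^ 3) * (2 * β ^ 2 * σ ^ 2 / (β * a ^ 3))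
        + 4 * σ ^ 2 / (b * β * s ^ 3 * a ^ 3)
        + η ^ 2 / (β * s ^ 3) * (384 * L ^ 2 * G / (ρ ^ 2 * γ ^ 2)))
      ≤ 4 / aη * (L * Δ / (a ^ 2 * s ^ 2)) + 5408 * Aβ * (σ ^ 2 / (a ^ 2 * s ^ 2))
        + 16 / (aβ * ab) * (σ ^ 2 / (a ^ 2 * s ^ 2))
        + 3456000000 * Aη ^ 2 / aβ * (a ^ 3 * G / (δ ^ 2 * ρ ^ 4 * s ^ 3)) := by
  have ha0 : 0 < a := by linarith
  have hs0 : 0 < s := by linarith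
  have hβ : 0 < β := lt_of_lt_of_le (by positivity) hβ1
  have hη : 0 < η := lt_of_lt_of_le (by positivity) hη1
  have hb0 : 0 < b := lt_of_lt_of_le (by positivity) hb
  have hγ₀ : 0 < δ * ρ / 1500 := by positivity
  have hγ0 : 0 < γ := hγ₀.trans_le hγ
  have hl : (η * L) ^ 2 ≤ Aη ^ 2 * a ^ 4 / s ^ 2 := by
    have : η * L ≤ Aη * a ^ 2 / s := by
      calc η * L ≤ Aη * (a ^ 2 / (L * s)) * L := by gcongr
        _ = _ := by field_simp
    calc (η * L) ^ 2 ≤ (Aη * a ^ 2 / s) ^ 2 := by gcongr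
      _ = _ := by field_simp
  have t1 : Δ / (η * s ^ 3) ≤ 1 / aη * (L * Δ / (a ^ 2 * s ^ 2)) := by
    calc Δ / (η * s ^ 3) ≤ Δ / (aη * (a ^ 2 / (L * s)) * s ^ 3) := by gcongr
      _ = _ := by field_simp
  -- The network-dependent noise coefficient decays like s⁻²; `hK` says that T is large enough for
  -- it to be at most 1.
  have t2 : a ^ 3 * (η * L) ^ 2 / (ρ * γ) ^ 3 ≤ 1 := by
    calc a ^ 3 * (η * L) ^ 2 / (ρ * γ) ^ 3
        ≤ a ^ 3 * (Aη ^ 2 * a ^ 4 / s ^ 2) / (ρ * (δ * ρ / 1500)) ^ 3 := by gcongr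
      _ = Aη ^ 2 * a ^ 7 / (ρ * (δ * ρ / 1500)) ^ 3 / s ^ 2 := by ring
      _ ≤ s / s ^ 2 := by gcongr
      _ = 1 / s := by field_simp
      _ ≤ 1 := by rw [div_le_one hs0]; exact hs
  have t3 : β / a ^ 3 ≤ Aβ * (1 / (a ^ 2 * s ^ 2)) := by
    calc β / a ^ 3 ≤ Aβ * (a / s ^ 2) / a ^ 3 := by gcongr
      _ = _ := by field_simp
  have t4 : (4 + 672 * a ^ 3 * (η * L) ^ 2 / (ρ * γ) ^ 3) * (2 * β ^ 2 * σ ^ 2 / (β * a ^ 3))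
      ≤ 1352 * Aβ * (σ ^ 2 / (a ^ 2 * s ^ 2)) := by
    have e1 : 2 * β ^ 2 * σ ^ 2 / (β * a ^ 3) = 2 * σ ^ 2 * (β / a ^ 3) := by field_simp
    have e2 : 4 + 672 * a ^ 3 * (η * L) ^ 2 / (ρ * γ) ^ 3
      = 4 + 672 * (a ^ 3 * (η * L) ^ 2 / (ρ * γ) ^ 3) := by ring
    rw [e1, e2]
    calc _ ≤ (4 + 672 * 1) * (2 * σ ^ 2 * (Aβ * (1 / (a ^ 2 * s ^ 2)))) := by gcongr
      _ = _ := by ring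
  have t5 : 4 * σ ^ 2 / (b * β * s ^ 3 * a ^ 3)
      ≤ 4 / (aβ * ab) * (σ ^ 2 / (a ^ 2 * s ^ 2)) := by
    calc 4 * σ ^ 2 / (b * β * s ^ 3 * a ^ 3)
        ≤ 4 * σ ^ 2 / (ab * (s / a ^ 2) * (aβ * (a / s ^ 2)) * s ^ 3 * a ^ 3) := by gcongr
      _ = _ := by field_simp
  have t6 : η ^ 2 / (β * s ^ 3) * (384 * L ^ 2 * G / (ρ ^ 2 * γ ^ 2))
      ≤ 864000000 * Aη ^ 2 / aβ * (a ^ 3 * G / (δ ^ 2 * ρ ^ 4 * s ^ 3)) := by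
    calc η ^ 2 / (β * s ^ 3) * (384 * L ^ 2 * G / (ρ ^ 2 * γ ^ 2))
        = 384 * G * (η * L) ^ 2 / (β * s ^ 3 * (ρ ^ 2 * γ ^ 2)) := by field_simp
      _ ≤ 384 * G * (Aη ^ 2 * a ^ 4 / s ^ 2)
          / (aβ * (a / s ^ 2) * s ^ 3 * (ρ ^ 2 * (δ * ρ / 1500) ^ 2)) := by gcongr
      _ = _ := by field_simp; ring
  have e1 : 4 / aη * (L * Δ / (a ^ 2 * s ^ 2)) = 4 * (1 / aη * (L * Δ / (a ^ 2 * s ^ 2))) := by ring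
  have e2 : 16 / (aβ * ab) * (σ ^ 2 / (a ^ 2 * s ^ 2))
    = 4 * (4 / (aβ * ab) * (σ ^ 2 / (a ^ 2 * s ^ 2))) := by ring
  have e3 : 3456000000 * Aη ^ 2 / aβ * (a ^ 3 * G / (δ ^ 2 * ρ ^ 4 * s ^ 3))
    = 4 * (864000000 * Aη ^ 2 / aβ * (a ^ 3 * G / (δ ^ 2 * ρ ^ 4 * s ^ 3))) := by ring
  rw [e1, e2, e3]
  linarith

/-! ### The bound of part (b) -/

section Rate

variable {n d : ℕ} {Z Ξ : Type*} [MeasurableSpace Z] [MeasurableSpace Ξ] {S : Setup n d Z Ξ}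
  {L ρ ω σ δ : ℝ}

theorem average_norm_gradient_sq_le_rateBound (hn : 1 ≤ n) (hL : 0 < L)
    (hA : S.Assumptions L ρ ω σ δ) {aβ Aβ aη Aη ab : ℝ} (haβ : 0 < aβ) (haη : 0 < aη)
    (hab : 0 < ab) : ∃ T₀ : ℕ, ∀ T : ℕ, T₀ ≤ T → ∀ p : Params d,
      StepSizes n L ρ ω δ p.η p.γ p.β → p.γ = gammaInf n ρ ω δ p.γ →
      aβ * betaScale n T ≤ p.β → p.β ≤ Aβ * betaScale n T →
      aη * etaScale n L T ≤ p.η → p.η ≤ Aη * etaScale n L T →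
      1 ≤ p.b₀ → ab * batchScale n T ≤ p.b₀ →
      ∀ (Ω : Type*) [MeasurableSpace Ω] (P : Measure Ω) [IsProbabilityMeasure P]
        (D : Ω → Draws n p.b₀ Z Ξ), IsRun S p P D →
      1 / (T : ℝ) * ∑ t ∈ Finset.range T, 1 / (n : ℝ) *
          ∑ i, ∫ w, ‖gradient S.obj ((iter S p (D w) t).θ i)‖ ^ 2 ∂P
        ≤ (4 / aη + 5408 * Aβ + 16 / (aβ * ab) + 3456000000 * Aη ^ 2 / aβ)
          * rateBound n L ρ σ δ T (S.obj p.θ₀ - S.optVal) (initGrad S p P D) := by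
  have hρ := hA.mixing.rho_pos
  have hδ := hA.contractive.delta_pos
  have hn1 : (1 : ℝ) ≤ n := by exact_mod_cast hn
  have ha : 1 ≤ (n : ℝ) ^ (1 / 3 : ℝ) := Real.one_le_rpow hn1 (by norm_num)
  have ha3 : ((n : ℝ) ^ (1 / 3 : ℝ)) ^ 3 = n := rpow_third_pow_three (Nat.cast_nonneg n)
  -- The first entry tames the network term in the noise coefficient; the second forces β̄ = β.
  obtain ⟨T₀, hT₀⟩ := exists_forall_le_rpow_third
    (max (Aη ^ 2 * ((n : ℝ) ^ (1 / 3 : ℝ)) ^ 7 / (ρ * (δ * ρ / 1500)) ^ 3)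
      (8 * (Aβ * (n : ℝ) ^ (1 / 3 : ℝ)) / (ρ * δ * (δ * ρ / 1500))))
  refine ⟨T₀, fun T hT p hs hγ hβ1 hβ2 hη1 hη2 hb hb1 Ω _ P _ D hD => ?_⟩
  obtain ⟨hT1, hs1, hK⟩ := hT₀ T hT
  have hs3 : ((T : ℝ) ^ (1 / 3 : ℝ)) ^ 3 = T := rpow_third_pow_three (Nat.cast_nonneg T)
  rw [betaScale, rpow_two_thirds (Nat.cast_nonneg T)] at hβ1 hβ2
  rw [etaScale, rpow_two_thirds (Nat.cast_nonneg n)] at hη1 hη2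
  rw [batchScale, rpow_two_thirds (Nat.cast_nonneg n)] at hb1
  rw [rateBound_eq]
  have hΔ : 0 ≤ S.obj p.θ₀ - S.optVal := sub_nonneg.2 (ciInf_le hA.regular.obj_bddBelow _)
  have hG : 0 ≤ initGrad S p P D := initGrad_nonneg
  have hγ₀ := le_of_eq_gammaInf hn hρ hA.mixing.rho_le_one hA.mixing.omega_pos
    hA.mixing.omega_le_two hδ hA.contractive.delta_le_one hγ
  have hmain : 1 / (T : ℝ) * ∑ t ∈ Finset.range T, 1 / (n : ℝ) *
      ∑ i, ∫ w, ‖gradient S.obj ((iter S p (D w) t).θ i)‖ ^ 2 ∂P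
      ≤ 4 * (1 / (T : ℝ) * ∑ t ∈ Finset.range T, ∫ w, merit S L (iter S p (D w) t) ∂P) := by
    rw [mul_left_comm, Finset.mul_sum _ _ (4 : ℝ)]
    exact mul_le_mul_of_nonneg_left (Finset.sum_le_sum fun t _ =>
      average_integral_norm_gradient_sq_le hn hA hD t) (by positivity)
  refine hmain.trans ((mul_le_mul_of_nonneg_left (average_merit_le hn hA hD hs hb hT1)
    (by norm_num)).trans ?_)
  have hβ := hs.beta_pos
  have hAβ : 0 < Aβ := by
    have h1 : 0 < (n : ℝ) ^ (1 / 3 : ℝ) / ((T : ℝ) ^ (1 / 3 : ℝ)) ^ 2 := by positivity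
    exact pos_of_mul_pos_left (hβ.trans_le hβ2) h1.le
  have hκ : betaBar ρ δ p.γ p.β = p.β := by
    refine betaBar_eq hρ hA.mixing.rho_le_one hδ hA.contractive.delta_le_one
      (by positivity) hγ₀ ?_
    have h1 := (le_max_right _ _).trans hK
    rw [div_le_iff₀ (by positivity)] at h1
    have h2 : p.β * ((T : ℝ) ^ (1 / 3 : ℝ)) ^ 2 ≤ Aβ * (n : ℝ) ^ (1 / 3 : ℝ) := by
      rw [← le_div_iff₀ (by positivity), mul_div_assoc]
      exact hβ2
    have h3 : p.β * (T : ℝ) ^ (1 / 3 : ℝ) ≤ p.β * ((T : ℝ) ^ (1 / 3 : ℝ)) ^ 2 :=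
      mul_le_mul_of_nonneg_left (le_self_pow₀ hs1 two_ne_zero) hβ.le
    refine le_of_mul_le_mul_left (a := (T : ℝ) ^ (1 / 3 : ℝ)) ?_ (by linarith)
    linarith
  rw [hκ]
  have hbd := bound_le_rate (σ := σ) ha hs1 hL hρ hδ hγ₀ haβ haη hab hΔ hG hβ1 hβ2 hη1 hη2 hb1
    ((le_max_left _ _).trans hK)
  rw [ha3, hs3] at hbd
  refine hbd.trans ?_
  set R₁ := L * (S.obj p.θ₀ - S.optVal) /
    (((n : ℝ) ^ (1 / 3 : ℝ)) ^ 2 * ((T : ℝ) ^ (1 / 3 : ℝ)) ^ 2) with hR₁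
  set R₂ := σ ^ 2 / (((n : ℝ) ^ (1 / 3 : ℝ)) ^ 2 * ((T : ℝ) ^ (1 / 3 : ℝ)) ^ 2)
  set R₃ := n * initGrad S p P D / (δ ^ 2 * ρ ^ 4 * T) with hR₃
  set R₄ := σ ^ 2 * (n : ℝ) ^ (5 / 3 : ℝ) / (δ ^ 3 * ρ ^ 6 * (T : ℝ) ^ (4 / 3 : ℝ))
  have r1 : 0 ≤ R₁ := by positivity
  have r2 : 0 ≤ R₂ := by positivity
  have r3 : 0 ≤ R₃ := by positivity
  have r4 : 0 ≤ R₄ := by positivity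
  -- The fourth term of the rate is not needed; it only enlarges the right side.
  calc 4 / aη * R₁ + 5408 * Aβ * R₂ + 16 / (aβ * ab) * R₂ + 3456000000 * Aη ^ 2 / aβ * R₃
      ≤ 4 / aη * (R₁ + R₂ + R₃ + R₄) + 5408 * Aβ * (R₁ + R₂ + R₃ + R₄)
        + 16 / (aβ * ab) * (R₁ + R₂ + R₃ + R₄)
        + 3456000000 * Aη ^ 2 / aβ * (R₁ + R₂ + R₃ + R₄) := by
        gcongr <;> linarith
    _ = _ := by ring

end Rate

/-! ### Admissible parameters -/

/-- γ_∞ depends continuously on γ, is positive at γ = 0, and is at most 0 at γ = 1 because of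
√(1−γ); so it crosses the diagonal. -/
lemma exists_eq_gammaInf {n : ℕ} {ρ ω δ : ℝ} (hn : 1 ≤ n) (hρ : 0 < ρ) (hω : 0 < ω)
    (hδ : 0 < δ) : ∃ γ : ℝ, 0 < γ ∧ γ ≤ 1 ∧ γ = gammaInf n ρ ω δ γ := by
  have hn0 : (0 : ℝ) < n := by exact_mod_cast hn
  have hc : Continuous fun γ => gammaInf n ρ ω δ γ - γ := by
    unfold gammaInf
    fun_prop
  have h0 : 0 < gammaInf n ρ ω δ 0 := by
    simp only [gammaInf, sub_zero, Real.sqrt_one]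
    positivity
  have h1 : gammaInf n ρ ω δ 1 ≤ 0 :=
    ((min_le_right _ _).trans (min_le_right _ _)).trans_eq (by simp)
  obtain ⟨γ, hγ, h⟩ := intermediate_value_Icc' (zero_le_one' ℝ) hc.continuousOn
    (show (0 : ℝ) ∈ _ from ⟨by linarith, by linarith⟩)
  have hγeq : γ = gammaInf n ρ ω δ γ := (sub_eq_zero.1 h).symm
  refine ⟨γ, lt_of_le_of_ne hγ.1 fun h2 => ?_, hγ.2, hγeq⟩
  rw [← h2] at hγeq
  exact h0.ne hγeq

lemma Cgbar_le {n : ℕ} {L ρ ω γ β : ℝ} (hβ0 : 0 ≤ β) (hβ1 : β ≤ 1)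
    (hτ0 : 0 ≤ ρ * γ) (hτ1 : ρ * γ ≤ 1) : Cgbar n L ρ ω γ β
      ≤ L ^ 2 * (8 + n / (ρ * γ) * (96 + 141 / 400 * (ρ ^ 2 / ω ^ 2))) := by
  have h1 : (1 - β) ^ 2 ≤ 1 := pow_le_one₀ (by linarith) (by linarith)
  have h2 : (1 - ρ * γ) ^ 2 ≤ 1 := pow_le_one₀ (by linarith) (by linarith)
  have h3 : 8 * (1 - β) ^ 2 * L ^ 2 * (1 - ρ * γ) ^ 2 ≤ 8 * 1 * L ^ 2 * 1 := by gcongr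
  have e : L ^ 2 * n / (ρ * γ) * (96 + 141 / 400 * (ρ ^ 2 / ω ^ 2))
    = L ^ 2 * (n / (ρ * γ) * (96 + 141 / 400 * (ρ ^ 2 / ω ^ 2))) := by ring
  unfold Cgbar
  rw [e]
  linarith

/-- η_∞ is bounded below once β ≤ 1/2, so large T suffices for it. The square-root bound has the
same order in T as η, so there c_η has to be small. -/
theorem exists_stepSizes {n : ℕ} {L ρ ω δ γ : ℝ} (hn : 1 ≤ n) (hL : 0 < L) (hρ : 0 < ρ)
    (hρ1 : ρ ≤ 1) (hω : 0 < ω) (hδ : 0 < δ) (hδ1 : δ ≤ 1) (hγ0 : 0 < γ) (hγ1 : γ ≤ 1)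
    (hγ : γ = gammaInf n ρ ω δ γ) {cβ : ℝ} (hcβ : 0 < cβ) :
    ∃ c : ℝ, 0 < c ∧ ∀ cη : ℝ, 0 < cη → cη ≤ c → ∃ T₀ : ℕ, ∀ T : ℕ, T₀ ≤ T →
      StepSizes n L ρ ω δ (cη * etaScale n L T) γ (cβ * betaScale n T) := by
  have hn0 : (0 : ℝ) < n := by exact_mod_cast hn
  have hτ0 : 0 < ρ * γ := by positivity
  have hτ1 : ρ * γ ≤ 1 := by
    calc ρ * γ ≤ 1 * 1 := by gcongr
      _ = 1 := one_mul _
  set a := (n : ℝ) ^ (1 / 3 : ℝ) with ha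
  have ha0 : 0 < a := by positivity
  have ha3 : a ^ 3 = n := rpow_third_pow_three (Nat.cast_nonneg n)
  set M := 8 + n / (ρ * γ) * (96 + 141 / 400 * (ρ ^ 2 / ω ^ 2)) with hM
  have hM0 : 0 < M := by positivity
  -- L²M bounds C_ḡ for every β in [0,1]. With βn = c_β a⁴/s² the square-root bound is at least
  -- √(c_β/(8M))·a²/(Ls), which is this constant times the scale of η.
  refine ⟨√(cβ / (8 * M)), by positivity, fun cη hcη hcη' => ?_⟩
  set k := γ * min (√(1 / n) * (√(γ * ρ ^ 3) / 45)) (ρ ^ 2 / (240 * ω)) with hk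
  have hk0 : 0 < k := by positivity
  obtain ⟨T₀, hT₀⟩ := exists_forall_le_rpow_third
    (max (cη * a ^ 2 / k) (max (2 * (cβ * a)) (8 * (cβ * a) / (ρ * δ * γ))))
  refine ⟨T₀, fun T hT => ?_⟩
  obtain ⟨-, hs1, hK⟩ := hT₀ T hT
  set s := (T : ℝ) ^ (1 / 3 : ℝ) with hs
  have hs0 : 0 < s := by linarith
  have hss : s ≤ s ^ 2 := le_self_pow₀ hs1 two_ne_zero
  rw [betaScale, rpow_two_thirds (Nat.cast_nonneg T), etaScale,
    rpow_two_thirds (Nat.cast_nonneg n), ← ha, ← hs]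
  have hβ0 : 0 < cβ * (a / s ^ 2) := by positivity
  have hK1 := (le_max_left _ _).trans hK
  have hK2 := ((le_max_left _ _).trans (le_max_right _ _)).trans hK
  have hK3 := ((le_max_right _ _).trans (le_max_right _ _)).trans hK
  have hβ2 : cβ * (a / s ^ 2) ≤ 1 / 2 := by
    rw [← mul_div_assoc, div_le_div_iff₀ (by positivity) (by norm_num)]
    linarith
  have hκ : betaBar ρ δ γ (cβ * (a / s ^ 2)) = cβ * (a / s ^ 2) := by
    refine betaBar_eq hρ hρ1 hδ hδ1 hγ0.le le_rfl ?_
    rw [div_le_iff₀ (by positivity)] at hK3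
    rw [← mul_div_assoc, ← mul_div_assoc, div_le_iff₀ (by positivity)]
    have : s * (ρ * δ * γ) ≤ s ^ 2 * (ρ * δ * γ) := by gcongr
    linarith
  refine ⟨by positivity, hγ0, hγ1, hβ0, by linarith, hγ.le, fun _ => le_min ?_ ?_⟩
  · have h1 : k / L ≤ etaInf n L ρ ω γ (cβ * (a / s ^ 2)) := by
      rw [hk, etaInf, mul_div_right_comm]
      have h2 : 1 / (n : ℝ) ≤ (1 - cβ * (a / s ^ 2)) / (cβ * (a / s ^ 2) * n) := by
        rw [div_le_div_iff₀ hn0 (by positivity)]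
        have : cβ * (a / s ^ 2) * n ≤ (1 - cβ * (a / s ^ 2)) * n :=
          mul_le_mul_of_nonneg_right (by linarith) hn0.le
        linarith
      gcongr
    refine le_trans ?_ h1
    rw [div_le_iff₀ hk0] at hK1
    rw [← mul_div_assoc, div_le_div_iff₀ (by positivity) hL]
    have := mul_le_mul_of_nonneg_right hK1 hL.le
    linarith
  · rw [hκ]
    have hC := Cgbar_le (n := n) (L := L) (ω := ω) hβ0.le (by linarith : cβ * (a / s ^ 2) ≤ 1)
      hτ0.le hτ1
    rw [← hM] at hC
    have hC0 : 0 < Cgbar n L ρ ω γ (cβ * (a / s ^ 2)) :=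
      lt_of_lt_of_le (by positivity) (StepSizes.Cgbar_ge hn hρ hω hγ0)
    have hc2 : cη ^ 2 ≤ cβ / (8 * M) := (Real.le_sqrt' hcη).1 hcη'
    refine Real.le_sqrt_of_sq_le ?_
    calc (cη * (a ^ 2 / (L * s))) ^ 2 = cη ^ 2 * (a ^ 4 / (L ^ 2 * s ^ 2)) := by field_simp
      _ ≤ cβ / (8 * M) * (a ^ 4 / (L ^ 2 * s ^ 2)) := by gcongr
      _ = cβ * (a / s ^ 2) * n / (8 * (L ^ 2 * M)) := by rw [← ha3]; field_simp
      _ ≤ _ := by gcongr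

end DoCoM

end

/-! ### The three claims together -/

theorem theorem1 :
    -- the non-asymptotic bound
    (∀ (n d : ℕ), 1 ≤ n →
      ∀ (Z : Type*) (Ξ : Type*) [MeasurableSpace Z] [MeasurableSpace Ξ]
        (S : DoCoM.Setup n d Z Ξ) (L ρ ω σ δ : ℝ), S.Assumptions L ρ ω σ δ →
      ∀ (p : DoCoM.Params d), 1 ≤ p.b₀ → DoCoM.StepSizes n L ρ ω δ p.η p.γ p.β →
      ∀ (Ω : Type*) [MeasurableSpace Ω] (P : MeasureTheory.Measure Ω)
        [MeasureTheory.IsProbabilityMeasure P] (D : Ω → DoCoM.Draws n p.b₀ Z Ξ),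
        DoCoM.IsRun S p P D →
      MeasureTheory.Integrable (fun ω => ∑ i, ‖(DoCoM.iter S p (D ω) 0).g i‖ ^ 2) P ∧
      (∀ t, MeasureTheory.Integrable (fun ω => DoCoM.merit S L (DoCoM.iter S p (D ω) t)) P) ∧
      ∀ T : ℕ, 1 ≤ T →
        1 / (T : ℝ) * ∑ t ∈ Finset.range T, ∫ ω, DoCoM.merit S L (DoCoM.iter S p (D ω) t) ∂P ≤
          DoCoM.mainBound n L ρ ω σ δ p.η p.γ p.β p.b₀ T
            (S.obj p.θ₀ - S.optVal) (DoCoM.initGrad S p P D)) ∧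
    -- the rate, with a constant `C` that depends only on the constants in the parameter choices
    (∀ aβ Aβ aη Aη ab : ℝ, 0 < aβ → 0 < aη → 0 < ab →
      ∃ C : ℝ, ∀ (n d : ℕ), 1 ≤ n →
      ∀ (Z : Type*) (Ξ : Type*) [MeasurableSpace Z] [MeasurableSpace Ξ]
        (S : DoCoM.Setup n d Z Ξ) (L ρ ω σ δ : ℝ), 0 < L → S.Assumptions L ρ ω σ δ →
      ∃ T₀ : ℕ, ∀ T : ℕ, T₀ ≤ T → ∀ (p : DoCoM.Params d),
        DoCoM.StepSizes n L ρ ω δ p.η p.γ p.β →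
        p.γ = DoCoM.gammaInf n ρ ω δ p.γ →
        aβ * DoCoM.betaScale n T ≤ p.β → p.β ≤ Aβ * DoCoM.betaScale n T →
        aη * DoCoM.etaScale n L T ≤ p.η → p.η ≤ Aη * DoCoM.etaScale n L T →
        1 ≤ p.b₀ → ab * DoCoM.batchScale n T ≤ p.b₀ →
      ∀ (Ω : Type*) [MeasurableSpace Ω] (P : MeasureTheory.Measure Ω)
        [MeasureTheory.IsProbabilityMeasure P] (D : Ω → DoCoM.Draws n p.b₀ Z Ξ),
        DoCoM.IsRun S p P D →
      (∀ t i, MeasureTheory.Integrable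
        (fun ω => ‖gradient S.obj ((DoCoM.iter S p (D ω) t).θ i)‖ ^ 2) P) ∧
      1 / (T : ℝ) * ∑ t ∈ Finset.range T, 1 / (n : ℝ) *
          ∑ i, ∫ ω, ‖gradient S.obj ((DoCoM.iter S p (D ω) t).θ i)‖ ^ 2 ∂P ≤
        C * DoCoM.rateBound n L ρ σ δ T (S.obj p.θ₀ - S.optVal) (DoCoM.initGrad S p P D)) ∧
    -- such parameter choices are admissible for all large `T`
    (∀ (n : ℕ) (L ρ ω δ : ℝ), 1 ≤ n → 0 < L → 0 < ρ → ρ ≤ 1 → 0 < ω → ω ≤ 2 → 0 < δ → δ ≤ 1 →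
      ∃ γ : ℝ, γ = DoCoM.gammaInf n ρ ω δ γ ∧
        ∀ cβ : ℝ, 0 < cβ → ∃ c : ℝ, 0 < c ∧ ∀ cη : ℝ, 0 < cη → cη ≤ c →
          ∃ T₀ : ℕ, ∀ T : ℕ, T₀ ≤ T →
            DoCoM.StepSizes n L ρ ω δ (cη * DoCoM.etaScale n L T) γ
              (cβ * DoCoM.betaScale n T)) := by
  refine ⟨?_, ?_, ?_⟩
  · intro n d hn Z Ξ _ _ S L ρ ω σ δ hA p hb hs Ω _ P _ D hD
    exact ⟨(DoCoM.sqIntState hA hD 0).g.integrable_sq, DoCoM.integrable_merit hn hA hD,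
      fun T hT => DoCoM.average_merit_le_mainBound hn hA hD hs hb hT⟩
  · intro aβ Aβ aη Aη ab haβ haη hab
    refine ⟨4 / aη + 5408 * Aβ + 16 / (aβ * ab) + 3456000000 * Aη ^ 2 / aβ, ?_⟩
    intro n d hn Z Ξ _ _ S L ρ ω σ δ hL hA
    obtain ⟨T₀, h⟩ := DoCoM.average_norm_gradient_sq_le_rateBound hn hL hA haβ haη hab
      (Aβ := Aβ) (Aη := Aη)
    refine ⟨T₀, fun T hT p hs hγ hβ1 hβ2 hη1 hη2 hb hb1 Ω _ P _ D hD => ⟨fun t i => ?_,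
      h T hT p hs hγ hβ1 hβ2 hη1 hη2 hb hb1 Ω P D hD⟩⟩
    exact DoCoM.integrable_norm_gradient_obj_sq hn hA ((DoCoM.sqIntState hA hD t).θ i)
  · intro n L ρ ω δ hn hL hρ hρ1 hω _ hδ hδ1
    obtain ⟨γ, hγ0, hγ1, hγ⟩ := DoCoM.exists_eq_gammaInf hn hρ hω hδ
    exact ⟨γ, hγ, fun cβ hcβ =>
      DoCoM.exists_stepSizes hn hL hρ hρ1 hω hδ hδ1 hγ0 hγ1 hγ hcβ⟩
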